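/- Let $G$ be a finite group and $X$ a topological space with a continuous left $G$-action. Let $R(X)$ be the category of retractive spaces $X \xrightarrow{i} Y \xrightarrow{p} X$, $p i = \mathrm{id}$ (morphisms are maps under and over $X$), with the strict $G$-action $g\cdot(Y,i,p)=(Y, i\circ g^{-1}, g\circ p)$ and with sum $\oplus$ given by gluing along $X$. Let $\mathcal{E}G$ be the category with object set $G$ and exactly one morphism between any two objects. For a finite $G$-set $S$, regarded as a discrete category, let $\mathrm{Cat}(S\times\mathcal{E}G,R(X))^G$ be the category of strictly $G$-equivariant functors and $G$-equivariant natural transformations. For a map $f\colon S\to T$ of finite $G$-sets, put $(f^*F)(s,g)=F(f(s),g)$ and $(f_!F)(t,g)=g\bigl(\bigoplus_{i\in f^{-1}(g^{-1}t)}F(i,1)\bigr)$, where under the canonical isomorphism $(f_!F)(t,g)\cong\bigoplus_{j\in f^{-1}(t)}F(j,g)$ the morphism $(f_!F)(t,g\to h)$ is the sum of the morphisms $F(j,g\to h)$. For $H\le G$ put $R(X)^{hH}=\mathrm{Cat}(G/H\times\mathcal{E}G,R(X))^G$. It is equivalent to the category of retractive $H$-spaces over $X$, by sending $F$ to $F(eH,e)$,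 on which $h\in H$ acts by the map of spaces underlying $hF(eH,e)=F(eH,h)\to F(eH,e)$. A relative $H$-cell complex is a map of $H$-spaces that is a sequential colimit of attachments of cells $H/N\times S^{n-1}\to H/N\times D^n$ ($N\le H$, $n\ge 0$). Let $R^H(X)$ be the category of retractive $H$-spaces $Y$ over $X$ for which $X\to Y$ is a relative $H$-cell complex. A map is a weak equivalence if it induces weak homotopy equivalences on the fixed points of all subgroups of $H$. A map $Y\to Z$ is a cofibration if it has the $H$-equivariant fiberwise homotopy extension property: the canonical map $Y\times I\cup_{Y\times 1}Z\times 1\to Z\times I$ has an $H$-equivariant retraction over $X$. Let $R^H_{hf}(X)$ be the full subcategory of $R^H(X)$ on the objects that are retracts, in the localization of $R^H(X)$ at the weak equivalences, of relative $H$-cell complexes with finitely many cells; regard it as a full subcategory of $R(X)^{hH}$ via the above equivalence. **Proposition.** For all subgroups $H,K\le G$ and every span $G/H\xleftarrow{p}S\xrightarrow{q}G/K$ of finite $G$-sets, the functor $(-*S)=q_!p^*\colon R(X)^{hH}\to R(X)^{hK}$ restricts to an exact functor $R^H_{hf}(X)\to R^K_{hf}(X)$. That is, it sends objects of $R^H_{hf}(X)$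 to objects of $R^K_{hf}(X)$ and, on $R^H_{hf}(X)$, it preserves zero objects, cofibrations, weak equivalences, and pushouts along cofibrations (where pushouts are formed in $R(X)^{hH}$ and $R(X)^{hK}$). -/

import Mathlib

open CategoryTheory CategoryTheory.Limits HomotopicalAlgebra

universe u v w

namespace SpanTransfer

noncomputable section

/-! ### Categories with a strict action of a group -/

/-- A strict left action of `G` on a category `C` by functors. -/
class StrictAction (G : Type u) [Group G] (C : Type*) [Category C] where
  /-- The functor by which `g` acts. -/
  act : G → C ⥤ C
  act_one : act 1 = 𝟭 C
  act_mul : ∀ g h : G, act (g * h) = act h ⋙ act g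

open StrictAction

section Action

variable {G : Type u} [Group G] {C : Type*} [Category C] [StrictAction G C]

lemma act_inv_comp (g : G) : act (C := C) g⁻¹ ⋙ act g = 𝟭 C := by
  rw [← act_mul, mul_inv_cancel, act_one]

lemma act_comp_inv (g : G) : act (C := C) g ⋙ act g⁻¹ = 𝟭 C := by
  rw [← act_mul, inv_mul_cancel, act_one]

instance act_isEquivalence (g : G) : (act (C := C) g).IsEquivalence :=
  (CategoryTheory.Equivalence.mk (act (C := C) g) (act g⁻¹)
    (eqToIso (act_comp_inv g).symm) (eqToIso (act_inv_comp g))).isEquivalence_functor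

end Action

/-! ### The category `S × EG` and equivariant functors out of it -/

/-- Objects of the category `S × EG`, for a set `S` and a group `G`. -/
@[ext]
structure ProdEG (S : Type v) (G : Type u) where
  pt : S
  elt : G

namespace ProdEG

variable {S : Type v} {T : Type w} {G : Type u}

/-- `S` is a discrete category, and `EG` has a unique morphism between any two objects, so there is
a (unique) morphism from `(s, g)` to `(s', g')` exactly when `s = s'`. -/
instance : Category (ProdEG S G) where
  Hom x y := PLift (x.pt = y.pt)
  id _ := ⟨rfl⟩
  comp f g := ⟨f.down.trans g.down⟩

instance (x y : ProdEG S G) : Subsingleton (x ⟶ y) :=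
  inferInstanceAs (Subsingleton (PLift (x.pt = y.pt)))

/-- The unique morphism `(s, g) ⟶ (s', g')` when `s = s'`. -/
def homMk {x y : ProdEG S G} (h : x.pt = y.pt) : x ⟶ y := ⟨h⟩

lemma hom_eq {x y : ProdEG S G} (f : x ⟶ y) : x.pt = y.pt := f.down

variable [Group G] [MulAction G S] [MulAction G T]

/-- The diagonal action of `k : G` on `S × EG`. -/
abbrev shift (S : Type v) [MulAction G S] (k : G) : ProdEG S G ⥤ ProdEG S G where
  obj x := ⟨k • x.pt, k * x.elt⟩
  map f := homMk (congrArg (k • ·) (hom_eq f))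

/-- The functor `S × EG ⥤ T × EG` induced by an equivariant map `S → T`. -/
abbrev mapPt (f : S →[G] T) : ProdEG S G ⥤ ProdEG T G where
  obj x := ⟨f x.pt, x.elt⟩
  map e := homMk (congrArg f (hom_eq e))

lemma shift_mapPt (f : S →[G] T) (k : G) :
    shift S k ⋙ mapPt f = mapPt f ⋙ shift T k :=
  CategoryTheory.Functor.ext (fun x => by simp [shift, mapPt, map_smul])
    (fun _ _ _ => Subsingleton.elim _ _)

end ProdEG

open ProdEG

/-- Objects of `Cat(S × EG, C)^G`: functors which commute strictly with the actions of `G`. -/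
structure EqFunctor (G : Type u) [Group G] (S : Type v) [MulAction G S]
    (C : Type*) [Category C] [StrictAction G C] where
  functor : ProdEG S G ⥤ C
  equivariant : ∀ k : G, shift S k ⋙ functor = functor ⋙ act k

namespace EqFunctor

variable {G : Type u} [Group G] {S : Type v} [MulAction G S] {T : Type w} [MulAction G T]
  {C : Type*} [Category C] [StrictAction G C]

lemma equivariant_obj (F : EqFunctor G S C) (k : G) (x : ProdEG S G) :
    F.functor.obj ((shift S k).obj x) = (act k).obj (F.functor.obj x) :=
  CategoryTheory.Functor.congr_obj (F.equivariant k) x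

lemma equivariant_map (F : EqFunctor G S C) (k : G) {x y : ProdEG S G} (e : x ⟶ y) :
    F.functor.map ((shift S k).map e) =
      eqToHom (F.equivariant_obj k x) ≫ (act k).map (F.functor.map e) ≫
        eqToHom (F.equivariant_obj k y).symm :=
  CategoryTheory.Functor.congr_hom (F.equivariant k) e

/-- Morphisms of `Cat(S × EG, C)^G`: natural transformations fixed by `G`. -/
@[ext]
structure Hom (F F' : EqFunctor G S C) where
  natTrans : F.functor ⟶ F'.functor
  equivariant : ∀ (k : G) (x : ProdEG S G),
    natTrans.app ((shift S k).obj x) =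
      eqToHom (F.equivariant_obj k x) ≫ (act k).map (natTrans.app x) ≫
        eqToHom (F'.equivariant_obj k x).symm

instance : Category (EqFunctor G S C) where
  Hom F F' := Hom F F'
  id F := ⟨𝟙 _, fun k x => by simp⟩
  comp α β := ⟨α.natTrans ≫ β.natTrans, fun k x => by
    simp [α.equivariant, β.equivariant]⟩
  id_comp _ := Hom.ext (Category.id_comp _)
  comp_id _ := Hom.ext (Category.comp_id _)
  assoc _ _ _ := Hom.ext (Category.assoc _ _ _)

@[ext]
lemma hom_ext {F F' : EqFunctor G S C} (α β : F ⟶ F') (h : α.natTrans = β.natTrans) : α = β :=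
  Hom.ext h

@[simp] lemma id_natTrans (F : EqFunctor G S C) : (𝟙 F : F ⟶ F).natTrans = 𝟙 F.functor := rfl

@[simp] lemma comp_natTrans {F F' F'' : EqFunctor G S C} (α : F ⟶ F') (β : F' ⟶ F'') :
    (α ≫ β).natTrans = α.natTrans ≫ β.natTrans := rfl

/-- The pullback (restriction) functor `f^*`, given by `(f^* F)(s, g) = F(f s, g)`. -/
def pullback (C : Type*) [Category C] [StrictAction G C] (f : S →[G] T) :
    EqFunctor G T C ⥤ EqFunctor G S C where
  obj F :=
    { functor := mapPt f ⋙ F.functor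
      equivariant := fun k => by
        rw [← CategoryTheory.Functor.assoc, shift_mapPt, CategoryTheory.Functor.assoc,
          F.equivariant, CategoryTheory.Functor.assoc] }
  map α :=
    { natTrans := CategoryTheory.Functor.whiskerLeft (mapPt f) α.natTrans
      equivariant := fun k x => by
        have hx : (mapPt f).obj ((shift S k).obj x) =
            (shift T k).obj ((mapPt f).obj x) :=
          CategoryTheory.Functor.congr_obj (shift_mapPt f k) x
        have h := NatTrans.congr α.natTrans hx
        simp only [CategoryTheory.Functor.whiskerLeft_app]
        rw [h, α.equivariant, eqToHom_map, eqToHom_map]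
        simp }

/-! ### The pushforward -/

section Pushforward

/-- The fibre of `f` over `t`. -/
abbrev Fib (f : S →[G] T) (t : T) : Type v := { s : S // f s = t }

/-- The restriction to the fibre over `t` of `F(-, 1)`. -/
abbrev fibObj (f : S →[G] T) (F : EqFunctor G S C) (t : T) : Fib f t → C :=
  fun i => F.functor.obj ⟨i.1, 1⟩

lemma fib_inv_smul {f : S →[G] T} {t : T} (g : G) {j : S} (h : f j = t) :
    f (g⁻¹ • j) = g⁻¹ • t := by rw [map_smul, h]

lemma fib_smul {f : S →[G] T} {t : T} (g : G) (i : Fib f (g⁻¹ • t)) : f (g • i.1) = t := by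
  rw [map_smul, i.2, smul_inv_smul]

lemma smul_obj (F : EqFunctor G S C) (k g : G) (j : S) :
    F.functor.obj ⟨k • j, k * g⟩ = (act k).obj (F.functor.obj ⟨j, g⟩) :=
  F.equivariant_obj k ⟨j, g⟩

lemma obj_eq_act (F : EqFunctor G S C) (g : G) (j : S) :
    F.functor.obj ⟨j, g⟩ = (act g).obj (F.functor.obj ⟨g⁻¹ • j, 1⟩) := by
  rw [← smul_obj, smul_inv_smul, mul_one]

lemma act_obj_eq (F : EqFunctor G S C) (g : G) (j : S) :
    (act g).obj (F.functor.obj ⟨j, 1⟩) = F.functor.obj ⟨g • j, g⟩ := by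
  rw [← smul_obj, mul_one]

lemma natTrans_smul {F F' : EqFunctor G S C} (α : F ⟶ F') (g : G) (j : S) :
    α.natTrans.app ⟨j, g⟩ = eqToHom (F.obj_eq_act g j) ≫
      (act g).map (α.natTrans.app ⟨g⁻¹ • j, 1⟩) ≫ eqToHom (F'.obj_eq_act g j).symm := by
  have h := α.equivariant g ⟨g⁻¹ • j, 1⟩
  have hx : (⟨j, g⟩ : ProdEG S G) = ⟨g • g⁻¹ • j, g * 1⟩ := by simp
  rw [NatTrans.congr α.natTrans hx]
  erw [h]
  simp [eqToHom_map]

variable [Finite S] [HasFiniteCoproducts C] (f : S →[G] T)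

/-- The value `g (⨁_{i ∈ f⁻¹(g⁻¹ t)} F(i, 1))` of the pushforward at `(t, g)`. -/
abbrev pushObj (F : EqFunctor G S C) (t : T) (g : G) : C :=
  (act g).obj (∐ fibObj f F (g⁻¹ • t))

variable {f} in
/-- The inclusion of `F(j, g)` in the pushforward at `(t, g)`, for `j ∈ f⁻¹(t)`: the identification
`F(j, g) = g F(g⁻¹ j, 1)` followed by `g` applied to the inclusion of a summand. These inclusions
make up the canonical isomorphism
`⨁_{j ∈ f⁻¹(t)} F(j, g) ≅ g (⨁_{i ∈ f⁻¹(g⁻¹ t)} F(i, 1))`. -/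
def pushInj (F : EqFunctor G S C) (t : T) (g : G) (j : S) (h : f j = t) :
    F.functor.obj ⟨j, g⟩ ⟶ pushObj f F t g :=
  eqToHom (F.obj_eq_act g j) ≫
    (act g).map (Sigma.ι (fibObj f F (g⁻¹ • t)) ⟨g⁻¹ • j, fib_inv_smul g h⟩)

/-- The morphism out of the pushforward at `(t, g)` with given components on the `F(j, g)`. -/
def pushDesc (F : EqFunctor G S C) (t : T) (g : G) {Z : C}
    (φ : ∀ j : S, f j = t → (F.functor.obj ⟨j, g⟩ ⟶ Z)) : pushObj f F t g ⟶ Z :=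
  (PreservesCoproduct.iso (act g) (fibObj f F (g⁻¹ • t))).hom ≫
    Sigma.desc (fun i => eqToHom (act_obj_eq F g i.1) ≫ φ (g • i.1) (fib_smul g i))

variable {f}

lemma map_ι_iso_hom (F : EqFunctor G S C) (t : T) (g : G) (i : Fib f (g⁻¹ • t)) :
    (act g).map (Sigma.ι (fibObj f F (g⁻¹ • t)) i) ≫
      (PreservesCoproduct.iso (act g) (fibObj f F (g⁻¹ • t))).hom =
      Sigma.ι (fun i => (act g).obj (fibObj f F (g⁻¹ • t) i)) i := by
  rw [← Iso.eq_comp_inv, PreservesCoproduct.inv_hom, ι_comp_sigmaComparison]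

lemma pushInj_desc (F : EqFunctor G S C) (t : T) (g : G) {Z : C}
    (φ : ∀ j : S, f j = t → (F.functor.obj ⟨j, g⟩ ⟶ Z)) (j : S) (h : f j = t) :
    pushInj F t g j h ≫ pushDesc f F t g φ = φ j h := by
  have key : ∀ (j' : S) (h' : f j' = t) (_ : j = j')
      (e' : F.functor.obj ⟨j, g⟩ = F.functor.obj ⟨j', g⟩),
      eqToHom e' ≫ φ j' h' = φ j h := by
    rintro j' h' rfl e'; simp
  simp only [pushInj, pushDesc, Category.assoc]
  rw [reassoc_of% map_ι_iso_hom F t g, Sigma.ι_desc, eqToHom_trans_assoc]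
  exact key _ _ (by simp) _

lemma push_hom_ext (F : EqFunctor G S C) (t : T) (g : G) {Z : C} {a b : pushObj f F t g ⟶ Z}
    (h : ∀ (j : S) (hj : f j = t), pushInj F t g j hj ≫ a = pushInj F t g j hj ≫ b) :
    a = b := by
  rw [← cancel_epi (PreservesCoproduct.iso (act g) (fibObj f F (g⁻¹ • t))).inv]
  refine Sigma.hom_ext _ _ fun i => ?_
  rw [PreservesCoproduct.inv_hom, ι_comp_sigmaComparison_assoc, ι_comp_sigmaComparison_assoc]
  have key : ∀ (i' : Fib f (g⁻¹ • t)) (_ : i' = i),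
      (act g).map (Sigma.ι (fibObj f F (g⁻¹ • t)) i') ≫ a =
        (act g).map (Sigma.ι (fibObj f F (g⁻¹ • t)) i') ≫ b →
      (act g).map (Sigma.ι (fibObj f F (g⁻¹ • t)) i) ≫ a =
        (act g).map (Sigma.ι (fibObj f F (g⁻¹ • t)) i) ≫ b := by
    rintro i' rfl h; exact h
  refine key ⟨g⁻¹ • (g • i.1), fib_inv_smul g (fib_smul g i)⟩ (by ext; simp) ?_
  have := h (g • i.1) (fib_smul g i)
  simpa only [pushInj, Category.assoc, cancel_epi] using this

variable (f)

/-- The unique morphism `(j, g) ⟶ (j, h)` of `S × EG`. -/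
abbrev homElt (j : S) (g h : G) : (⟨j, g⟩ : ProdEG S G) ⟶ ⟨j, h⟩ := homMk rfl

/-- The pushforward of an equivariant functor, as a functor. On the summands `F(j, g)` the morphism
`(t, g ⟶ h)` is sent to the coproduct of the morphisms `F(j, g ⟶ h)`. -/
abbrev pushFunctor (F : EqFunctor G S C) : ProdEG T G ⥤ C where
  obj x := pushObj f F x.pt x.elt
  map {x y} e := pushDesc f F x.pt x.elt fun j h =>
    F.functor.map (homElt j x.elt y.elt) ≫ pushInj F y.pt y.elt j (h.trans (hom_eq e))
  map_id x := push_hom_ext F _ _ fun j h => by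
    rw [pushInj_desc, Category.comp_id]
    have : homElt j x.elt x.elt = 𝟙 _ := rfl
    rw [this, F.functor.map_id, Category.id_comp]
  map_comp {x y z} e e' := push_hom_ext F _ _ fun j h => by
    rw [pushInj_desc, reassoc_of% pushInj_desc, Category.assoc, pushInj_desc,
      ← Category.assoc, ← F.functor.map_comp]
    rfl

variable {f}

lemma pushObj_shift (F : EqFunctor G S C) (k : G) (t : T) (g : G) :
    pushObj f F (k • t) (k * g) = (act k).obj (pushObj f F t g) := by
  have h : (k * g)⁻¹ • k • t = g⁻¹ • t := by
    rw [mul_inv_rev, mul_smul, inv_smul_smul]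
  have key : ∀ (t₁ t₂ : T) (_ : t₁ = t₂) (A : C ⥤ C) (_ : A = act g ⋙ act k),
      A.obj (∐ fibObj f F t₁) = (act k).obj ((act g).obj (∐ fibObj f F t₂)) := by
    rintro t _ rfl A rfl
    rfl
  exact key _ _ h _ (act_mul _ _)

lemma pushInj_shift (F : EqFunctor G S C) (k : G) (t : T) (g : G) (j : S) (h : f j = t)
    (h' : f (k • j) = k • t) :
    pushInj F (k • t) (k * g) (k • j) h' =
      eqToHom (smul_obj F k g j) ≫ (act k).map (pushInj F t g j h) ≫
        eqToHom (pushObj_shift F k t g).symm := by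
  have key : ∀ (t₁ t₂ : T) (_ : t₁ = t₂) (i : Fib f t₁) (i' : Fib f t₂) (_ : i.1 = i'.1)
      (A : C ⥤ C) (_ : A = act g ⋙ act k)
      (e₁ : (act k).obj ((act g).obj (∐ fibObj f F t₂)) = A.obj (∐ fibObj f F t₁))
      (e₂ : A.obj (fibObj f F t₁ i) = (act k).obj ((act g).obj (fibObj f F t₂ i'))),
      A.map (Sigma.ι (fibObj f F t₁) i) =
        eqToHom e₂ ≫ (act k).map ((act g).map (Sigma.ι (fibObj f F t₂) i')) ≫ eqToHom e₁ := by
    rintro t _ rfl ⟨i, hi⟩ ⟨i', hi'⟩ (rfl : i = i') A rfl e₁ e₂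
    simp
  have hpt : (k * g)⁻¹ • k • t = g⁻¹ • t := by rw [mul_inv_rev, mul_smul, inv_smul_smul]
  have hj : (k * g)⁻¹ • k • j = g⁻¹ • j := by rw [mul_inv_rev, mul_smul, inv_smul_smul]
  have hobj : (act (k * g)).obj (F.functor.obj ⟨(k * g)⁻¹ • k • j, 1⟩) =
      (act k).obj ((act g).obj (F.functor.obj ⟨g⁻¹ • j, 1⟩)) := by
    rw [hj, act_mul]; rfl
  have := key ((k * g)⁻¹ • k • t) (g⁻¹ • t) hpt ⟨(k * g)⁻¹ • k • j, fib_inv_smul _ h'⟩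
    ⟨g⁻¹ • j, fib_inv_smul g h⟩ hj (act (k * g)) (act_mul _ _) (pushObj_shift F k t g).symm hobj
  simp only [pushInj, CategoryTheory.Functor.map_comp, eqToHom_map, Category.assoc]
  rw [this, eqToHom_trans_assoc, eqToHom_trans_assoc]

variable (f)

lemma pushFunctor_equivariant (F : EqFunctor G S C) (k : G) :
    shift T k ⋙ pushFunctor f F = pushFunctor f F ⋙ act k := by
  refine CategoryTheory.Functor.ext (fun x => pushObj_shift F k x.pt x.elt) fun x y e => ?_
  refine push_hom_ext (f := f) F _ _ fun j h => ?_
  obtain ⟨j, rfl⟩ : ∃ j', k • j' = j := ⟨k⁻¹ • j, smul_inv_smul _ _⟩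
  have h₀ : f j = x.pt := by
    rw [map_smul] at h
    exact smul_left_cancel k h
  have h₁ : f j = y.pt := h₀.trans (hom_eq e)
  have hy : f (k • j) = k • y.pt := by rw [map_smul, h₁]
  have hm : F.functor.map (homElt (k • j) (k * x.elt) (k * y.elt)) =
      eqToHom (smul_obj F k x.elt j) ≫ (act k).map (F.functor.map (homElt j x.elt y.elt)) ≫
        eqToHom (smul_obj F k y.elt j).symm := F.equivariant_map k (homElt j x.elt y.elt)
  have lhs : pushInj F (k • x.pt) (k * x.elt) (k • j) h ≫ (shift T k ⋙ pushFunctor f F).map e =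
      F.functor.map (homElt (k • j) (k * x.elt) (k * y.elt)) ≫
        pushInj F (k • y.pt) (k * y.elt) (k • j) hy :=
    pushInj_desc F (k • x.pt) (k * x.elt) (fun j' h'' =>
      F.functor.map (homElt j' (k * x.elt) (k * y.elt)) ≫
        pushInj F (k • y.pt) (k * y.elt) j' (h''.trans (hom_eq ((shift T k).map e)))) (k • j) h
  have rhs : pushInj F x.pt x.elt j h₀ ≫ (pushFunctor f F).map e =
      F.functor.map (homElt j x.elt y.elt) ≫ pushInj F y.pt y.elt j h₁ :=
    pushInj_desc F x.pt x.elt (fun j' h'' => F.functor.map (homElt j' x.elt y.elt) ≫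
      pushInj F y.pt y.elt j' (h''.trans (hom_eq e))) j h₀
  have rhs' := congrArg (act k).map rhs
  rw [CategoryTheory.Functor.map_comp, CategoryTheory.Functor.map_comp] at rhs'
  rw [lhs, pushInj_shift F k x.pt x.elt j h₀ h, pushInj_shift F k y.pt y.elt j h₁ hy, hm]
  simp only [Category.assoc, eqToHom_trans_assoc, eqToHom_refl, Category.id_comp,
    CategoryTheory.Functor.comp_map]
  rw [reassoc_of% rhs']

/-- The components of the morphism of pushforwards induced by a morphism. -/
abbrev pushMap {F F' : EqFunctor G S C} (α : F ⟶ F') (t : T) (g : G) :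
    pushObj f F t g ⟶ pushObj f F' t g :=
  (act g).map (Limits.Sigma.map fun i : Fib f (g⁻¹ • t) => α.natTrans.app ⟨i.1, 1⟩)

variable {f} in
lemma pushInj_pushMap {F F' : EqFunctor G S C} (α : F ⟶ F') (t : T) (g : G) (j : S)
    (h : f j = t) :
    pushInj F t g j h ≫ pushMap f α t g = α.natTrans.app ⟨j, g⟩ ≫ pushInj F' t g j h := by
  rw [natTrans_smul]
  simp only [pushInj, pushMap, Category.assoc, eqToHom_trans_assoc, eqToHom_refl,
    Category.id_comp, ← CategoryTheory.Functor.map_comp]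
  rw [Limits.Sigma.ι_map (fun i : Fib f (g⁻¹ • t) => α.natTrans.app ⟨i.1, 1⟩)]

/-- The pushforward (transfer) functor `f_!`, given on objects by
`(f_! F)(t, g) = g (⨁_{i ∈ f⁻¹(g⁻¹ t)} F(i, 1))`. -/
def pushforward (C : Type*) [Category C] [StrictAction G C] [HasFiniteCoproducts C]
    (f : S →[G] T) : EqFunctor G S C ⥤ EqFunctor G T C where
  obj F := ⟨pushFunctor f F, pushFunctor_equivariant f F⟩
  map {F F'} α :=
    { natTrans :=
        { app := fun x => pushMap f α x.pt x.elt
          naturality := fun x y e => push_hom_ext F _ _ fun j h => by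
            rw [reassoc_of% pushInj_desc, Category.assoc, pushInj_pushMap, reassoc_of% pushInj_pushMap,
              pushInj_desc, NatTrans.naturality_assoc] }
      equivariant := fun k x => push_hom_ext F _ _ fun j h => by
        obtain ⟨j, rfl⟩ : ∃ j', k • j' = j := ⟨k⁻¹ • j, smul_inv_smul _ _⟩
        have h₀ : f j = x.pt := by
          rw [map_smul] at h
          exact smul_left_cancel k h
        have hm : α.natTrans.app ⟨k • j, k * x.elt⟩ =
            eqToHom (smul_obj F k x.elt j) ≫ (act k).map (α.natTrans.app ⟨j, x.elt⟩) ≫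
              eqToHom (smul_obj F' k x.elt j).symm := α.equivariant k ⟨j, x.elt⟩
        have rhs' := congrArg (act k).map (pushInj_pushMap α x.pt x.elt j h₀)
        rw [CategoryTheory.Functor.map_comp, CategoryTheory.Functor.map_comp] at rhs'
        rw [pushInj_pushMap, pushInj_shift F k x.pt x.elt j h₀ h,
          pushInj_shift F' k x.pt x.elt j h₀ h, hm]
        simp only [Category.assoc, eqToHom_trans_assoc, eqToHom_refl, Category.id_comp]
        rw [reassoc_of% rhs'] }
  map_id F := by
    refine hom_ext _ _ (NatTrans.ext (funext fun x => push_hom_ext F _ _ fun j h => ?_))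
    refine (pushInj_pushMap (𝟙 F) x.pt x.elt j h).trans ?_
    simp
  map_comp {F F' F''} α β := by
    refine hom_ext _ _ (NatTrans.ext (funext fun x => push_hom_ext F _ _ fun j h => ?_))
    refine (pushInj_pushMap (α ≫ β) x.pt x.elt j h).trans ?_
    change _ = pushInj F x.pt x.elt j h ≫ pushMap f α x.pt x.elt ≫ pushMap f β x.pt x.elt
    rw [reassoc_of% pushInj_pushMap, pushInj_pushMap]
    simp

end Pushforward

end EqFunctor

/-! ### Retractive objects -/

/-- Retractive objects over `A`: objects `Y` with maps `i : A ⟶ Y` and `p : Y ⟶ A` such that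
`i ≫ p` is the identity of `A`. -/
structure Retractive {D : Type*} [Category D] (A : D) where
  obj : D
  i : A ⟶ obj
  p : obj ⟶ A
  i_p : i ≫ p = 𝟙 A

namespace Retractive

section Basic

variable {D : Type*} [Category D] {A : D}

/-- Morphisms of retractive objects: morphisms under and over `A`. -/
@[ext]
structure Hom (Y Z : Retractive A) where
  hom : Y.obj ⟶ Z.obj
  i_hom : Y.i ≫ hom = Z.i
  hom_p : hom ≫ Z.p = Y.p

instance : Category (Retractive A) where
  Hom Y Z := Hom Y Z
  id Y := ⟨𝟙 _, by simp, by simp⟩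
  comp f g := ⟨f.hom ≫ g.hom, by rw [← Category.assoc, f.i_hom, g.i_hom],
    by rw [Category.assoc, g.hom_p, f.hom_p]⟩
  id_comp _ := Hom.ext (Category.id_comp _)
  comp_id _ := Hom.ext (Category.comp_id _)
  assoc _ _ _ := Hom.ext (Category.assoc _ _ _)

@[ext]
lemma hom_ext {Y Z : Retractive A} (f g : Y ⟶ Z) (h : f.hom = g.hom) : f = g := Hom.ext h

@[simp] lemma id_hom (Y : Retractive A) : (𝟙 Y : Y ⟶ Y).hom = 𝟙 Y.obj := rfl

@[simp] lemma comp_hom {Y Z W : Retractive A} (f : Y ⟶ Z) (g : Z ⟶ W) :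
    (f ≫ g).hom = f.hom ≫ g.hom := rfl

lemma eqToHom_hom {Y Z : Retractive A} (h : Y = Z) :
    (eqToHom h).hom = eqToHom (congrArg Retractive.obj h) := by
  subst h; rfl

/-- The sum of a finite family of retractive objects, obtained by gluing along `A`. -/
abbrev wedge [HasFiniteWidePushouts D] {J : Type} [Finite J] (Y : J → Retractive A) :
    Retractive A where
  obj := widePushout A (fun j => (Y j).obj) (fun j => (Y j).i)
  i := WidePushout.head _
  p := WidePushout.desc (𝟙 A) (fun j => (Y j).p) (fun j => (Y j).i_p)
  i_p := WidePushout.head_desc _ _ _ _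

/-- The inclusion of a summand in the sum. -/
abbrev wedgeι [HasFiniteWidePushouts D] {J : Type} [Finite J] (Y : J → Retractive A) (j : J) :
    Y j ⟶ wedge Y :=
  ⟨WidePushout.ι (fun j => (Y j).i) j, WidePushout.arrow_ι (fun j => (Y j).i) j,
    WidePushout.ι_desc (fun j => (Y j).i) (𝟙 A) (fun j => (Y j).p) (fun j => (Y j).i_p) j⟩

/-- The morphism out of the sum with given components. -/
abbrev wedgeDesc [HasFiniteWidePushouts D] {J : Type} [Finite J] (Y : J → Retractive A)
    {Z : Retractive A} (φ : ∀ j, Y j ⟶ Z) : wedge Y ⟶ Z where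
  hom := WidePushout.desc Z.i (fun j => (φ j).hom) (fun j => (φ j).i_hom)
  i_hom := WidePushout.head_desc _ _ _ _
  hom_p := by
    refine WidePushout.hom_ext (fun j => (Y j).i) _ _ (fun j => ?_) ?_
    · rw [WidePushout.ι_desc_assoc, WidePushout.ι_desc, (φ j).hom_p]
    · rw [WidePushout.head_desc_assoc, WidePushout.head_desc, Z.i_p]

/-- The sum is a coproduct. -/
def wedgeIsColimit [HasFiniteWidePushouts D] {J : Type} [Finite J] (Y : J → Retractive A) :
    IsColimit (Cofan.mk (wedge Y) (wedgeι Y)) :=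
  Cofan.IsColimit.mk _ (fun t => wedgeDesc Y t.inj)
    (fun t j => hom_ext _ _ (WidePushout.ι_desc (fun j => (Y j).i) t.pt.i
      (fun j => (t.inj j).hom) (fun j => (t.inj j).i_hom) j))
    (fun t m h => hom_ext _ _ (WidePushout.hom_ext (fun j => (Y j).i) _ _
      (fun j => (congrArg Hom.hom (h j)).trans
        (WidePushout.ι_desc (fun j => (Y j).i) t.pt.i
          (fun j => (t.inj j).hom) (fun j => (t.inj j).i_hom) j).symm)
      (m.i_hom.trans (WidePushout.head_desc (fun j => (Y j).i) t.pt.i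
          (fun j => (t.inj j).hom) (fun j => (t.inj j).i_hom)).symm)))

instance [HasFiniteWidePushouts D] : HasFiniteCoproducts (Retractive A) where
  out _ := ⟨fun F =>
    haveI : HasColimit (Discrete.functor (F.obj ∘ Discrete.mk)) :=
      ⟨⟨⟨_, wedgeIsColimit (F.obj ∘ Discrete.mk)⟩⟩⟩
    hasColimit_of_iso (Discrete.natIsoFunctor (F := F))⟩

end Basic

section Action

variable {G : Type u} [Group G] {D : Type*} [Category D] (A : Action D G)

lemma ρ_mul_hom (g h : G) : A.ρ (g * h) = A.ρ h ≫ A.ρ g := map_mul A.ρ g h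

lemma ρ_inv_comp (g : G) : A.ρ g⁻¹ ≫ A.ρ g = 𝟙 A.V := by
  rw [← ρ_mul_hom, mul_inv_cancel, Action.ρ_one]

/-- The retractive object `(Y, i ∘ g⁻¹, g ∘ p)`. -/
abbrev actObj (g : G) (Y : Retractive A.V) : Retractive A.V where
  obj := Y.obj
  i := A.ρ g⁻¹ ≫ Y.i
  p := Y.p ≫ A.ρ g
  i_p := by
    rw [Category.assoc, ← Category.assoc Y.i, Y.i_p, Category.id_comp, ρ_inv_comp]

/-- The functor by which `g` acts on the retractive objects over the underlying object of `A`. -/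
abbrev actFunctor (g : G) : Retractive A.V ⥤ Retractive A.V where
  obj Y := actObj A g Y
  map {Y Z} f := ⟨f.hom, (Category.assoc _ _ _).trans (congrArg (A.ρ g⁻¹ ≫ ·) f.i_hom),
    (Category.assoc _ _ _).symm.trans (congrArg (· ≫ A.ρ g) f.hom_p)⟩

lemma ext_obj {Y : D} {i i' : A.V ⟶ Y} {p p' : Y ⟶ A.V} (h : i ≫ p = 𝟙 _) (h' : i' ≫ p' = 𝟙 _)
    (hi : i = i') (hp : p = p') : (⟨Y, i, p, h⟩ : Retractive A.V) = ⟨Y, i', p', h'⟩ := by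
  subst hi hp; rfl

instance : StrictAction G (Retractive A.V) where
  act := actFunctor A
  act_one := CategoryTheory.Functor.ext
    (fun Y => ext_obj A _ _
      (by rw [inv_one, Action.ρ_one, Category.id_comp]) (by rw [Action.ρ_one, Category.comp_id]))
    (fun Y Z f => by
      ext
      simp only [comp_hom, eqToHom_hom, eqToHom_refl]
      exact ((Category.id_comp _).trans (Category.comp_id _)).symm)
  act_mul g h := CategoryTheory.Functor.ext
    (fun Y => ext_obj A _ _
      (by
        change A.ρ (g * h)⁻¹ ≫ Y.i = A.ρ g⁻¹ ≫ A.ρ h⁻¹ ≫ Y.i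
        rw [mul_inv_rev, ρ_mul_hom, Category.assoc])
      (by
        change Y.p ≫ A.ρ (g * h) = (Y.p ≫ A.ρ h) ≫ A.ρ g
        rw [ρ_mul_hom, Category.assoc]))
    (fun Y Z f => by
      ext
      simp only [comp_hom, eqToHom_hom, eqToHom_refl]
      exact ((Category.id_comp _).trans (Category.comp_id _)).symm)

@[simp]
lemma act_map_hom (g : G) {Y Z : Retractive A.V} (f : Y ⟶ Z) :
    ((act g).map f).hom = f.hom := rfl

end Action

end Retractive

open Retractive

/-! ### Homotopy fixed points of `R(X)` as equivariant retractive spaces -/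

section Evaluation

variable {G : Type u} [Group G] {D : Type*} [Category D] (X : Action D G) (H : Subgroup G)

/-- The restriction of an object with `G`-action to a subgroup. -/
abbrev resObj : Action D H := (Action.res D H.subtype).obj X

/-- The base point `(eH, g)` of `G/H × EG`. -/
abbrev basePt (g : G) : ProdEG (G ⧸ H) G := ⟨((1 : G) : G ⧸ H), g⟩

/-- The unique morphism `(eH, g) ⟶ (eH, g')`. -/
abbrev baseHom (g g' : G) : basePt H g ⟶ basePt H g' := homMk rfl

variable {X H}

lemma shift_basePt (h : H) (g : G) :
    (shift (G ⧸ H) (h : G)).obj (basePt H g) = basePt H (h * g) := by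
  refine ProdEG.ext ?_ rfl
  change ((h * 1 : G) : G ⧸ H) = ((1 : G) : G ⧸ H)
  rw [mul_one, QuotientGroup.eq]
  simp

variable (F : EqFunctor G (G ⧸ H) (Retractive X.V))

lemma basePt_obj (h : H) (g : G) :
    (act (h : G)).obj (F.functor.obj (basePt H g)) = F.functor.obj (basePt H (h * g)) := by
  rw [← F.equivariant_obj, shift_basePt]

/-- The morphism `h F(eH, e) = F(eH, h) ⟶ F(eH, e)` given by `F` applied to `h ⟶ e`. -/
def evalAct (h : H) : (act (h : G)).obj (F.functor.obj (basePt H 1)) ⟶ F.functor.obj (basePt H 1) :=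
  eqToHom (basePt_obj F h 1) ≫ F.functor.map (baseHom H (h * 1) 1)

lemma map_eq_of_eq {F : EqFunctor G (G ⧸ H) (Retractive X.V)} {x x' y y' : ProdEG (G ⧸ H) G}
    (hx : x = x') (hy : y = y') (f : x ⟶ y) (f' : x' ⟶ y') :
    F.functor.map f = eqToHom (by rw [hx]) ≫ F.functor.map f' ≫ eqToHom (by rw [hy]) := by
  subst hx hy
  rw [Subsingleton.elim f f']
  simp

lemma act_map_baseHom (h : H) (g g' : G) :
    (act (h : G)).map (F.functor.map (baseHom H g g')) =
      eqToHom (basePt_obj F h g) ≫ F.functor.map (baseHom H (h * g) (h * g')) ≫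
        eqToHom (basePt_obj F h g').symm := by
  have h₁ := F.equivariant_map (h : G) (baseHom H g g')
  have h₂ := map_eq_of_eq (F := F) (shift_basePt h g) (shift_basePt h g')
    ((shift (G ⧸ H) (h : G)).map (baseHom H g g')) (baseHom H (h * g) (h * g'))
  have h₃ : (act (h : G)).map (F.functor.map (baseHom H g g')) =
      eqToHom (F.equivariant_obj _ _).symm ≫
        F.functor.map ((shift (G ⧸ H) (h : G)).map (baseHom H g g')) ≫
        eqToHom (F.equivariant_obj _ _) := by
    rw [h₁]
    simp only [Category.assoc, eqToHom_trans, eqToHom_trans_assoc, eqToHom_refl, Category.id_comp,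
      Category.comp_id]
  rw [h₃, h₂]
  simp only [Category.assoc, eqToHom_trans, eqToHom_trans_assoc]

lemma evalAct_one : evalAct F 1 = eqToHom (by rw [OneMemClass.coe_one, act_one]; rfl) := by
  have h : F.functor.map (baseHom H (((1 : H) : G) * 1) 1) = _ :=
    map_eq_of_eq (F := F) (x' := basePt H 1) (y' := basePt H 1) (by simp) rfl _ (𝟙 _)
  rw [evalAct, h, F.functor.map_id]
  simp only [Category.id_comp, eqToHom_trans]

lemma evalAct_mul (h k : H) : evalAct F (h * k) =
    eqToHom (by rw [Subgroup.coe_mul, act_mul]; rfl) ≫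
      (act (h : G)).map (evalAct F k) ≫ evalAct F h := by
  have h₁ : F.functor.map (baseHom H (((h * k : H) : G) * 1) 1) = _ :=
    map_eq_of_eq (F := F) (x' := basePt H (h * (k * 1))) (y' := basePt H 1)
      (by rw [Subgroup.coe_mul, mul_assoc]) rfl _
      (baseHom H (h * (k * 1)) (h * 1) ≫ baseHom H (h * 1) 1)
  rw [evalAct, h₁, evalAct, evalAct, CategoryTheory.Functor.map_comp,
    CategoryTheory.Functor.map_comp, act_map_baseHom, eqToHom_map]
  simp only [Category.assoc, eqToHom_trans_assoc, eqToHom_refl, Category.id_comp,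
    Category.comp_id]

lemma natTrans_basePt {F F' : EqFunctor G (G ⧸ H) (Retractive X.V)} (α : F ⟶ F') (h : H)
    (g : G) : α.natTrans.app (basePt H (h * g)) =
      eqToHom (basePt_obj F h g).symm ≫ (act (h : G)).map (α.natTrans.app (basePt H g)) ≫
        eqToHom (basePt_obj F' h g) := by
  rw [NatTrans.congr α.natTrans (shift_basePt h g).symm, α.equivariant, eqToHom_map, eqToHom_map]
  simp only [Category.assoc, eqToHom_trans, eqToHom_trans_assoc]

lemma evalAct_natural {F F' : EqFunctor G (G ⧸ H) (Retractive X.V)} (α : F ⟶ F') (h : H) :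
    evalAct F h ≫ α.natTrans.app (basePt H 1) =
      (act (h : G)).map (α.natTrans.app (basePt H 1)) ≫ evalAct F' h := by
  rw [evalAct, evalAct, Category.assoc, α.natTrans.naturality, natTrans_basePt]
  simp only [Category.assoc, eqToHom_trans_assoc, eqToHom_refl, Category.id_comp]

lemma evalAct_i (h : H) : X.ρ (h : G) ≫ (F.functor.obj (basePt H 1)).i =
    (F.functor.obj (basePt H 1)).i ≫ (evalAct F h).hom := by
  have h₁ : (X.ρ (h : G)⁻¹ ≫ (F.functor.obj (basePt H 1)).i) ≫ (evalAct F h).hom =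
      (F.functor.obj (basePt H 1)).i := (evalAct F h).i_hom
  have h₂ : X.ρ (h : G) ≫ X.ρ (h : G)⁻¹ = 𝟙 X.V := by
    rw [← ρ_mul_hom, inv_mul_cancel, Action.ρ_one]
  have h₃ := congrArg (X.ρ (h : G) ≫ ·) h₁
  simp only [Category.assoc, reassoc_of% h₂] at h₃
  exact h₃.symm

variable (X H)

/-- The functor `R(X)^{hH} = Cat(G/H × EG, R(X))^G ⥤` retractive `H`-spaces over `X` (an equivalence
of categories): it sends `F` to the retractive space `F(eH, e)`, on which `h ∈ H` acts by the map
of spaces underlying `h F(eH, e) = F(eH, h) ⟶ F(eH, e)`. -/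
def eval : EqFunctor G (G ⧸ H) (Retractive X.V) ⥤ Retractive (resObj X H) where
  obj F :=
    { obj :=
        { V := (F.functor.obj (basePt H 1)).obj
          ρ :=
            { toFun := fun h => (evalAct F h).hom
              map_one' := by
                rw [evalAct_one, Retractive.eqToHom_hom]; rfl
              map_mul' := fun h k => by
                rw [evalAct_mul, Retractive.comp_hom, Retractive.comp_hom, Retractive.eqToHom_hom]
                exact Category.id_comp _ } }
      i :=
        { hom := (F.functor.obj (basePt H 1)).i
          comm := fun h => evalAct_i F h }
      p :=
        { hom := (F.functor.obj (basePt H 1)).p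
          comm := fun h => (evalAct F h).hom_p }
      i_p := Action.hom_ext _ _ (F.functor.obj (basePt H 1)).i_p }
  map {F F'} α :=
    { hom :=
        { hom := (α.natTrans.app (basePt H 1)).hom
          comm := fun h => congrArg Retractive.Hom.hom (evalAct_natural α h) }
      i_hom := Action.hom_ext _ _ (α.natTrans.app (basePt H 1)).i_hom
      hom_p := Action.hom_ext _ _ (α.natTrans.app (basePt H 1)).hom_p }

end Evaluation

/-! ### Weak equivalences and fibrewise cofibrations of equivariant spaces -/

section HomotopyTheory

/-- The map on path components induced by a continuous map. -/
def zerothHomotopyMap {A B : Type u} [TopologicalSpace A] [TopologicalSpace B] (f : C(A, B)) :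
    ZerothHomotopy A → ZerothHomotopy B :=
  Quotient.map f fun _ _ h => h.map f.continuous

/-- The map on `n`-fold loops induced by a continuous map. -/
def genLoopMap {A B : Type u} [TopologicalSpace A] [TopologicalSpace B] (f : C(A, B)) (n : ℕ)
    (a : A) (γ : GenLoop (Fin n) A a) : GenLoop (Fin n) B (f a) :=
  ⟨f.comp γ.1, fun y hy => congrArg f (γ.2 y hy)⟩

/-- The map on homotopy groups `π_n` induced by a continuous map. -/
def homotopyGroupMap {A B : Type u} [TopologicalSpace A] [TopologicalSpace B] (f : C(A, B))
    (n : ℕ) (a : A) : HomotopyGroup.Pi n A a → HomotopyGroup.Pi n B (f a) :=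
  Quotient.map (genLoopMap f n a) fun _ _ h => h.map fun H => H.compContinuousMap f

/-- A weak homotopy equivalence is a continuous map which is bijective on path components and on
all homotopy groups at all base points. -/
def IsWeakHomotopyEquiv {A B : Type u} [TopologicalSpace A] [TopologicalSpace B]
    (f : C(A, B)) : Prop :=
  Function.Bijective (zerothHomotopyMap f) ∧
    ∀ (n : ℕ) (a : A), Function.Bijective (homotopyGroupMap f n a)

variable {H : Type u} [Group H]

/-- The fixed points of a subgroup. -/
def fixedSet (Y : Action TopCat.{u} H) (J : Subgroup H) : Set Y.V :=
  { y | ∀ h ∈ J, (Y.ρ h).hom y = y }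

/-- The map induced on fixed points by an equivariant map. -/
def fixedMap {Y Z : Action TopCat.{u} H} (f : Y ⟶ Z) (J : Subgroup H) :
    C(fixedSet Y J, fixedSet Z J) where
  toFun y := ⟨f.hom.hom y.1, fun h hh => by
    have e : f.hom.hom ((Y.ρ h).hom y.1) = (Z.ρ h).hom (f.hom.hom y.1) :=
      ConcreteCategory.congr_hom (f.comm h) y.1
    rw [← e, y.2 h hh]⟩
  continuous_toFun := by fun_prop

/-- The cylinder `Y × I`. -/
def cyl (Y : Action TopCat.{u} H) : Action TopCat.{u} H where
  V := TopCat.of (Y.V × unitInterval)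
  ρ :=
    { toFun := fun h => TopCat.ofHom ((Y.ρ h).hom.prodMap (ContinuousMap.id _))
      map_one' := by rw [map_one]; rfl
      map_mul' := fun h k => by rw [map_mul]; rfl }

/-- The functoriality of the cylinder. -/
def cylMap {Y Z : Action TopCat.{u} H} (f : Y ⟶ Z) : cyl Y ⟶ cyl Z where
  hom := TopCat.ofHom (f.hom.hom.prodMap (ContinuousMap.id _))
  comm h := by
    ext z
    exact Prod.ext (ConcreteCategory.congr_hom (f.comm h) z.1) rfl

/-- The inclusion `Y = Y × 1 ⟶ Y × I`. -/
def cylEnd (Y : Action TopCat.{u} H) : Y ⟶ cyl Y where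
  hom := TopCat.ofHom ((ContinuousMap.id _).prodMk (ContinuousMap.const _ 1))
  comm _ := rfl

/-- The projection `Y × I ⟶ Y`. -/
def cylProj (Y : Action TopCat.{u} H) : cyl Y ⟶ Y where
  hom := TopCat.ofHom ContinuousMap.fst
  comm _ := rfl

lemma cylEnd_map {Y Z : Action TopCat.{u} H} (f : Y ⟶ Z) :
    cylEnd Y ≫ cylMap f = f ≫ cylEnd Z := rfl

lemma cylEnd_proj (Y : Action TopCat.{u} H) : cylEnd Y ≫ cylProj Y = 𝟙 Y := rfl

/-- The space `Y × I ∪_{Y × 1} Z × 1`. -/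
abbrev mappingCylinder {Y Z : Action TopCat.{u} H} (f : Y ⟶ Z) : Action TopCat.{u} H :=
  pushout (cylEnd Y) f

/-- The canonical map `Y × I ∪_{Y × 1} Z × 1 ⟶ Z × I`. -/
def mappingCylinderIncl {Y Z : Action TopCat.{u} H} (f : Y ⟶ Z) : mappingCylinder f ⟶ cyl Z :=
  pushout.desc (cylMap f) (cylEnd Z) (cylEnd_map f)

variable {A : Action TopCat.{u} H}

/-- The projection `Y × I ∪_{Y × 1} Z × 1 ⟶ A`, for a map `Y ⟶ Z` of retractive spaces over `A`. -/
def mappingCylinderProj {Y Z : Retractive A} (f : Y ⟶ Z) : mappingCylinder f.hom ⟶ A :=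
  pushout.desc (cylProj Y.obj ≫ Y.p) Z.p (by
    rw [← Category.assoc, cylEnd_proj, Category.id_comp, f.hom_p])

variable (A)

/-- The maps with the equivariant fibrewise homotopy extension property: those for which
`Y × I ∪_{Y × 1} Z × 1 ⟶ Z × I` has an equivariant retraction over `A`. -/
def fhep : MorphismProperty (Retractive A) := fun _ Z f =>
  ∃ r : cyl Z.obj ⟶ mappingCylinder f.hom,
    mappingCylinderIncl f.hom ≫ r = 𝟙 _ ∧ r ≫ mappingCylinderProj f = cylProj Z.obj ≫ Z.p

/-- The maps which are weak homotopy equivalences on the fixed points of all subgroups. -/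
def fixedWeq : MorphismProperty (Retractive A) := fun _ _ f =>
  ∀ J : Subgroup H, IsWeakHomotopyEquiv (fixedMap f.hom J)

/-! ### Relative cell complexes and homotopy finiteness -/

/-- The `H`-space `H/N × B`. -/
def orbitProd (N : Subgroup H) (B : TopCat.{u}) : Action TopCat.{u} H where
  V := TopCat.of (Σ _ : H ⧸ N, B)
  ρ :=
    { toFun := fun h => TopCat.ofHom
        ⟨fun z => ⟨h • z.1, z.2⟩,
          continuous_sigma fun q => continuous_sigmaMk (σ := fun _ : H ⧸ N => B) (i := h • q)⟩
      map_one' := by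
        refine TopCat.hom_ext (ContinuousMap.ext fun z => ?_)
        exact Sigma.ext (one_smul H z.1) HEq.rfl
      map_mul' := fun h k => by
        refine TopCat.hom_ext (ContinuousMap.ext fun z => ?_)
        exact Sigma.ext (mul_smul h k z.1) HEq.rfl }

/-- The map `H/N × B ⟶ H/N × B'` induced by a map `B ⟶ B'`. -/
def orbitProdMap (N : Subgroup H) {B B' : TopCat.{u}} (f : B ⟶ B') :
    orbitProd N B ⟶ orbitProd N B' where
  hom := TopCat.ofHom ⟨fun z => ⟨z.1, f z.2⟩,
    continuous_sigma fun q =>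
      (continuous_sigmaMk (σ := fun _ : H ⧸ N => B') (i := q)).comp f.hom.continuous⟩
  comm _ := rfl

/-- The generating cells `H/N × S^{n-1} ⟶ H/N × D^n`, for subgroups `N` of `H` and `n ≥ 0`. -/
def basicCell (H : Type u) [Group H] (a : Subgroup H × ℕ) :
    orbitProd a.1 (TopCat.diskBoundary.{u} a.2) ⟶ orbitProd a.1 (TopCat.disk.{u} a.2) :=
  orbitProdMap a.1 (TopCat.diskBoundaryInclusion a.2)

/-- The structure of a relative `H`-cell complex on a map: a presentation of it as a sequential
colimit, starting with its source, of attachments of cells `H/N × D^n` of any dimensions. -/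
abbrev RelCellStructure {Y Z : Action TopCat.{u} H} (f : Y ⟶ Z) :=
  RelativeCellComplex.{u} (fun _ : ℕ => basicCell H) f

/-- The retractive `H`-spaces `Y` over `A` for which `A ⟶ Y` is a relative `H`-cell complex; the
full subcategory of these is `R^H(A)`. -/
def isCellComplex : ObjectProperty (Retractive A) := fun Y => Nonempty (RelCellStructure Y.i)

/-- The weak equivalences of `R^H(A)`. -/
def cellWeq : MorphismProperty (isCellComplex A).FullSubcategory :=
  (fixedWeq A).inverseImage (isCellComplex A).ι

/-- The relative `H`-cell complexes with finitely many cells. -/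
def isFiniteCellComplex : ObjectProperty (Retractive A) := fun Y =>
  ∃ c : RelCellStructure Y.i, Finite c.Cells

/-- The objects of `R^H_hf(A)`: the objects of `R^H(A)` which are retracts of a finite relative
complex in the homotopy category, i.e. in the localization of `R^H(A)` at its weak equivalences. -/
def isHomotopyFinite : ObjectProperty (Retractive A) := fun Y =>
  ∃ (hY : isCellComplex A Y) (Z : (isCellComplex A).FullSubcategory),
    isFiniteCellComplex A Z.obj ∧
      Nonempty (Retract ((cellWeq A).Q.obj ⟨Y, hY⟩) ((cellWeq A).Q.obj Z))

end HomotopyTheory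

/-! ### The action of spans -/

section Span

variable {G : Type u} [Group G] (X : Action TopCat.{u} G) {H K : Subgroup G}

/-- The functor `(- * S) = q_! p^*` from `R(X)^{hH} = Cat(G/H × EG, R(X))^G` to
`R(X)^{hK} = Cat(G/K × EG, R(X))^G`, for a span `G/H ⟵ S ⟶ G/K` of finite `G`-sets. -/
def spanAction {S : Type v} [Finite S] [MulAction G S] (p : S →[G] G ⧸ H) (q : S →[G] G ⧸ K) :
    EqFunctor G (G ⧸ H) (Retractive X.V) ⥤ EqFunctor G (G ⧸ K) (Retractive X.V) :=
  EqFunctor.pullback _ p ⋙ EqFunctor.pushforward _ q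

variable (H)

/-- The objects of `R(X)^{hH}` which belong to `R^H_hf(X)`. -/
def hfObj : ObjectProperty (EqFunctor G (G ⧸ H) (Retractive X.V)) :=
  (isHomotopyFinite (resObj X H)).inverseImage (eval X H)

/-- The maps of `R(X)^{hH}` with the `H`-equivariant FHEP. -/
def hfCof : MorphismProperty (EqFunctor G (G ⧸ H) (Retractive X.V)) :=
  (fhep (resObj X H)).inverseImage (eval X H)

/-- The maps of `R(X)^{hH}` which are weak equivalences on the fixed points of all subgroups
of `H`. -/
def hfWeq : MorphismProperty (EqFunctor G (G ⧸ H) (Retractive X.V)) :=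
  (fixedWeq (resObj X H)).inverseImage (eval X H)

end Span

/-- Let `P` and `P'` be classes of objects of `C` and `D`, regarded as full subcategories, with
classes of cofibrations and weak equivalences, and with pushouts along cofibrations formed in
`C` and `D`. The functor `F` restricts to an exact functor from `P` to `P'` if it sends objects
of `P` to objects of `P'` and if, on `P`, it preserves zero objects, cofibrations, weak
equivalences, and pushouts along cofibrations. -/
structure RestrictsToExact {C D : Type*} [Category C] [Category D] (F : C ⥤ D)
    (P : ObjectProperty C) (cof weq : MorphismProperty C)
    (P' : ObjectProperty D) (cof' weq' : MorphismProperty D) : Prop where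
  map_mem : ∀ Y : C, P Y → P' (F.obj Y)
  map_zero : ∀ Y : C, P Y → IsZero Y → IsZero (F.obj Y)
  map_cof : ∀ {Y Z : C} (f : Y ⟶ Z), P Y → P Z → cof f → cof' (F.map f)
  map_weq : ∀ {Y Z : C} (f : Y ⟶ Z), P Y → P Z → weq f → weq' (F.map f)
  map_pushout : ∀ {Y Z W V : C} {f : Y ⟶ Z} {g : Y ⟶ W} {f' : W ⟶ V} {g' : Z ⟶ V},
    P Y → P Z → P W → cof f → IsPushout f g g' f' →
      IsPushout (F.map f) (F.map g) (F.map g') (F.map f')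

end

end SpanTransfer

/-! Let Y = F(eH, e), an H-space, and let T = q⁻¹(eK), a finite K-set. A choice of g_j in the coset
p(j), for j in T, identifies each summand F(p(j), e) of (q_! p^* F)(eK, e) with Y. An element k of K
carries the summand j to the summand kj, and on Y it acts through c(k, j) = g_{kj}⁻¹ k g_j, which
lies in H and is a cocycle. The value of the span is therefore the pushout of T × Y ← T × X → X,
where K acts on T × Y through c and the right-hand map is (j, x) ↦ g_j x. This is
`isTransfer_spanMap`. The rest of the proof studies the transfer Y ↦ X ∪_{T × X} (T × Y) for an
arbitrary cocycle and base change (`IsTransfer`).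

On underlying spaces the twisted product is the left adjoint T × −, so it preserves colimits; it
also maps compatibly to path spaces and cylinders. Hence zero objects and pushouts are a formal
matter (`IsTransfer.isPushout_map`), and a retraction witnessing homotopy extension can be
transferred (`IsTransfer.fhep`). Since T × H/N is a disjoint union of K-orbits, a cell H/N × D^n
becomes a family of cells K/L × D^n indexed by these orbits (`orbitInclIsColimit`). So a relative
cell complex goes to a relative cell complex (`transferCells`), and a finite one to a finite one
because T and H are finite.

Weak equivalences are not visibly preserved by the pushout along T × X → X, but homotopy
equivalences under X are. Between relative cell complexes the relative equivariant Whitehead theorem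
(`exists_homotopy_sections`) provides, for a weak equivalence f, a homotopy section s of f and a
homotopy section of s, all under X. Such data survive the transfer (`IsTransfer.homotopicUnder`) and
force the transferred map to be a weak equivalence. The theorem is proved by lifting cells against
the end point map of the mapping path space, which comes down to compressing a map of pairs (D^n,
S^{n-1}) along a weak homotopy equivalence (`compresses_disk`).

Consequently the transfer descends to the localizations of the categories of relative cell
complexes. There it preserves retracts of finite complexes, which gives homotopy finiteness. Zero
objects and pushouts pass between equivariant functors and equivariant retractive spaces because
`eval` is an equivalence of categories. -/

namespace SpanTransfer

noncomputable section

/-! ### Homotopy extension for pairs of spaces -/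

section HomotopyExtension

open unitInterval

variable {P P' A : Type*} [TopologicalSpace P] [TopologicalSpace P'] [TopologicalSpace A]

/-- The cylinder `P × I` retracts onto `P × 0 ∪ S × I`. -/
def HasHEP (S : Set P) : Prop :=
  ∃ r : C(P × I, P × I), (∀ z, (r z).2 = 0 ∨ (r z).1 ∈ S) ∧ (∀ p, r (p, 0) = (p, 0)) ∧
    ∀ p ∈ S, ∀ t, r (p, t) = (p, t)

/-- Compose with the retraction r: use g where r lands over S and f where it lands at height 0.
These two regions are closed, cover the cylinder, and the formulas agree on their overlap. Only
continuity of g over S is needed. -/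
lemma HasHEP.extend {S : Set P} (h : HasHEP S) (hS : IsClosed S) (f : C(P, A)) (g : P × I → A)
    (hg : ContinuousOn g (Prod.fst ⁻¹' S)) (h₀ : ∀ p ∈ S, g (p, 0) = f p) :
    ∃ F : C(P × I, A), (∀ p, F (p, 0) = f p) ∧ ∀ p ∈ S, ∀ t, F (p, t) = g (p, t) := by
  classical
  obtain ⟨r, hr, hr₀, hrS⟩ := h
  let F : P × I → A := fun z => if (r z).1 ∈ S then g (r z) else f (r z).1
  have hF : ∀ z, (r z).2 = 0 → F z = f (r z).1 := fun z hz => by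
    by_cases hs : (r z).1 ∈ S
    · simp only [F, if_pos hs]
      rw [← h₀ _ hs, ← hz]
    · simp only [F, if_neg hs]
  have hc₁ : IsClosed {z | (r z).1 ∈ S} := hS.preimage (by fun_prop)
  have hc₂ : IsClosed {z | (r z).2 = 0} := isClosed_eq (by fun_prop) continuous_const
  have hcont : Continuous F := by
    rw [← continuousOn_univ]
    have : (Set.univ : Set (P × I)) = {z | (r z).1 ∈ S} ∪ {z | (r z).2 = 0} := by
      ext z; simpa using (hr z).symm
    rw [this]
    refine ContinuousOn.union_of_isClosed ?_ ?_ hc₁ hc₂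
    · refine ContinuousOn.congr (hg.comp r.continuous.continuousOn fun z hz => hz) fun z hz => ?_
      exact if_pos hz
    · refine ContinuousOn.congr (f := fun z => f (r z).1) (by fun_prop) fun z hz => hF z hz
  refine ⟨⟨F, hcont⟩, fun p => ?_, fun p hp t => ?_⟩
  · refine (hF (p, 0) ?_).trans ?_ <;> simp [hr₀]
  · simp only [ContinuousMap.coe_mk, F, hrS p hp t, if_pos hp]

/-- The boundary `S × I ∪ P × {0, 1}` of the box `P × I`. -/
def boxBd (S : Set P) : Set (P × I) := { z | z.1 ∈ S ∨ z.2 = 0 ∨ z.2 = 1 }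

lemma HasHEP.of_homeomorph {S : Set P} {S' : Set P'} (e : P ≃ₜ P') (he : ∀ p, e p ∈ S' ↔ p ∈ S)
    (h : HasHEP S') : HasHEP S := by
  obtain ⟨r, hr, hr₀, hrS⟩ := h
  refine ⟨⟨fun z => (e.symm (r (e z.1, z.2)).1, (r (e z.1, z.2)).2), by fun_prop⟩,
    fun z => ?_, fun p => ?_, fun p hp t => ?_⟩
  · refine (hr (e z.1, z.2)).imp id fun hz => ?_
    rw [← he]
    simpa using hz
  · simp [hr₀]
  · simp [hrS (e p) ((he p).2 hp)]

/-- A closed subset for which homotopy extension holds, also for the boundary of its box. -/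
structure GoodPair (S : Set P) : Prop where
  isClosed : IsClosed S
  hep : HasHEP S
  hep_box : HasHEP (boxBd S)

lemma GoodPair.of_homeomorph {S : Set P} {S' : Set P'} (e : P ≃ₜ P') (he : ∀ p, e p ∈ S' ↔ p ∈ S)
    (h : GoodPair S') : GoodPair S where
  isClosed := by
    have : S = e ⁻¹' S' := by ext p; exact (he p).symm
    rw [this]
    exact h.isClosed.preimage e.continuous
  hep := h.hep.of_homeomorph e he
  hep_box := h.hep_box.of_homeomorph (e.prodCongr (Homeomorph.refl I))
    fun z => or_congr (he z.1) Iff.rfl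

/-- A map on the three kinds of faces of the box, at the parameters `t`, and on the box
at `t = 0`, extends to the box at all parameters. -/
lemma GoodPair.fill {S : Set P} (h : GoodPair S) (f : C(P × I, A)) (g₀ g₁ : C(P × I, A))
    (g : (P × I) × I → A) (hg : ContinuousOn g {z | z.1.1 ∈ S})
    (hg₀ : ∀ p ∈ S, ∀ t, g ((p, 0), t) = g₀ (p, t)) (hg₁ : ∀ p ∈ S, ∀ t, g ((p, 1), t) = g₁ (p, t))
    (hf₀ : ∀ p, f (p, 0) = g₀ (p, 0)) (hf₁ : ∀ p, f (p, 1) = g₁ (p, 0))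
    (hf : ∀ p ∈ S, ∀ s, f (p, s) = g ((p, s), 0)) :
    ∃ F : C((P × I) × I, A), (∀ z, F (z, 0) = f z) ∧ (∀ p t, F ((p, 0), t) = g₀ (p, t)) ∧
      (∀ p t, F ((p, 1), t) = g₁ (p, t)) ∧ ∀ p ∈ S, ∀ s t, F ((p, s), t) = g ((p, s), t) := by
  classical
  -- The order of the tests is immaterial: where the side over S meets the faces s = 0 and s = 1,
  -- the three prescriptions agree by `hg₀` and `hg₁`.
  let G : (P × I) × I → A := fun z =>
    if z.1.2 = 0 then g₀ (z.1.1, z.2) else if z.1.2 = 1 then g₁ (z.1.1, z.2) else g z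
  have G₀ : ∀ p t, G ((p, 0), t) = g₀ (p, t) := fun p t => if_pos rfl
  have G₁ : ∀ p t, G ((p, 1), t) = g₁ (p, t) := fun p t =>
    (if_neg one_ne_zero).trans (if_pos rfl)
  have GS : ∀ p ∈ S, ∀ s t, G ((p, s), t) = g ((p, s), t) := fun p hp s t => by
    by_cases hs : s = 0
    · subst hs; rw [G₀, hg₀ p hp]
    by_cases hs' : s = 1
    · subst hs'; rw [G₁, hg₁ p hp]
    · simp only [G, if_neg hs, if_neg hs']
  have c₁ : IsClosed {z : (P × I) × I | z.1.1 ∈ S} := h.isClosed.preimage (by fun_prop)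
  have c₂ : IsClosed {z : (P × I) × I | z.1.2 = 0} := isClosed_eq (by fun_prop) continuous_const
  have c₃ : IsClosed {z : (P × I) × I | z.1.2 = 1} := isClosed_eq (by fun_prop) continuous_const
  have hG : ContinuousOn G (Prod.fst ⁻¹' boxBd S) := by
    have : (Prod.fst ⁻¹' boxBd S : Set ((P × I) × I)) =
        {z | z.1.1 ∈ S} ∪ ({z | z.1.2 = 0} ∪ {z | z.1.2 = 1}) := rfl
    rw [this]
    refine ContinuousOn.union_of_isClosed ?_ (ContinuousOn.union_of_isClosed ?_ ?_ c₂ c₃) c₁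
      (c₂.union c₃)
    · exact hg.congr fun z hz => GS z.1.1 hz z.1.2 z.2
    · refine ContinuousOn.congr (f := fun z => g₀ (z.1.1, z.2)) (by fun_prop) ?_
      rintro ⟨⟨p, s⟩, t⟩ (rfl : s = 0)
      exact G₀ p t
    · refine ContinuousOn.congr (f := fun z => g₁ (z.1.1, z.2)) (by fun_prop) ?_
      rintro ⟨⟨p, s⟩, t⟩ (rfl : s = 1)
      exact G₁ p t
  have hb : IsClosed (boxBd S) :=
    (h.isClosed.preimage continuous_fst).union
      ((isClosed_eq continuous_snd continuous_const).union
        (isClosed_eq continuous_snd continuous_const))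
  obtain ⟨F, hF, hFS⟩ := h.hep_box.extend hb f G hG (by
    rintro ⟨p, s⟩ (hp | rfl | rfl)
    · rw [GS p hp, hf p hp]
    · rw [G₀, hf₀]
    · rw [G₁, hf₁])
  exact ⟨F, hF, fun p t => (hFS _ (Or.inr (Or.inl rfl)) t).trans (G₀ p t),
    fun p t => (hFS _ (Or.inr (Or.inr rfl)) t).trans (G₁ p t),
    fun p hp s t => (hFS _ (Or.inl hp) t).trans (GS p hp s t)⟩

/-! ### Homotopy extension for the unit sphere in the unit ball of a normed space -/

section Ball

open Metric

variable (E : Type*) [NormedAddCommGroup E]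

/-- The unit ball. -/
abbrev Ball := closedBall (0 : E) 1

/-- The unit sphere in the unit ball. -/
def ballBd : Set (Ball E) := { x | ‖(x : E)‖ = 1 }

lemma norm_ball_le (x : Ball E) : ‖(x : E)‖ ≤ 1 := mem_closedBall_zero_iff.1 x.2

lemma isClosed_ballBd : IsClosed (ballBd E) :=
  isClosed_eq (by fun_prop) continuous_const

variable [NormedSpace ℝ E]

lemma hasHEP_ballBd : HasHEP (ballBd E) := by
  -- The retraction is the projection of the cylinder from the point (0, 2) above it, (x, t) ↦ (x /
  -- m, 2 - (2 - t) / m). The ray leaves through the side at m = ‖x‖ and through the bottom at m =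
  -- (2 - t) / 2; the larger value of m is the one met first.
  let m : Ball E × I → ℝ := fun z => max ‖(z.1 : E)‖ ((2 - z.2) / 2)
  have hm : ∀ z, 0 < m z := fun z => lt_of_lt_of_le (by
    have := z.2.2.2
    linarith : (0 : ℝ) < (2 - z.2) / 2) (le_max_right _ _)
  have hmc : Continuous m := by fun_prop
  have h₁ : ∀ z, ‖(m z)⁻¹ • (z.1 : E)‖ = ‖(z.1 : E)‖ / m z := fun z => by
    rw [norm_smul, norm_inv, Real.norm_of_nonneg (hm z).le, inv_mul_eq_div]
  have hm1 : ∀ z, m z ≤ 1 := fun z => max_le (norm_ball_le E z.1) (by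
    have := z.2.2.1
    linarith)
  have h₂ : ∀ z, 2 - (2 - (z.2 : ℝ)) / m z ∈ Set.Icc (0 : ℝ) 1 := fun z => by
    have ht := z.2.2.2
    constructor
    · have : (2 - (z.2 : ℝ)) / m z ≤ 2 := by
        rw [div_le_iff₀ (hm z)]
        have := le_max_right ‖(z.1 : E)‖ ((2 - z.2) / 2)
        change _ ≤ m z at this
        linarith
      linarith
    · have : (1 : ℝ) ≤ (2 - (z.2 : ℝ)) / m z := by
        rw [le_div_iff₀ (hm z)]
        have := hm1 z
        linarith
      linarith
  refine ⟨⟨fun z => (⟨(m z)⁻¹ • (z.1 : E), ?_⟩, ⟨2 - (2 - (z.2 : ℝ)) / m z, h₂ z⟩), ?_⟩, ?_, ?_, ?_⟩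
  · rw [mem_closedBall_zero_iff, h₁, div_le_one (hm z)]
    exact le_max_left _ _
  · refine Continuous.prodMk (Continuous.subtype_mk ?_ _) (Continuous.subtype_mk ?_ _)
    · exact (hmc.inv₀ fun z => (hm z).ne').smul (by fun_prop)
    · exact continuous_const.sub (Continuous.div (by fun_prop) hmc fun z => (hm z).ne')
  · intro z
    rcases le_total ‖(z.1 : E)‖ ((2 - z.2) / 2) with h | h
    · left
      have hz : m z = (2 - z.2) / 2 := max_eq_right h
      have h0 := hm z
      apply Subtype.ext
      change 2 - (2 - (z.2 : ℝ)) / m z = 0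
      rw [hz] at h0 ⊢
      have : (2 : ℝ) - z.2 ≠ 0 := by linarith
      field_simp
      norm_num
    · right
      have hz : m z = ‖(z.1 : E)‖ := max_eq_left h
      have h0 := hm z
      change ‖(m z)⁻¹ • (z.1 : E)‖ = 1
      rw [h₁, hz]
      rw [hz] at h0
      exact div_self h0.ne'
  · intro p
    have : m (p, 0) = 1 := by
      change max ‖(p : E)‖ ((2 - ((0 : I) : ℝ)) / 2) = 1
      have := norm_ball_le E p
      simpa using this
    ext <;> simp [this]
  · intro p hp t
    have : m (p, t) = 1 := by
      change max ‖(p : E)‖ ((2 - (t : ℝ)) / 2) = 1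
      rw [hp]
      have := t.2.1
      exact max_eq_left (by linarith)
    ext <;> simp [this]

/-- The interval `[-1, 1]`, as the image of `I`. -/
lemma abs_two_mul_sub_one (s : I) : |2 * (s : ℝ) - 1| ≤ 1 := by
  have := s.2.1
  have := s.2.2
  rw [abs_le]; constructor <;> linarith

lemma abs_two_mul_sub_one_eq (s : I) : |2 * (s : ℝ) - 1| = 1 ↔ s = 0 ∨ s = 1 := by
  rw [abs_eq zero_le_one, Subtype.ext_iff, Subtype.ext_iff, or_comm]
  refine or_congr ⟨fun h => ?_, fun h => ?_⟩ ⟨fun h => ?_, fun h => ?_⟩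
  all_goals simp only [Set.Icc.coe_zero, Set.Icc.coe_one] at *; linarith

lemma half_add_one_mem {x : ℝ} (h : |x| ≤ 1) : (x + 1) / 2 ∈ Set.Icc (0 : ℝ) 1 := by
  rw [abs_le] at h
  constructor <;> linarith

/-- The box on a unit ball is a unit ball. -/
def ballBoxHomeo : Ball E × I ≃ₜ Ball (E × ℝ) where
  toFun z := ⟨(z.1, 2 * z.2 - 1), by
    rw [mem_closedBall_zero_iff, Prod.norm_def]
    exact max_le (norm_ball_le E z.1) (abs_two_mul_sub_one z.2)⟩
  invFun z := (⟨z.1.1, by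
      rw [mem_closedBall_zero_iff]
      exact (norm_fst_le z.1).trans (norm_ball_le _ z)⟩,
    ⟨(z.1.2 + 1) / 2, half_add_one_mem ((norm_snd_le z.1).trans (norm_ball_le _ z))⟩)
  left_inv z := by ext <;> simp
  right_inv z := by
    refine Subtype.ext (Prod.ext rfl ?_)
    change 2 * ((z.1.2 + 1) / 2) - 1 = z.1.2
    ring
  continuous_toFun := by fun_prop
  continuous_invFun := by fun_prop

/-- With the supremum norm on E × ℝ the box over a unit ball is again a unit ball, and the boundary
of the box is its sphere. So the extension property for the box is that of a ball, which is why
arbitrary normed spaces are allowed. -/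
lemma goodPair_ballBd : GoodPair (ballBd E) where
  isClosed := isClosed_ballBd E
  hep := hasHEP_ballBd E
  hep_box := (hasHEP_ballBd (E × ℝ)).of_homeomorph (ballBoxHomeo E) fun z => by
    change ‖((z.1 : E), 2 * (z.2 : ℝ) - 1)‖ = 1 ↔ ‖(z.1 : E)‖ = 1 ∨ z.2 = 0 ∨ z.2 = 1
    rw [← abs_two_mul_sub_one_eq, Prod.norm_def]
    have h₁ := norm_ball_le E z.1
    have h₂ := abs_two_mul_sub_one z.2
    rw [Real.norm_eq_abs]
    constructor
    · intro h
      rcases max_choice ‖(z.1 : E)‖ |2 * (z.2 : ℝ) - 1| with h' | h' <;> rw [h'] at h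
      exacts [Or.inl h, Or.inr h]
    · rintro (h | h)
      · exact le_antisymm (max_le h₁ h₂) (h.ge.trans (le_max_left _ _))
      · exact le_antisymm (max_le h₁ h₂) (h.ge.trans (le_max_right _ _))

end Ball

/-! ### Cubes as balls for the supremum norm -/

section Cube

variable (N : Type*) [Fintype N]

/-- A cube is a unit ball for the supremum norm. -/
def cubeHomeo : (N → I) ≃ₜ Ball (N → ℝ) where
  toFun y := ⟨fun i => 2 * y i - 1, by
    rw [mem_closedBall_zero_iff, pi_norm_le_iff_of_nonneg zero_le_one]
    exact fun i => abs_two_mul_sub_one (y i)⟩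
  invFun z := fun i => ⟨(z.1 i + 1) / 2,
    half_add_one_mem ((norm_le_pi_norm z.1 i).trans (norm_ball_le _ z))⟩
  left_inv y := by ext; simp
  right_inv z := by
    refine Subtype.ext (funext fun i => ?_)
    change 2 * ((z.1 i + 1) / 2) - 1 = z.1 i
    ring
  continuous_toFun := by fun_prop
  continuous_invFun := continuous_pi fun i =>
    ((((continuous_apply i).comp continuous_subtype_val).add_const 1).div_const 2).subtype_mk _

lemma cubeHomeo_mem (y : N → I) : cubeHomeo N y ∈ ballBd (N → ℝ) ↔ y ∈ Cube.boundary N := by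
  have h := norm_ball_le _ (cubeHomeo N y)
  have h' : ‖(cubeHomeo N y : N → ℝ)‖ < 1 ↔ ∀ i, ‖(cubeHomeo N y : N → ℝ) i‖ < 1 :=
    pi_norm_lt_iff one_pos
  change ‖(cubeHomeo N y : N → ℝ)‖ = 1 ↔ ∃ i, y i = 0 ∨ y i = 1
  rw [← not_iff_not, ← ne_eq, ← h.lt_iff_ne, h', not_exists]
  refine forall_congr' fun i => ?_
  rw [← abs_two_mul_sub_one_eq]
  exact (abs_two_mul_sub_one (y i)).lt_iff_ne

lemma goodPair_cube : GoodPair (Cube.boundary N) :=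
  (goodPair_ballBd (N → ℝ)).of_homeomorph (cubeHomeo N) (cubeHomeo_mem N)

end Cube

end HomotopyExtension

/-! ### Homotopic maps on homotopy groups -/

section HomotopyGroups

open unitInterval

variable {A B C : Type u} [TopologicalSpace A] [TopologicalSpace B] [TopologicalSpace C]

/-- The maps `γ` and `δ` on a cube are freely homotopic, with the boundary moving along `c`. -/
def HomotopicAlong {N : Type} (c : C(I, A)) (γ δ : C(N → I, A)) : Prop :=
  ∃ Γ : C((N → I) × I, A), (∀ y, Γ (y, 0) = γ y) ∧ (∀ y, Γ (y, 1) = δ y) ∧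
    ∀ y ∈ Cube.boundary N, ∀ t, Γ (y, t) = c t

namespace HomotopicAlong

variable {N : Type} {c : C(I, A)} {γ γ' δ δ' : C(N → I, A)}

lemma symm (h : HomotopicAlong c γ δ) : HomotopicAlong (c.comp ⟨σ, by fun_prop⟩) δ γ := by
  obtain ⟨Γ, h₀, h₁, hb⟩ := h
  refine ⟨⟨fun z => Γ (z.1, σ z.2), by fun_prop⟩, fun y => ?_, fun y => ?_, fun y hy t => ?_⟩
  · simp [h₁]
  · simp [h₀]
  · simp [hb y hy]

lemma exists_of_boundary [Fintype N] (h : ∀ y ∈ Cube.boundary N, γ y = c 0) :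
    ∃ δ : C(N → I, A), HomotopicAlong c γ δ := by
  obtain ⟨Γ, h₀, hb⟩ := (goodPair_cube N).hep.extend (goodPair_cube N).isClosed γ
    (fun z => c z.2) (by fun_prop) (fun y hy => (h y hy).symm)
  exact ⟨⟨fun y => Γ (y, 1), by fun_prop⟩, Γ, h₀, fun _ => rfl, hb⟩

/-- Change of base point along `c` is well defined on homotopy classes. Fill a box whose floor is
the homotopy from `γ` to `γ'`, whose walls are the two free homotopies, and whose sides move along
`c`; the opposite face is the desired homotopy relative to the boundary. -/
lemma homotopicRel [Fintype N] (h : HomotopicAlong c γ δ) (h' : HomotopicAlong c γ' δ')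
    (hγ : γ.HomotopicRel γ' (Cube.boundary N)) : δ.HomotopicRel δ' (Cube.boundary N) := by
  obtain ⟨Γ, h₀, h₁, hb⟩ := h
  obtain ⟨Γ', h₀', h₁', hb'⟩ := h'
  obtain ⟨K⟩ := hγ
  obtain ⟨F, -, hF₀, hF₁, hFb⟩ := (goodPair_cube N).fill
    ⟨fun z => K (z.2, z.1), by fun_prop⟩ Γ Γ' (fun z => c z.2) (by fun_prop)
    (fun y hy t => (hb y hy t).symm) (fun y hy t => (hb' y hy t).symm)
    (fun y => by simp [h₀]) (fun y => by simp [h₀'])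
    (fun y hy s => (K.eq_fst s hy).trans ((h₀ y).symm.trans (hb y hy 0)))
  refine ⟨⟨⟨⟨fun z => F ((z.2, z.1), 1), by fun_prop⟩, fun y => ?_, fun y => ?_⟩,
    fun s y hy => ?_⟩⟩
  · exact (hF₀ y 1).trans (h₁ y)
  · exact (hF₁ y 1).trans (h₁' y)
  · exact (hFb y hy s 1).trans ((hb y hy 1).symm.trans (h₁ y))

end HomotopicAlong

lemma homotopyGroupMap_comp (g : C(B, C)) (f : C(A, B)) (n : ℕ) (a : A) :
    homotopyGroupMap (g.comp f) n a = homotopyGroupMap g n (f a) ∘ homotopyGroupMap f n a := by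
  funext x
  induction x using Quotient.inductionOn
  rfl

lemma homotopyGroupMap_id_bijective (n : ℕ) (a : A) :
    Function.Bijective (homotopyGroupMap (ContinuousMap.id A) n a) := by
  have : homotopyGroupMap (ContinuousMap.id A) n a = id := by
    funext x
    induction x using Quotient.inductionOn
    rfl
  rw [this]
  exact Function.bijective_id

lemma zerothHomotopyMap_comp (g : C(B, C)) (f : C(A, B)) :
    zerothHomotopyMap (g.comp f) = zerothHomotopyMap g ∘ zerothHomotopyMap f := by
  funext x
  induction x using Quotient.inductionOn
  rfl

lemma zerothHomotopyMap_id : zerothHomotopyMap (ContinuousMap.id A) = id := by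
  funext x
  induction x using Quotient.inductionOn
  rfl

/-- Homotopic maps agree on path components. -/
lemma zerothHomotopyMap_eq_of_homotopy {f g : C(A, B)} (H : f.Homotopy g) :
    zerothHomotopyMap f = zerothHomotopyMap g := by
  funext x
  induction x using Quotient.inductionOn with
  | h a =>
    exact Quotient.sound ⟨{ toFun := fun t => H (t, a), continuous_toFun := by fun_prop,
                            source' := by simp, target' := by simp }⟩

/-- Homotopic maps agree on homotopy groups, up to a bijection which changes the base point. -/
lemma exists_homotopyGroupMap_eq {f g : C(A, B)} (H : f.Homotopy g) (n : ℕ) (a : A) :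
    ∃ τ : HomotopyGroup.Pi n B (f a) → HomotopyGroup.Pi n B (g a), Function.Bijective τ ∧
      τ ∘ homotopyGroupMap f n a = homotopyGroupMap g n a := by
  let c : C(I, B) := ⟨fun t => H (t, a), by fun_prop⟩
  have c₀ : c 0 = f a := H.apply_zero a
  have c₁ : c 1 = g a := H.apply_one a
  have ex : ∀ γ : GenLoop (Fin n) B (f a), ∃ δ : GenLoop (Fin n) B (g a),
      HomotopicAlong c γ.1 δ.1 := fun γ => by
    obtain ⟨δ, Γ, h₀, h₁, hb⟩ := HomotopicAlong.exists_of_boundary (c := c) (γ := γ.1)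
      (fun y hy => (γ.2 y hy).trans c₀.symm)
    exact ⟨⟨δ, fun y hy => (h₁ y).symm.trans ((hb y hy 1).trans c₁)⟩, Γ, h₀, h₁, hb⟩
  have ex' : ∀ δ : GenLoop (Fin n) B (g a), ∃ γ : GenLoop (Fin n) B (f a),
      HomotopicAlong c γ.1 δ.1 := fun δ => by
    obtain ⟨γ, Γ, h₀, h₁, hb⟩ := HomotopicAlong.exists_of_boundary
      (c := c.comp ⟨σ, by fun_prop⟩) (γ := δ.1)
      (fun y hy => (δ.2 y hy).trans (c₁.symm.trans (by simp)))
    refine ⟨⟨γ, fun y hy => (h₁ y).symm.trans ((hb y hy 1).trans (by simp [c₀]))⟩, ?_⟩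
    have := (show HomotopicAlong _ _ _ from ⟨Γ, h₀, h₁, hb⟩).symm
    have hc : (c.comp ⟨σ, by fun_prop⟩).comp ⟨σ, by fun_prop⟩ = c := by ext; simp
    rwa [hc] at this
  choose τ hτ using ex
  -- Injectivity of the change of base point is its well-definedness along the reversed path.
  have hinj : ∀ γ γ' δ δ', HomotopicAlong c γ δ → HomotopicAlong c γ' δ' →
      δ.HomotopicRel δ' (Cube.boundary (Fin n)) → γ.HomotopicRel γ' (Cube.boundary (Fin n)) :=
    fun γ γ' δ δ' h h' hd => h.symm.homotopicRel h'.symm hd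
  refine ⟨Quotient.map τ fun γ γ' h => (hτ γ).homotopicRel (hτ γ') h, ⟨?_, ?_⟩, ?_⟩
  · rintro ⟨γ⟩ ⟨γ'⟩ h
    exact Quotient.sound (hinj _ _ _ _ (hτ γ) (hτ γ') (Quotient.exact h))
  · rintro ⟨δ⟩
    obtain ⟨γ, hγ⟩ := ex' δ
    exact ⟨Quotient.mk _ γ, Quotient.sound ((hτ γ).homotopicRel hγ (.refl _))⟩
  · funext x
    induction x using Quotient.inductionOn with
    | h γ =>
      -- The homotopy `H` applied to `γ` is itself a free homotopy from f ∘ γ to g ∘ γ along the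
      -- track `c` of the base point.
      refine Quotient.sound ((hτ (genLoopMap f n a γ)).homotopicRel
        (show HomotopicAlong c _ _ from ⟨⟨fun z => H (z.2, γ z.1), by fun_prop⟩, ?_, ?_, ?_⟩)
        (.refl _))
      · exact fun y => H.apply_zero _
      · exact fun y => H.apply_one _
      · exact fun y hy t => congrArg (fun x => H (t, x)) (γ.2 y hy)

lemma homotopyGroupMap_injective_iff {f g : C(A, B)} (H : f.Homotopy g) (n : ℕ) (a : A) :
    Function.Injective (homotopyGroupMap f n a) ↔ Function.Injective (homotopyGroupMap g n a) := by
  obtain ⟨τ, hτ, h⟩ := exists_homotopyGroupMap_eq H n a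
  rw [← h, hτ.1.of_comp_iff]

lemma homotopyGroupMap_surjective_iff {f g : C(A, B)} (H : f.Homotopy g) (n : ℕ) (a : A) :
    Function.Surjective (homotopyGroupMap f n a) ↔
      Function.Surjective (homotopyGroupMap g n a) := by
  obtain ⟨τ, hτ, h⟩ := exists_homotopyGroupMap_eq H n a
  rw [← h, Function.Surjective.of_comp_iff' hτ]

lemma homotopyGroupMap_bijective_of_homotopy_id {f : C(A, A)}
    (H : f.Homotopy (ContinuousMap.id A)) (n : ℕ) (a : A) :
    Function.Bijective (homotopyGroupMap f n a) :=
  ⟨(homotopyGroupMap_injective_iff H n a).2 (homotopyGroupMap_id_bijective n a).1,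
    (homotopyGroupMap_surjective_iff H n a).2 (homotopyGroupMap_id_bijective n a).2⟩

/-- A homotopy section of a weak homotopy equivalence is a weak homotopy equivalence. -/
lemma IsWeakHomotopyEquiv.of_section {f : C(A, B)} (hf : IsWeakHomotopyEquiv f) {s : C(B, A)}
    (H : (f.comp s).Homotopy (ContinuousMap.id B)) : IsWeakHomotopyEquiv s := by
  constructor
  · have h := zerothHomotopyMap_eq_of_homotopy H
    rw [zerothHomotopyMap_comp, zerothHomotopyMap_id] at h
    rw [← hf.1.of_comp_iff', h]
    exact Function.bijective_id
  · intro n b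
    have h := homotopyGroupMap_bijective_of_homotopy_id H n b
    rwa [homotopyGroupMap_comp, (hf.2 n (s b)).of_comp_iff'] at h

/-- A map with a homotopy section which itself has a homotopy section is a weak homotopy
equivalence. -/
lemma isWeakHomotopyEquiv_of_sections {f : C(A, B)} {s : C(B, A)} {f' : C(A, B)}
    (H : (f.comp s).Homotopy (ContinuousMap.id B))
    (H' : (s.comp f').Homotopy (ContinuousMap.id A)) : IsWeakHomotopyEquiv f := by
  -- Both f and f' are homotopic to f ∘ s ∘ f'. Thus f is injective on homotopy groups because f'
  -- is. It is surjective because f ∘ s ∘ f' is the composite of the bijection induced by s ∘ f'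
  -- with a map that is onto since f ∘ s is.
  have h₁ : (f.comp (s.comp f')).Homotopy f := (ContinuousMap.Homotopy.refl f).comp H'
  have h₂ : (f.comp (s.comp f')).Homotopy f' := H.comp (ContinuousMap.Homotopy.refl f')
  constructor
  · have e := zerothHomotopyMap_eq_of_homotopy H
    have e' := zerothHomotopyMap_eq_of_homotopy H'
    have e₁ := (zerothHomotopyMap_eq_of_homotopy h₁).symm.trans
      (zerothHomotopyMap_eq_of_homotopy h₂)
    rw [zerothHomotopyMap_comp, zerothHomotopyMap_id] at e e'
    rw [← e₁] at e'
    exact Function.bijective_iff_has_inverse.2 ⟨_, congrFun e', congrFun e⟩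
  · intro n a
    have b := homotopyGroupMap_bijective_of_homotopy_id H' n a
    constructor
    · rw [← homotopyGroupMap_injective_iff h₁, homotopyGroupMap_injective_iff h₂]
      rw [homotopyGroupMap_comp] at b
      exact b.1.of_comp
    · rw [← homotopyGroupMap_surjective_iff h₁, homotopyGroupMap_comp]
      refine Function.Surjective.comp ?_ b.2
      have b' := homotopyGroupMap_bijective_of_homotopy_id H n (f' a)
      rw [homotopyGroupMap_comp] at b'
      exact b'.2.of_comp

end HomotopyGroups

/-! ### Compression of maps of pairs along weak homotopy equivalences -/

section Compression

open unitInterval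

variable {P P' : Type*} [TopologicalSpace P] [TopologicalSpace P']
variable {A B : Type u} [TopologicalSpace A] [TopologicalSpace B]

/-- Extension of a homotopy defined on a closed subset. -/
lemma GoodPair.extend {S : Set P} (hS : GoodPair S) (f : C(P, A)) (g : C(S × I, A))
    (h₀ : ∀ x : S, g (x, 0) = f x) :
    ∃ F : C(P × I, A), (∀ p, F (p, 0) = f p) ∧ ∀ (x : S) t, F (x, t) = g (x, t) := by
  classical
  let g' : P × I → A := fun z => if hz : z.1 ∈ S then g (⟨z.1, hz⟩, z.2) else f z.1
  have hg' : ∀ (x : S) t, g' (x, t) = g (x, t) := fun x t => dif_pos x.2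
  obtain ⟨F, hF, hFS⟩ := hS.hep.extend hS.isClosed f g' (by
      rw [continuousOn_iff_continuous_domRestrict]
      have : (Prod.fst ⁻¹' S).domRestrict g' =
          fun z => g (⟨z.1.1, z.2⟩, z.1.2) := funext fun z => hg' ⟨z.1.1, z.2⟩ z.1.2
      rw [this]
      fun_prop) fun p hp => (hg' ⟨p, hp⟩ 0).trans (h₀ _)
  exact ⟨F, hF, fun x t => (hFS x x.2 t).trans (hg' x t)⟩

/-- Filling of a box. -/
lemma GoodPair.fill_box {S : Set P} (hS : GoodPair S) (f : C(P × I, A)) (g₀ g₁ : C(P × I, A))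
    (g : C((S × I) × I, A)) (hg₀ : ∀ (x : S) t, g ((x, 0), t) = g₀ (x, t))
    (hg₁ : ∀ (x : S) t, g ((x, 1), t) = g₁ (x, t))
    (hf₀ : ∀ p, f (p, 0) = g₀ (p, 0)) (hf₁ : ∀ p, f (p, 1) = g₁ (p, 0))
    (hf : ∀ (x : S) s, f (x, s) = g ((x, s), 0)) :
    ∃ F : C((P × I) × I, A), (∀ z, F (z, 0) = f z) ∧ (∀ p t, F ((p, 0), t) = g₀ (p, t)) ∧
      (∀ p t, F ((p, 1), t) = g₁ (p, t)) ∧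
        ∀ (x : S) s t, F ((x, s), t) = g ((x, s), t) := by
  classical
  let g' : (P × I) × I → A := fun z =>
    if hz : z.1.1 ∈ S then g ((⟨z.1.1, hz⟩, z.1.2), z.2) else f z.1
  have hg' : ∀ (x : S) s t, g' ((x, s), t) = g ((x, s), t) := fun x s t => dif_pos x.2
  obtain ⟨F, h₁, h₂, h₃, h₄⟩ := hS.fill f g₀ g₁ g' (by
      rw [continuousOn_iff_continuous_domRestrict]
      have : Set.domRestrict {z : (P × I) × I | z.1.1 ∈ S} g' =
          fun z => g ((⟨z.1.1.1, z.2⟩, z.1.1.2), z.1.2) :=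
        funext fun z => hg' ⟨z.1.1.1, z.2⟩ z.1.1.2 z.1.2
      rw [this]
      fun_prop)
    (fun p hp t => (hg' ⟨p, hp⟩ 0 t).trans (hg₀ _ t))
    (fun p hp t => (hg' ⟨p, hp⟩ 1 t).trans (hg₁ _ t)) hf₀ hf₁
    (fun p hp s => (hf ⟨p, hp⟩ s).trans (hg' ⟨p, hp⟩ s 0).symm)
  exact ⟨F, h₁, h₂, h₃, fun x s t => (h₄ x x.2 s t).trans (hg' x s t)⟩

/-- A lift `w` of `v` through `g`, extending `u`, up to a homotopy extending `h`. -/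
def HasCompression (S : Set P) (g : C(A, B)) (u : C(S, A)) (h : C(S × I, B)) (v : C(P, B)) :
    Prop :=
  ∃ (w : C(P, A)) (W : C(P × I, B)), (∀ x : S, w x = u x) ∧ (∀ p, W (p, 0) = g (w p)) ∧
    (∀ p, W (p, 1) = v p) ∧ ∀ (x : S) t, W (x, t) = h (x, t)

/-- Maps of pairs can be compressed along `g`. -/
def Compresses (S : Set P) (g : C(A, B)) : Prop :=
  ∀ (u : C(S, A)) (h : C(S × I, B)) (v : C(P, B)), (∀ x, h (x, 0) = g (u x)) →
    (∀ x, h (x, 1) = v x) → HasCompression S g u h v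

lemma Compresses.of_homeomorph {S : Set P} {S' : Set P'} {g : C(A, B)} (e : P ≃ₜ P')
    (he : ∀ p, e p ∈ S' ↔ p ∈ S) (h' : Compresses S' g) : Compresses S g := by
  intro u h v h₀ h₁
  have hS : ∀ x : S', e.symm x ∈ S := fun x => by rw [← he]; simp
  let k : C(S', S) := ⟨fun x => ⟨e.symm x, hS x⟩, by fun_prop⟩
  obtain ⟨w, W, e₀, e₁, e₂, e₃⟩ := h' (u.comp k) (h.comp (k.prodMap (.id I)))
    (v.comp ⟨e.symm, e.symm.continuous⟩) (fun x => h₀ _) (fun x => h₁ _)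
  have hk : ∀ x : S, k ⟨e x, (he x).2 x.2⟩ = x := fun x => Subtype.ext (by simp [k])
  refine ⟨⟨fun p => w (e p), by fun_prop⟩, ⟨fun z => W (e z.1, z.2), by fun_prop⟩,
    fun x => ?_, fun p => e₁ _, fun p => ?_, fun x t => ?_⟩
  · exact (e₀ ⟨e x, (he x).2 x.2⟩).trans (congrArg u (hk x))
  · simp [e₂]
  · exact (e₃ ⟨e x, (he x).2 x.2⟩ t).trans (congrArg (fun y => h (y, t)) (hk x))

/-- Compressibility is invariant under homotopies of maps of pairs. -/
lemma HasCompression.of_homotopy {S : Set P} (hS : GoodPair S) {g : C(A, B)} (u : C(S × I, A))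
    (h : C((S × I) × I, B)) (v : C(P × I, B)) (h₀ : ∀ x t, h ((x, 0), t) = g (u (x, t)))
    (h₁ : ∀ x t, h ((x, 1), t) = v (x, t))
    (H : HasCompression S g ⟨fun x => u (x, 0), by fun_prop⟩ ⟨fun z => h (z, 0), by fun_prop⟩
      ⟨fun p => v (p, 0), by fun_prop⟩) :
    HasCompression S g ⟨fun x => u (x, 1), by fun_prop⟩ ⟨fun z => h (z, 1), by fun_prop⟩
      ⟨fun p => v (p, 1), by fun_prop⟩ := by
  obtain ⟨w, W, e₀, e₁, e₂, e₃⟩ := H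
  -- First carry the lift along the homotopy of its boundary values. Then fill a box with floor `W`,
  -- walls g ∘ w' and v, and side h; its face at time 1 is the new homotopy.
  obtain ⟨w', f₀, f₁⟩ := hS.extend w u fun x => (e₀ x).symm
  obtain ⟨F, -, k₁, k₂, k₃⟩ := hS.fill_box W (g.comp w') v h
    (fun x t => (h₀ x t).trans (congrArg g (f₁ x t).symm)) h₁
    (fun p => (e₁ p).trans (congrArg g (f₀ p).symm)) e₂ e₃
  exact ⟨⟨fun p => w' (p, 1), by fun_prop⟩, ⟨fun z => F (z, 1), by fun_prop⟩, fun x => f₁ x 1,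
    fun p => k₁ p 1, fun p => k₂ p 1, fun x t => k₃ x t 1⟩

/-- To show that maps of pairs can be compressed, one may precompose on the subspace with
a map homotopic to the identity, and assume that the diagram commutes. -/
lemma Compresses.of_deformation {S : Set P} (hS : GoodPair S) {g : C(A, B)} (k : C(S × I, S))
    (hk : ∀ x, k (x, 0) = x)
    (H : ∀ (u : C(S, A)) (v : C(P, B)), (∀ x : S, v x = g (u (k (x, 1)))) →
      HasCompression S g ⟨fun x => u (k (x, 1)), by fun_prop⟩
        ⟨fun z => g (u (k (z.1, 1))), by fun_prop⟩ v) : Compresses S g := by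
  intro u h v h₀ h₁
  -- On the subspace, `V` moves v backwards along h while k deforms the point. At time 1 it equals g
  -- ∘ u ∘ k₁, so the diagram commutes strictly there.
  obtain ⟨V, V₀, V₁⟩ := hS.extend v ⟨fun z => h (k z, σ z.2), by fun_prop⟩
    (fun x => by simp [hk, h₁])
  -- This runs the deformation in reverse, back to the given data. The product of the two parameters
  -- makes the homotopy constant at time 0 and equal to h at time 1.
  have := HasCompression.of_homotopy hS (g := g) ⟨fun z => u (k (z.1, σ z.2)), by fun_prop⟩
    ⟨fun z => h (k (z.1.1, σ z.2), z.1.2 * z.2), by fun_prop⟩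
    ⟨fun z => V (z.1, σ z.2), by fun_prop⟩
    (fun x t => by simp [h₀]) (fun x t => by simp [V₁]) (by
      obtain ⟨w, W, e₀, e₁, e₂, e₃⟩ := H u ⟨fun p => V (p, 1), by fun_prop⟩
        (fun x => by simp [V₁, h₀])
      exact ⟨w, W, fun x => by simp [e₀], e₁, fun p => by simp [e₂],
        fun x t => by simp [e₃, h₀]⟩)
  obtain ⟨w, W, e₀, e₁, e₂, e₃⟩ := this
  exact ⟨w, W, fun x => by simp [e₀, hk], e₁, fun p => by simp [e₂, V₀],
    fun x t => by simp [e₃, hk]⟩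

end Compression

/-! ### Contracting all faces but one of the boundary of a box -/

section FaceDeformation

open unitInterval

variable (V : Type*) [NormedAddCommGroup V]

/-- An auxiliary function for the deformation of the unit sphere of `ℝ × V`, which is positive
exactly on the interior of the face on which the first coordinate is `1`. -/
def faceFn (z : ballBd (ℝ × V)) : ℝ := z.1.1.1 - ‖z.1.1.2‖

lemma ballBd_prod_cases (z : ballBd (ℝ × V)) :
    z.1.1.1 = 1 ∨ z.1.1.1 = -1 ∨ ‖z.1.1.2‖ = 1 := by
  have h : max ‖z.1.1.1‖ ‖z.1.1.2‖ = 1 := z.2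
  rcases max_choice ‖z.1.1.1‖ ‖z.1.1.2‖ with h' | h' <;> rw [h'] at h
  · rw [Real.norm_eq_abs, abs_eq zero_le_one] at h
    tauto
  · tauto

lemma ballBd_prod_le (z : ballBd (ℝ × V)) : z.1.1.1 ≤ 1 := by
  have h : max ‖z.1.1.1‖ ‖z.1.1.2‖ = 1 := z.2
  exact (le_abs_self _).trans ((le_max_left _ _).trans h.le)

variable [NormedSpace ℝ V]

/-- The deformation of the unit sphere of `ℝ × V`, before normalization. -/
def faceDefAux (z : ballBd (ℝ × V) × I) : ℝ × V :=
  ((1 - z.2) * z.1.1.1.1 + z.2 * (2 * faceFn V z.1 - 1),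
    ((1 - z.2) + z.2 * max (faceFn V z.1) 0) • z.1.1.1.2)

/-- If the second coordinate vanishes, there are two cases. Either t = 1 and `faceFn` ≤ 0, and then
the first coordinate is 2 `faceFn` - 1 < 0. Or the V-component of the point is 0; then its first
coordinate is 1 or -1, and 2 `faceFn` - 1 is 1 or -3, so both terms being averaged have the same
sign. -/
lemma faceDefAux_ne_zero (z : ballBd (ℝ × V) × I) : faceDefAux V z ≠ 0 := by
  obtain ⟨z, t⟩ := z
  intro h
  have h₁ : (1 - (t : ℝ)) * z.1.1.1 + t * (2 * faceFn V z - 1) = 0 := congrArg Prod.fst h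
  have h₂ : ((1 - (t : ℝ)) + t * max (faceFn V z) 0) • z.1.1.2 = 0 := congrArg Prod.snd h
  have ht₀ := t.2.1
  have ht₁ := t.2.2
  rcases smul_eq_zero.1 h₂ with h₃ | h₃
  · have hm := le_max_right (faceFn V z) 0
    have h₄ : 0 ≤ t * max (faceFn V z) 0 := mul_nonneg ht₀ hm
    have ht : (t : ℝ) = 1 := by linarith
    rw [ht] at h₁ h₃
    have := le_max_left (faceFn V z) 0
    linarith
  · have hθ : faceFn V z = z.1.1.1 := by simp [faceFn, h₃]
    rw [hθ] at h₁
    rcases ballBd_prod_cases V z with h' | h' | h'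
    · rw [h'] at h₁
      linarith
    · rw [h'] at h₁
      linarith
    · rw [h₃] at h'
      simp at h'

lemma continuous_faceDefAux : Continuous (faceDefAux V) := by
  unfold faceDefAux faceFn
  fun_prop

lemma norm_faceDefAux_normalized (z : ballBd (ℝ × V) × I) :
    ‖‖faceDefAux V z‖⁻¹ • faceDefAux V z‖ = 1 := by
  rw [norm_smul, norm_inv, norm_norm, inv_mul_cancel₀]
  exact norm_ne_zero_iff.2 (faceDefAux_ne_zero V z)

/-- A deformation of the unit sphere of `ℝ × V` which contracts all faces to a point, except for
the one on which the first coordinate is `1`. -/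
def faceDef : C(ballBd (ℝ × V) × I, ballBd (ℝ × V)) where
  toFun z :=
    ⟨⟨‖faceDefAux V z‖⁻¹ • faceDefAux V z, 
    mem_closedBall_zero_iff.2 (norm_faceDefAux_normalized V z).le⟩, norm_faceDefAux_normalized V z⟩
  continuous_toFun := Continuous.subtype_mk (Continuous.subtype_mk
    (((continuous_faceDefAux V).norm.inv₀ fun z =>
      norm_ne_zero_iff.2 (faceDefAux_ne_zero V z)).smul (continuous_faceDefAux V)) _) _

lemma faceDef_zero (z : ballBd (ℝ × V)) : faceDef V (z, 0) = z := by
  have h : faceDefAux V (z, 0) = z.1.1 := by simp [faceDefAux]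
  have hz : ‖z.1.1‖ = 1 := z.2
  refine Subtype.ext (Subtype.ext ?_)
  change ‖faceDefAux V (z, 0)‖⁻¹ • faceDefAux V (z, 0) = z.1.1
  rw [h, hz, inv_one, one_smul]

/-- The center of the face on which the first coordinate is `-1`. -/
def faceCenter : ballBd (ℝ × V) :=
  ⟨⟨(-1, 0), by rw [mem_closedBall_zero_iff]; simp [Prod.norm_def]⟩,
    by change ‖((-1 : ℝ), (0 : V))‖ = 1; simp [Prod.norm_def]⟩

/-- On these faces `faceFn` ≤ 0, so at time 1 the V-component is killed and the first coordinate is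
negative; normalizing leaves (-1, 0). -/
lemma faceDef_one (z : ballBd (ℝ × V)) (hz : z.1.1.1 = -1 ∨ ‖z.1.1.2‖ = 1) :
    faceDef V (z, 1) = faceCenter V := by
  have hθ : faceFn V z ≤ 0 := by
    rcases hz with h | h
    · have := norm_nonneg z.1.1.2
      simp only [faceFn, h]
      linarith
    · have := ballBd_prod_le V z
      simp only [faceFn, h]
      linarith
  have h : faceDefAux V (z, 1) = (2 * faceFn V z - 1, 0) := by simp [faceDefAux, max_eq_right hθ]
  have hn : ‖faceDefAux V (z, 1)‖ = -(2 * faceFn V z - 1) := by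
    rw [h, Prod.norm_def, norm_zero, max_eq_left (norm_nonneg _), Real.norm_eq_abs,
      abs_of_nonpos (by linarith)]
  refine Subtype.ext (Subtype.ext ?_)
  change ‖faceDefAux V (z, 1)‖⁻¹ • faceDefAux V (z, 1) = (-1, 0)
  rw [hn, h]
  have hne : (2 * faceFn V z - 1) ≠ 0 := by linarith
  refine Prod.ext ?_ (smul_zero _)
  change (-(2 * faceFn V z - 1))⁻¹ * (2 * faceFn V z - 1) = -1
  rw [inv_neg, neg_mul, inv_mul_cancel₀ hne]

end FaceDeformation

/-! ### Compression of disks along weak homotopy equivalences -/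

section WeakCompression

open unitInterval

variable {A B : Type u} [TopologicalSpace A] [TopologicalSpace B]

/-- The map on generalized loops, indexed by any type, which is induced by a map of spaces. -/
def genLoopPush (N : Type) (g : C(A, B)) (a : A) : C(GenLoop N A a, GenLoop N B (g a)) where
  toFun γ := ⟨g.comp γ.1, fun y hy => congrArg g (γ.2 y hy)⟩
  continuous_toFun := Continuous.subtype_mk (by fun_prop) _

lemma genLoop_homotopic_congr {M N : Type} (e : M ≃ N) {a : A} {γ δ : GenLoop M A a}
    (h : GenLoop.Homotopic γ δ) :
    GenLoop.Homotopic (GenLoop.congr a e γ) (GenLoop.congr a e δ) := by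
  obtain ⟨K⟩ := h
  refine ⟨⟨⟨⟨fun z => K (z.1, fun m => z.2 (e m)), by fun_prop⟩, fun y => ?_, fun y => ?_⟩,
    fun t y hy => ?_⟩⟩
  · exact K.apply_zero _
  · exact K.apply_one _
  · obtain ⟨i, hi⟩ := hy
    exact K.eq_fst t ⟨e.symm i, by simpa using hi⟩

/-- A homotopy of generalized loops, as a path. -/
lemma joined_of_genLoop_homotopic {N : Type} {a : A} {γ δ : GenLoop N A a}
    (h : GenLoop.Homotopic γ δ) : Nonempty (Path γ δ) := by
  obtain ⟨K⟩ := h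
  let K' : C(I, C(N → I, A)) := K.toContinuousMap.curry
  refine ⟨⟨⟨fun t => ⟨K' t, fun y hy => (K.eq_fst t hy).trans (γ.2 y hy)⟩,
    K'.continuous.subtype_mk _⟩, ?_, ?_⟩⟩
  · ext y
    exact K.apply_zero y
  · ext y
    exact K.apply_one y

/-- Injectivity on π_m, transported from the index set Fin m to N. The general index set is needed
because splitting off a coordinate i of a loop leaves loops indexed by the j ≠ i. -/
lemma genLoop_homotopic_of_push {g : C(A, B)} (hg : IsWeakHomotopyEquiv g) {m : ℕ} {N : Type}
    (e : Fin m ≃ N) {a : A} {γ δ : GenLoop N A a}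
    (h : GenLoop.Homotopic (genLoopPush N g a γ) (genLoopPush N g a δ)) :
    GenLoop.Homotopic γ δ := by
  have h' := genLoop_homotopic_congr e.symm h
  have h₁ : GenLoop.Homotopic (GenLoop.congr a e.symm γ) (GenLoop.congr a e.symm δ) :=
    Quotient.exact ((hg.2 m a).1 (a₁ := Quotient.mk _ (GenLoop.congr a e.symm γ))
      (a₂ := Quotient.mk _ (GenLoop.congr a e.symm δ)) (Quotient.sound h'))
  have h₂ := genLoop_homotopic_congr e h₁
  have hc : ∀ γ : GenLoop N A a, GenLoop.congr a e (GenLoop.congr a e.symm γ) = γ := fun γ => by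
    ext y
    change γ (fun n => y (e (e.symm n))) = γ y
    simp
  rwa [hc, hc] at h₂

lemma path_trans_homotopic_of_homotopic {x y z : A} (p : Path x y) (r : Path x z) (q : Path y z)
    (h : q.Homotopic (p.symm.trans r)) : (p.trans q).Homotopic r := by
  rw [← Path.Homotopic.Quotient.eq] at h ⊢
  rw [Path.Homotopic.Quotient.mk_trans, h, Path.Homotopic.Quotient.mk_trans,
    Path.Homotopic.Quotient.mk_symm, ← Path.Homotopic.Quotient.trans_assoc,
    Path.Homotopic.Quotient.trans_symm, Path.Homotopic.Quotient.refl_trans]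

/-- A path of generalized loops which ends at the constant loop can be lifted along a weak
homotopy equivalence, when its source is lifted. -/
lemma exists_path_lift {g : C(A, B)} (hg : IsWeakHomotopyEquiv g) {m : ℕ} (i : Fin (m + 1))
    {a : A} (γ : GenLoop { j // j ≠ i } A a)
    (ν : Path (genLoopPush _ g a γ) GenLoop.const) :
    ∃ ω : Path γ GenLoop.const,
      (ω.map (genLoopPush _ g a).continuous).Homotopic ν := by
  let q := genLoopPush { j // j ≠ i } g a
  have hγ : GenLoop.Homotopic γ GenLoop.const := by
    refine genLoop_homotopic_of_push hg (finSuccAboveEquiv i) ?_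
    refine ⟨⟨⟨⟨fun z => ν z.1 z.2, by fun_prop⟩, fun y => ?_, fun y => ?_⟩, fun t y hy => ?_⟩⟩
    · simp
    · simp only [Path.target]; rfl
    · exact ((ν t).2 y hy).trans ((q γ).2 y hy).symm
  obtain ⟨ω₀⟩ := joined_of_genLoop_homotopic hγ
  let q₀ : Path (q γ) GenLoop.const := ω₀.map q.continuous
  -- The image of the nullhomotopy `ω₀` need not be `ν`. The difference is a loop in the space of
  -- generalized loops, hence an element of π_{m+1} of the target; lift it by surjectivity and
  -- correct `ω₀` by the lift.
  obtain ⟨⟨α⟩, hα⟩ := (hg.2 (m + 1) a).2 (Quotient.mk _ (GenLoop.fromLoop i (q₀.symm.trans ν)))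
  have hα' : GenLoop.Homotopic (genLoopMap g (m + 1) a α)
    (GenLoop.fromLoop i (q₀.symm.trans ν)) := Quotient.exact hα
  have h₁ := GenLoop.homotopicTo i hα'
  rw [GenLoop.to_from] at h₁
  refine ⟨ω₀.trans (GenLoop.toLoop i α), ?_⟩
  rw [Path.map_trans]
  exact path_trans_homotopic_of_homotopic q₀ ν _ h₁

/-- The unit ball of `ℝ × (N → ℝ)` as a cube. -/
def cubeBallHomeo (N : Type) [Fintype N] : I × (N → I) ≃ₜ Ball (ℝ × (N → ℝ)) where
  toFun z := ⟨(1 - 2 * z.1, cubeHomeo N z.2), by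
    rw [mem_closedBall_zero_iff, Prod.norm_def]
    refine max_le ?_ (norm_ball_le _ (cubeHomeo N z.2))
    rw [← norm_neg, neg_sub]
    exact abs_two_mul_sub_one z.1⟩
  invFun z := (⟨((-z.1.1) + 1) / 2, half_add_one_mem (by
      rw [abs_neg]
      exact (norm_fst_le z.1).trans (norm_ball_le _ z))⟩,
    (cubeHomeo N).symm ⟨z.1.2, by
      rw [mem_closedBall_zero_iff]
      exact (norm_snd_le z.1).trans (norm_ball_le _ z)⟩)
  left_inv z := by ext <;> simp
  right_inv z := by
    refine Subtype.ext (Prod.ext ?_ ?_)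
    · change 1 - 2 * (((-z.1.1) + 1) / 2) = z.1.1
      ring
    · simp
  continuous_toFun := by fun_prop
  continuous_invFun := by fun_prop

/-- After `faceDef`, the map on the sphere is constant on all faces but one. On the remaining face
it is a generalized loop `γ`, and the map v on the ball becomes a path `ν` of generalized loops from
g ∘ γ to the constant loop, with the path parameter running from the exempt face (s = 0) to the
opposite one (s = 1). A lift of this path relative to its end points, as in `exists_path_lift`, is
exactly a compression. -/
lemma compresses_prod {g : C(A, B)} (hg : IsWeakHomotopyEquiv g) {m : ℕ} (i : Fin (m + 1)) :
    Compresses (ballBd (ℝ × ({ j // j ≠ i } → ℝ))) g := by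
  let N := { j // j ≠ i }
  let e := cubeBallHomeo N
  refine Compresses.of_deformation (goodPair_ballBd _) (faceDef _) (faceDef_zero _)
    fun u v hv => ?_
  let a := u (faceCenter _)
  have he₀ : ∀ y, e (0, y) ∈ ballBd (ℝ × (N → ℝ)) := fun y => by
    change ‖((1 - 2 * ((0 : I) : ℝ)), ((cubeHomeo N y : N → ℝ)))‖ = 1
    rw [Prod.norm_def]
    simpa using norm_ball_le _ (cubeHomeo N y)
  -- In cube coordinates a point of the sphere lies on the exempt face s = 0, or on one of the faces
  -- that have been contracted to the base point `a`.
  have hbd : ∀ x : ballBd (ℝ × (N → ℝ)), (e.symm x).1 = 0 ∨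
      (((e.symm x).1 = 1 ∨ (e.symm x).2 ∈ Cube.boundary N) ∧ u (faceDef _ (x, 1)) = a) := fun x => by
    rcases ballBd_prod_cases _ x with h | h | h
    · left
      refine Subtype.ext ?_
      change ((-x.1.1.1) + 1) / 2 = 0
      rw [h]; norm_num
    · refine Or.inr ⟨Or.inl (Subtype.ext ?_), congrArg u (faceDef_one _ x (Or.inl h))⟩
      change ((-x.1.1.1) + 1) / 2 = 1
      rw [h]; norm_num
    · refine Or.inr ⟨Or.inr ?_, congrArg u (faceDef_one _ x (Or.inr h))⟩
      rw [← cubeHomeo_mem]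
      change (cubeHomeo N) ((cubeHomeo N).symm _) ∈ _
      rw [Homeomorph.apply_symm_apply]
      exact h
  have hside : ∀ s y, s = 1 ∨ y ∈ Cube.boundary N → ∃ h : e (s, y) ∈ ballBd (ℝ × (N → ℝ)),
      u (faceDef _ (⟨e (s, y), h⟩, 1)) = a := by
    rintro s y (rfl | hy)
    · have h : e (1, y) ∈ ballBd (ℝ × (N → ℝ)) := by
        change ‖((1 - 2 * ((1 : I) : ℝ)), ((cubeHomeo N y : N → ℝ)))‖ = 1
        rw [Prod.norm_def]
        have := norm_ball_le _ (cubeHomeo N y)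
        norm_num [this]
      refine ⟨h, congrArg u (faceDef_one _ _ (Or.inl ?_))⟩
      change 1 - 2 * ((1 : I) : ℝ) = -1
      norm_num
    · have h' : ‖(cubeHomeo N y : N → ℝ)‖ = 1 := (cubeHomeo_mem N y).2 hy
      have h : e (s, y) ∈ ballBd (ℝ × (N → ℝ)) := by
        refine le_antisymm (norm_ball_le _ _) ?_
        rw [← h']
        exact norm_snd_le (e (s, y)).1
      exact ⟨h, congrArg u (faceDef_one _ _ (Or.inr h'))⟩
  have hvside : ∀ s y, s = 1 ∨ y ∈ Cube.boundary N → v (e (s, y)) = g a := fun s y h => by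
    obtain ⟨h₁, h₂⟩ := hside s y h
    rw [← h₂]
    exact hv ⟨_, h₁⟩
  let γ : GenLoop N A a := ⟨⟨fun y => u (faceDef _ (⟨e (0, y), he₀ y⟩, 1)), by fun_prop⟩,
    fun y hy => (hside 0 y (Or.inr hy)).2⟩
  let V : C(I, C(N → I, B)) := (⟨fun z => v (e z), by fun_prop⟩ : C(I × (N → I), B)).curry
  let ν : Path (genLoopPush N g a γ) GenLoop.const :=
    { toFun := fun s => ⟨V s, fun y hy => hvside s y (Or.inr hy)⟩
      continuous_toFun := V.continuous.subtype_mk _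
      source' := by
        ext y
        exact hv ⟨e (0, y), he₀ y⟩
      target' := by
        ext y
        exact hvside 1 y (Or.inl rfl) }
  obtain ⟨ω, ⟨K⟩⟩ := exists_path_lift hg i γ ν
  have hωu : ∀ x : ballBd (ℝ × (N → ℝ)), ω (e.symm x).1 (e.symm x).2 = u (faceDef _ (x, 1)) := by
    intro x
    rcases hbd x with h | ⟨h | h, hu⟩
    · rw [h, ω.source]
      change u (faceDef _ (⟨e (0, (e.symm x).2), he₀ _⟩, 1)) = _
      congr 3
      refine Subtype.ext ?_
      change e (0, (e.symm x).2) = x.1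
      rw [← h]
      exact e.apply_symm_apply x.1
    · rw [h, ω.target, hu]
      rfl
    · rw [hu]
      exact (ω _).2 _ h
  refine ⟨⟨fun p => ω (e.symm p).1 (e.symm p).2, by fun_prop⟩,
    ⟨fun z => K (z.2, (e.symm z.1).1) (e.symm z.1).2, by fun_prop⟩, hωu, fun p => ?_, fun p => ?_,
    fun x t => ?_⟩
  · change K (0, _) _ = _
    rw [K.apply_zero]
    rfl
  · change K (1, _) _ = _
    rw [K.apply_one]
    exact congrArg v (e.apply_symm_apply p)
  · change K (t, _) _ = g (u (faceDef _ (x, 1)))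
    rw [← hωu]
    rcases hbd x with h | ⟨h | h, hu⟩
    · rw [h, K.source, ω.source]
      rfl
    · rw [h, K.target, ω.target]
      rfl
    · exact ((K (t, _)).2 _ h).trans (congrArg g ((ω _).2 _ h).symm)

/-- For n = 0 the sphere is empty and the claim is surjectivity on path components. For n > 0 the
Euclidean ball is compared with the ball of `compresses_prod`: the preimage of the latter under a
linear isomorphism is a bounded convex body with interior, and a homeomorphism of the ambient space
takes it to the unit ball, frontier to sphere. -/
lemma compresses_disk {g : C(A, B)} (hg : IsWeakHomotopyEquiv g) (n : ℕ) :
    Compresses (ballBd (EuclideanSpace ℝ (Fin n))) g := by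
  cases n with
  | zero =>
    intro u h v h₀ h₁
    have hS : ∀ x : ballBd (EuclideanSpace ℝ (Fin 0)), False := fun x => by
      have h : ‖x.1.1‖ = 1 := x.2
      rw [Subsingleton.elim x.1.1 0, norm_zero] at h
      exact zero_ne_one h
    let p₀ : Ball (EuclideanSpace ℝ (Fin 0)) := ⟨0, by simp⟩
    have hp : ∀ p, p = p₀ := fun p => Subsingleton.elim _ _
    obtain ⟨⟨a⟩, ha⟩ := hg.1.2 (Quotient.mk _ (v p₀))
    obtain ⟨c⟩ : Joined (g a) (v p₀) := Quotient.exact ha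
    exact ⟨ContinuousMap.const _ a, ⟨fun z => c z.2, by fun_prop⟩, fun x => (hS x).elim,
      fun p => c.source, fun p => by rw [hp p]; exact c.target, fun x => (hS x).elim⟩
  | succ m =>
    let N := { j : Fin (m + 1) // j ≠ 0 }
    let E := EuclideanSpace ℝ (Fin (m + 1))
    let L : E ≃L[ℝ] ℝ × (N → ℝ) := ContinuousLinearEquiv.ofFinrankEq (by
      simp [E, N, Module.finrank_prod]; omega)
    let s : Set E := L ⁻¹' Metric.closedBall 0 1
    have hs : Convex ℝ s := (convex_closedBall _ _).linear_preimage L.toLinearMap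
    have hcl : IsClosed s := Metric.isClosed_closedBall.preimage L.continuous
    have hint : interior s = L ⁻¹' Metric.ball 0 1 := by
      rw [← interior_closedBall _ one_ne_zero]
      exact (L.toHomeomorph.preimage_interior _).symm
    have hfr : frontier s = L ⁻¹' Metric.sphere 0 1 := by
      rw [← frontier_closedBall _ one_ne_zero]
      exact (L.toHomeomorph.preimage_frontier _).symm
    have hb : Bornology.IsBounded s := by
      have : s = L.symm '' Metric.closedBall 0 1 := (L.image_symm_eq_preimage _).symm
      rw [this]
      exact L.symm.lipschitz.isBounded_image Metric.isBounded_closedBall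
    obtain ⟨f, -, f₁, f₂⟩ := exists_homeomorph_image_interior_closure_frontier_eq_unitBall hs
      (by rw [hint]; exact ⟨0, by simp⟩) hb
    rw [hcl.closure_eq] at f₁
    have m₁ : ∀ x : E, x ∈ s ↔ f x ∈ Metric.closedBall (0 : E) 1 := fun x => by
      rw [← f₁, f.injective.mem_set_image]
    have m₂ : ∀ x : E, x ∈ frontier s ↔ f x ∈ Metric.sphere (0 : E) 1 := fun x => by
      rw [← f₂, f.injective.mem_set_image]
    let φ : Ball (ℝ × (N → ℝ)) ≃ₜ Ball E :=
      { toFun := fun z => ⟨f (L.symm z), (m₁ _).1 (by simp [s])⟩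
        invFun := fun z => ⟨L (f.symm z), (m₁ (f.symm z)).2 (by simp)⟩
        left_inv := fun z => by simp
        right_inv := fun z => by simp
        continuous_toFun := by fun_prop
        continuous_invFun := by fun_prop }
    refine (compresses_prod hg (0 : Fin (m + 1))).of_homeomorph φ.symm fun p => ?_
    have := m₂ (f.symm p)
    rw [hfr, f.apply_symm_apply, mem_sphere_zero_iff_norm] at this
    rw [Set.mem_preimage, mem_sphere_zero_iff_norm] at this
    exact this

end WeakCompression

/-! ### Path objects and the equivariant Whitehead theorem -/

section Equivariant

open unitInterval

variable {H : Type u} [Group H]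

lemma ρ_mul_apply (Y : Action TopCat.{u} H) (g h : H) (y : Y.V) :
    (Y.ρ (g * h)).hom y = (Y.ρ g).hom ((Y.ρ h).hom y) := by
  rw [map_mul]; rfl

lemma ρ_one_apply (Y : Action TopCat.{u} H) (y : Y.V) : (Y.ρ 1).hom y = y := by
  rw [map_one]; rfl

lemma hom_ρ_apply {Y Z : Action TopCat.{u} H} (f : Y ⟶ Z) (h : H) (y : Y.V) :
    f.hom.hom ((Y.ρ h).hom y) = (Z.ρ h).hom (f.hom.hom y) :=
  ConcreteCategory.congr_hom (f.comm h) y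

lemma action_hom_ext {Y Z : Action TopCat.{u} H} {f g : Y ⟶ Z}
    (h : ∀ y : Y.V, f.hom.hom y = g.hom.hom y) : f = g :=
  Action.hom_ext _ _ (TopCat.hom_ext (ContinuousMap.ext h))

/-- A continuous equivariant map, as a morphism. -/
def actionHomMk {Y Z : Action TopCat.{u} H} (f : Y.V → Z.V) (hf : Continuous f)
    (h : ∀ k y, f ((Y.ρ k).hom y) = (Z.ρ k).hom (f y)) : Y ⟶ Z where
  hom := TopCat.ofHom ⟨f, hf⟩
  comm k := TopCat.hom_ext (ContinuousMap.ext (h k))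

@[simp] lemma actionHomMk_apply {Y Z : Action TopCat.{u} H} (f : Y.V → Z.V) (hf : Continuous f)
    (h : ∀ k y, f ((Y.ρ k).hom y) = (Z.ρ k).hom (f y)) (y : Y.V) :
    (actionHomMk f hf h).hom.hom y = f y := rfl

/-- An `H`-space, from a continuous action. -/
def actionMk (V : Type u) [TopologicalSpace V] (a : H → V → V) (ha : ∀ k, Continuous (a k))
    (h₁ : ∀ v, a 1 v = v) (hm : ∀ k l v, a (k * l) v = a k (a l v)) : Action TopCat.{u} H where
  V := TopCat.of V
  ρ :=
    { toFun := fun k => TopCat.ofHom ⟨a k, ha k⟩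
      map_one' := TopCat.hom_ext (ContinuousMap.ext h₁)
      map_mul' := fun k l => TopCat.hom_ext (ContinuousMap.ext (hm k l)) }

/-- The space of paths. -/
def pathObj (Y : Action TopCat.{u} H) : Action TopCat.{u} H :=
  actionMk C(I, Y.V) (fun k γ => (Y.ρ k).hom.comp γ) (fun k => by fun_prop)
    (fun γ => ContinuousMap.ext fun t => ρ_one_apply Y (γ t))
    (fun k l γ => ContinuousMap.ext fun t => ρ_mul_apply Y k l (γ t))

/-- The functoriality of the space of paths. -/
def pathMap {Y Z : Action TopCat.{u} H} (f : Y ⟶ Z) : pathObj Y ⟶ pathObj Z :=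
  actionHomMk (Y := pathObj Y) (Z := pathObj Z) (fun γ : C(I, Y.V) => f.hom.hom.comp γ)
    (ContinuousMap.continuous_postcomp _)
    fun k γ => ContinuousMap.ext fun t => hom_ρ_apply f k ((show C(I, Y.V) from γ) t)

/-- The evaluation of paths. -/
def pathEval (t : I) (Y : Action TopCat.{u} H) : pathObj Y ⟶ Y :=
  actionHomMk (Y := pathObj Y) (fun γ : C(I, Y.V) => γ t) (continuous_eval_const (F := C(I, Y.V)) t)
    fun _ _ => rfl

/-- The constant paths. -/
def pathConst (Y : Action TopCat.{u} H) : Y ⟶ pathObj Y :=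
  actionHomMk (Z := pathObj Y) (fun y => ContinuousMap.const I y) ContinuousMap.continuous_const'
    fun _ _ => rfl

/-- The morphisms `f` and `g` are homotopic relative to `j`. -/
def HomotopicUnder {A Y Z : Action TopCat.{u} H} (j : A ⟶ Y) (f g : Y ⟶ Z) : Prop :=
  ∃ h : Y ⟶ pathObj Z, h ≫ pathEval 0 Z = f ∧ h ≫ pathEval 1 Z = g ∧ j ≫ h = (j ≫ f) ≫ pathConst Z

lemma mem_fixedSet_map {Y Z : Action TopCat.{u} H} (f : Y ⟶ Z) {J : Subgroup H} {y : Y.V}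
    (hy : y ∈ fixedSet Y J) : f.hom.hom y ∈ fixedSet Z J := fun h hh => by
  rw [← hom_ρ_apply, hy h hh]

/-- Homotopic morphisms are homotopic on fixed points. -/
lemma HomotopicUnder.fixedMap_homotopy {A Y Z : Action TopCat.{u} H} {j : A ⟶ Y} {f g : Y ⟶ Z}
    (h : HomotopicUnder j f g) (J : Subgroup H) :
    Nonempty ((fixedMap f J).Homotopy (fixedMap g J)) := by
  obtain ⟨h, h₀, h₁, -⟩ := h
  let h' : C(Y.V, C(I, Z.V)) := h.hom.hom
  have hfix : ∀ (y : fixedSet Y J) t, h' y.1 t ∈ fixedSet Z J := fun y t k hk => by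
    have := mem_fixedSet_map h y.2 k hk
    exact congrArg (fun γ : C(I, Z.V) => γ t) this
  refine ⟨⟨⟨fun z => ⟨h' z.2.1 z.1, hfix z.2 z.1⟩, ?_⟩, fun y => ?_, fun y => ?_⟩⟩
  · exact Continuous.subtype_mk (by fun_prop) _
  · exact Subtype.ext (ConcreteCategory.congr_hom (congrArg Action.Hom.hom h₀) y.1)
  · exact Subtype.ext (ConcreteCategory.congr_hom (congrArg Action.Hom.hom h₁) y.1)

/-- The mapping path space. -/
def pathFib {Y Z : Action TopCat.{u} H} (f : Y ⟶ Z) : Action TopCat.{u} H :=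
  actionMk { x : Y.V × C(I, Z.V) // x.2 0 = f.hom.hom x.1 }
    (fun k x => ⟨((Y.ρ k).hom x.1.1, (Z.ρ k).hom.comp x.1.2), by
      rw [hom_ρ_apply, ← x.2]; rfl⟩) (fun k => by fun_prop)
    (fun x => Subtype.ext (Prod.ext (ρ_one_apply Y x.1.1)
      (ContinuousMap.ext fun t => ρ_one_apply Z (x.1.2 t))))
    (fun k l x => Subtype.ext (Prod.ext (ρ_mul_apply Y k l x.1.1)
      (ContinuousMap.ext fun t => ρ_mul_apply Z k l (x.1.2 t))))

/-- The points of the mapping path space. -/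
abbrev PathFibPt {Y Z : Action TopCat.{u} H} (f : Y ⟶ Z) : Type u :=
  { x : Y.V × C(I, Z.V) // x.2 0 = f.hom.hom x.1 }

/-- The source of the path. -/
def pathFibFst {Y Z : Action TopCat.{u} H} (f : Y ⟶ Z) : pathFib f ⟶ Y :=
  actionHomMk (Y := pathFib f) (fun x : PathFibPt f => x.1.1) (by fun_prop) fun _ _ => rfl

/-- The path. -/
def pathFibSnd {Y Z : Action TopCat.{u} H} (f : Y ⟶ Z) : pathFib f ⟶ pathObj Z :=
  actionHomMk (Y := pathFib f) (Z := pathObj Z) (fun x : PathFibPt f => x.1.2)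
    (continuous_snd.comp continuous_subtype_val) fun _ _ => rfl

/-- The end point of the path. -/
def pathFibEnd {Y Z : Action TopCat.{u} H} (f : Y ⟶ Z) : pathFib f ⟶ Z :=
  pathFibSnd f ≫ pathEval 1 Z

lemma pathFibSnd_eval {Y Z : Action TopCat.{u} H} (f : Y ⟶ Z) :
    pathFibSnd f ≫ pathEval 0 Z = pathFibFst f ≫ f :=
  action_hom_ext fun x => (show PathFibPt f from x).2

/-- The base point of an orbit. -/
abbrev orbitBase (N : Subgroup H) {B : TopCat.{u}} (b : B) : (orbitProd N B).V :=
  (⟨((1 : H) : H ⧸ N), b⟩ : Σ _ : H ⧸ N, B)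

lemma ρ_orbitBase (N : Subgroup H) {B : TopCat.{u}} (h : H) (b : B) :
    ((orbitProd N B).ρ h).hom (orbitBase N b) = (⟨(h : H ⧸ N), b⟩ : Σ _ : H ⧸ N, B) :=
  Sigma.ext (congrArg (QuotientGroup.mk (s := N)) (mul_one h)) HEq.rfl

lemma orbitBase_mem_fixedSet (N : Subgroup H) {B : TopCat.{u}} (b : B) :
    orbitBase N b ∈ fixedSet (orbitProd N B) N := fun h hh => by
  rw [ρ_orbitBase]
  exact Sigma.ext (QuotientGroup.eq.2 (by simpa using hh)) HEq.rfl

lemma continuous_orbitBase (N : Subgroup H) {B : TopCat.{u}} :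
    Continuous (fun b : B => orbitBase N b) :=
  show Continuous (Sigma.mk (β := fun _ : H ⧸ N => B) _) from continuous_sigmaMk

/-- Morphisms out of `H/N × B` are determined by their values on `eN × B`. -/
lemma orbitProd_hom_ext {N : Subgroup H} {B : TopCat.{u}} {Y : Action TopCat.{u} H}
    {f g : orbitProd N B ⟶ Y} (h : ∀ b, f.hom.hom (orbitBase N b) = g.hom.hom (orbitBase N b)) :
    f = g := action_hom_ext fun z => by
  obtain ⟨q, b⟩ := (show Σ _ : H ⧸ N, B from z)
  induction q using QuotientGroup.induction_on with
  | H k => rw [← ρ_orbitBase, hom_ρ_apply, hom_ρ_apply, h]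

/-- A point fixed by N is moved by k in a way that depends only on the coset kN. This is what makes
maps out of H/N × B the same as maps from B to the N-fixed points. -/
lemma ρ_eq_of_mk_eq {N : Subgroup H} {Y : Action TopCat.{u} H} {y : Y.V} (hy : y ∈ fixedSet Y N)
    {k l : H} (h : (k : H ⧸ N) = l) : (Y.ρ k).hom y = (Y.ρ l).hom y := by
  have : l = k * (k⁻¹ * l) := by group
  rw [this, ρ_mul_apply, hy _ (QuotientGroup.eq.1 h)]

/-- The morphism out of `H/N × B` with given values on `eN × B`. -/
def orbitProdDesc {N : Subgroup H} {B : TopCat.{u}} {Y : Action TopCat.{u} H} (f : B → Y.V)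
    (hf : Continuous f) (h : ∀ b, f b ∈ fixedSet Y N) : orbitProd N B ⟶ Y :=
  actionHomMk (Y := orbitProd N B) (fun z : Σ _ : H ⧸ N, B => (Y.ρ z.1.out).hom (f z.2))
    (continuous_sigma fun q => (Y.ρ q.out).hom.continuous.comp hf) fun k z => by
      rw [← ρ_mul_apply]
      obtain ⟨q, b⟩ := (show Σ _ : H ⧸ N, B from z)
      refine ρ_eq_of_mk_eq (h b) ?_
      change ((k • q).out : H ⧸ N) = ((k * q.out : H) : H ⧸ N)
      rw [QuotientGroup.out_eq']
      conv_lhs => rw [← QuotientGroup.out_eq' q]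
      rfl

lemma orbitProdDesc_base {N : Subgroup H} {B : TopCat.{u}} {Y : Action TopCat.{u} H} (f : B → Y.V)
    (hf : Continuous f) (h : ∀ b, f b ∈ fixedSet Y N) (b : B) :
    (orbitProdDesc f hf h).hom.hom (orbitBase N b) = f b := by
  refine Eq.trans (ρ_eq_of_mk_eq (h b) ?_) (ρ_one_apply Y (f b))
  exact QuotientGroup.out_eq' _

/-- The cells have the left lifting property with respect to the end point projection of the
mapping path space of a weak equivalence. -/
lemma hasLiftingProperty_basicCell {Y Z : Action TopCat.{u} H} (f : Y ⟶ Z)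
    (hf : ∀ J : Subgroup H, IsWeakHomotopyEquiv (fixedMap f J)) (c : Subgroup H × ℕ) :
    HasLiftingProperty (basicCell H c) (pathFibEnd f) := by
  obtain ⟨N, n⟩ := c
  refine ⟨fun {top bot} sq => ?_⟩
  let E := EuclideanSpace ℝ (Fin n)
  let toS : ballBd E → TopCat.diskBoundary.{u} n := fun x =>
    ULift.up ⟨x.1.1, mem_sphere_zero_iff_norm.2 x.2⟩
  have htoS : Continuous toS := continuous_uliftUp.comp (by fun_prop)
  let toD : Ball E → TopCat.disk.{u} n := ULift.up
  have htoD : Continuous toD := continuous_uliftUp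
  have hSD : ∀ x, TopCat.diskBoundaryInclusion n (toS x) = toD x.1 := fun x => rfl
  let τ : ballBd E → PathFibPt f := fun x => top.hom.hom (orbitBase N (toS x))
  have hτ : Continuous τ := top.hom.hom.continuous.comp ((continuous_orbitBase N).comp htoS)
  have hfix : ∀ x, (τ x : (pathFib f).V) ∈ fixedSet (pathFib f) N := fun x =>
    mem_fixedSet_map top (orbitBase_mem_fixedSet N (toS x))
  have hfix₁ : ∀ x, (τ x).1.1 ∈ fixedSet Y N := fun x => mem_fixedSet_map (pathFibFst f) (hfix x)
  have hfix₂ : ∀ x t, (τ x).1.2 t ∈ fixedSet Z N := fun x t =>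
    mem_fixedSet_map (pathFibSnd f ≫ pathEval t Z) (hfix x)
  let β : Ball E → Z.V := fun p => bot.hom.hom (orbitBase N (toD p))
  have hβ : Continuous β := bot.hom.hom.continuous.comp ((continuous_orbitBase N).comp htoD)
  have hfixβ : ∀ p, β p ∈ fixedSet Z N := fun p =>
    mem_fixedSet_map bot (orbitBase_mem_fixedSet N (toD p))
  -- Restricted to eN, the lifting problem takes place in N-fixed points. A map of the sphere to the
  -- mapping path space is a map u together with a homotopy starting at f ∘ u, and the lower square
  -- says that the homotopy ends at the map of the disk: these are the data of a compression problem
  -- along the fixed-point map.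
  obtain ⟨w, W, e₀, e₁, e₂, e₃⟩ := compresses_disk (hf N) n
    ⟨fun x => ⟨(τ x).1.1, hfix₁ x⟩, by fun_prop⟩
    ⟨fun z => ⟨(τ z.1).1.2 z.2, hfix₂ z.1 z.2⟩, Continuous.subtype_mk (by fun_prop) _⟩
    ⟨fun p => ⟨β p, hfixβ p⟩, by fun_prop⟩
    (fun x => Subtype.ext (τ x).2)
    (fun x => Subtype.ext
      (ConcreteCategory.congr_hom (congrArg Action.Hom.hom sq.w) (orbitBase N (toS x))))
  let W' : C(Ball E, C(I, Z.V)) :=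
    (⟨fun z => (W z).1, by fun_prop⟩ : C(Ball E × I, Z.V)).curry
  let l : TopCat.disk.{u} n → PathFibPt f := fun d =>
    ⟨((w d.down).1, W' d.down), congrArg Subtype.val (e₁ d.down)⟩
  have hl : Continuous l := by
    have : Continuous (ULift.down : TopCat.disk.{u} n → Ball E) := continuous_uliftDown
    fun_prop
  have hlfix : ∀ d, (l d : (pathFib f).V) ∈ fixedSet (pathFib f) N := fun d k hk =>
    Subtype.ext (Prod.ext ((w d.down).2 k hk)
      (ContinuousMap.ext fun t => (W (d.down, t)).2 k hk))
  refine ⟨⟨⟨orbitProdDesc (Y := pathFib f) l hl hlfix, ?_, ?_⟩⟩⟩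
  · refine orbitProd_hom_ext fun b => ?_
    let x : ballBd E := ⟨⟨b.down.1, Metric.sphere_subset_closedBall b.down.2⟩,
      mem_sphere_zero_iff_norm.1 b.down.2⟩
    refine (orbitProdDesc_base (Y := pathFib f) l hl hlfix (toD x.1)).trans ?_
    exact Subtype.ext (Prod.ext (congrArg Subtype.val (e₀ x))
      (ContinuousMap.ext fun t => congrArg Subtype.val (e₃ x t)))
  · refine orbitProd_hom_ext fun b => ?_
    refine (congrArg (pathFibEnd f).hom.hom
      (orbitProdDesc_base (Y := pathFib f) l hl hlfix b)).trans ?_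
    exact congrArg Subtype.val (e₂ b.down)

/-- Left lifting properties pass from the cells to coproducts, pushouts and transfinite
compositions. -/
lemma hasLiftingProperty_relCellStructure {A Y Z W : Action TopCat.{u} H} {j : A ⟶ W}
    (c : RelCellStructure j) (f : Y ⟶ Z)
    (hf : ∀ J : Subgroup H, IsWeakHomotopyEquiv (fixedMap f J)) :
    HasLiftingProperty j (pathFibEnd f) := by
  have h := (RelativeCellComplex.transfiniteCompositionOfShape (basicCell H) c).mem
  refine MorphismProperty.transfiniteCompositionsOfShape_pushouts_coproducts_le_llp_rlp _ _ _ h _ ?_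
  rintro _ _ _ ⟨a⟩
  exact hasLiftingProperty_basicCell f hf a

/-- A weak equivalence to a relative cell complex has a homotopy section. -/
lemma exists_homotopy_section {A Y Z : Action TopCat.{u} H} {i : A ⟶ Y} {j : A ⟶ Z}
    (c : RelCellStructure j) (f : Y ⟶ Z) (hij : i ≫ f = j)
    (hf : ∀ J : Subgroup H, IsWeakHomotopyEquiv (fixedMap f J)) :
    ∃ s : Z ⟶ Y, j ≫ s = i ∧ HomotopicUnder j (s ≫ f) (𝟙 Z) := by
  have := hasLiftingProperty_relCellStructure c f hf
  -- Use constant paths over the base. A lift of the identity of Z through the end point map then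
  -- consists of a map s : Z ⟶ Y and a homotopy from s ≫ f to the identity, stationary on A.
  let top : A ⟶ pathFib f := actionHomMk (Z := pathFib f)
    (fun a => (⟨(i.hom.hom a, ContinuousMap.const I (j.hom.hom a)),
      (ConcreteCategory.congr_hom (congrArg Action.Hom.hom hij) a).symm⟩ : PathFibPt f))
    (by fun_prop) fun k a => Subtype.ext (Prod.ext (hom_ρ_apply i k a)
      (ContinuousMap.ext fun t => hom_ρ_apply j k a))
  have sq : CommSq top j (pathFibEnd f) (𝟙 Z) := ⟨by rw [Category.comp_id]; rfl⟩
  refine ⟨sq.lift ≫ pathFibFst f, ?_, sq.lift ≫ pathFibSnd f, ?_, ?_, ?_⟩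
  · rw [← Category.assoc, sq.fac_left]; rfl
  · rw [Category.assoc, pathFibSnd_eval, Category.assoc]
  · rw [Category.assoc]
    exact sq.fac_right
  · rw [← Category.assoc, sq.fac_left, Category.assoc sq.lift, ← Category.assoc j, sq.fac_left]
    subst hij
    rfl

/-- The equivariant Whitehead theorem, relative to a subspace. -/
lemma exists_homotopy_sections {A Y Z : Action TopCat.{u} H} {i : A ⟶ Y} {j : A ⟶ Z}
    (b : RelCellStructure i) (c : RelCellStructure j) (f : Y ⟶ Z) (hij : i ≫ f = j)
    (hf : ∀ J : Subgroup H, IsWeakHomotopyEquiv (fixedMap f J)) :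
    ∃ (s : Z ⟶ Y) (f' : Y ⟶ Z), j ≫ s = i ∧ i ≫ f' = j ∧ HomotopicUnder j (s ≫ f) (𝟙 Z) ∧
      HomotopicUnder i (f' ≫ s) (𝟙 Y) := by
  obtain ⟨s, hs, h⟩ := exists_homotopy_section c f hij hf
  -- The section s is itself a weak equivalence, and Y is also a relative cell complex, so the same
  -- argument applies to s.
  obtain ⟨f', hf', h'⟩ := exists_homotopy_section b s hs fun J =>
    (hf J).of_section (h.fixedMap_homotopy J).some
  exact ⟨s, f', hs, hf', h, h'⟩

/-- A morphism is a weak equivalence if it has a homotopy section which has a homotopy section. -/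
lemma isWeakHomotopyEquiv_fixedMap {A Y Z : Action TopCat.{u} H} {i : A ⟶ Y} {j : A ⟶ Z}
    {f f' : Y ⟶ Z} {s : Z ⟶ Y} (h : HomotopicUnder j (s ≫ f) (𝟙 Z))
    (h' : HomotopicUnder i (f' ≫ s) (𝟙 Y)) (J : Subgroup H) :
    IsWeakHomotopyEquiv (fixedMap f J) :=
  isWeakHomotopyEquiv_of_sections (s := fixedMap s J) (f' := fixedMap f' J)
    (h.fixedMap_homotopy J).some (h'.fixedMap_homotopy J).some

end Equivariant

/-! ### Twisted products -/

section Twist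

open unitInterval

/-- A cocycle on a `K`-set `T` with values in a group `H`. -/
structure Cocycle (H K : Type u) [Group H] [Group K] (T : Type) [MulAction K T] where
  toFun : K → T → H
  map_mul : ∀ k l i, toFun (k * l) i = toFun k (l • i) * toFun l i

variable {H K : Type u} [Group H] [Group K] {T : Type} [MulAction K T]

namespace Cocycle

variable (c : Cocycle H K T)

lemma map_one (i : T) : c.toFun 1 i = 1 := by
  have h := c.map_mul 1 1 i
  rw [mul_one, one_smul] at h
  exact left_eq_mul.1 h

/-- The `K`-space `T × Y`, for an `H`-space `Y`, with `K` acting on `Y` through the cocycle. -/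
def twistObj (Y : Action TopCat.{u} H) : Action TopCat.{u} K :=
  actionMk (Σ _ : T, Y.V) (fun k z => ⟨k • z.1, (Y.ρ (c.toFun k z.1)).hom z.2⟩)
    (fun k => continuous_sigma fun i =>
      (show Continuous (Sigma.mk (β := fun _ : T => Y.V) (k • i)) from continuous_sigmaMk).comp
        (Y.ρ (c.toFun k i)).hom.continuous)
    (fun z => Sigma.ext (one_smul K z.1) (heq_of_eq (by
      rw [c.map_one]
      exact ρ_one_apply Y z.2)))
    (fun k l z => Sigma.ext (mul_smul k l z.1) (heq_of_eq (by
      rw [c.map_mul]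
      exact ρ_mul_apply Y _ _ z.2)))

/-- The points of the twisted product. -/
abbrev twistPt (i : T) {Y : Action TopCat.{u} H} (y : Y.V) : (c.twistObj Y).V :=
  (⟨i, y⟩ : Σ _ : T, Y.V)

lemma continuous_twistPt (i : T) {Y : Action TopCat.{u} H} :
    Continuous (fun y : Y.V => c.twistPt i y) :=
  show Continuous (Sigma.mk (β := fun _ : T => Y.V) i) from continuous_sigmaMk

lemma ρ_twistPt (k : K) (i : T) {Y : Action TopCat.{u} H} (y : Y.V) :
    ((c.twistObj Y).ρ k).hom (c.twistPt i y) =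
      c.twistPt (k • i) ((Y.ρ (c.toFun k i)).hom y) := rfl

/-- A morphism out of a twisted product. -/
def twistDesc {Y : Action TopCat.{u} H} {W : Action TopCat.{u} K} (f : T → Y.V → W.V)
    (hf : ∀ i, Continuous (f i))
    (h : ∀ k i y, f (k • i) ((Y.ρ (c.toFun k i)).hom y) = (W.ρ k).hom (f i y)) :
    c.twistObj Y ⟶ W :=
  actionHomMk (Y := c.twistObj Y) (fun z : Σ _ : T, Y.V => f z.1 z.2) (continuous_sigma hf)
    fun k z => h k z.1 z.2

lemma twist_hom_ext {Y : Action TopCat.{u} H} {W : Action TopCat.{u} K} {f g : c.twistObj Y ⟶ W}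
    (h : ∀ i y, f.hom.hom (c.twistPt i y) = g.hom.hom (c.twistPt i y)) : f = g :=
  action_hom_ext fun z => h z.1 z.2

/-- The twisted product, as a functor. -/
def twist : Action TopCat.{u} H ⥤ Action TopCat.{u} K where
  obj := c.twistObj
  map {Y Z} f := c.twistDesc (W := c.twistObj Z) (fun i y => c.twistPt i (f.hom.hom y))
    (fun i => (c.continuous_twistPt i).comp f.hom.hom.continuous)
    fun k i y => by rw [hom_ρ_apply, ρ_twistPt]

end Cocycle

/-- The product with a discrete space, as a functor. -/
def sigmaFunctor (T : Type) : TopCat.{u} ⥤ TopCat.{u} where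
  obj B := TopCat.of (Σ _ : T, B)
  map {B B'} f := TopCat.ofHom ⟨fun z => ⟨z.1, f z.2⟩, continuous_sigma fun i =>
    (show Continuous (Sigma.mk (β := fun _ : T => B') i) from continuous_sigmaMk).comp
      f.hom.continuous⟩

/-- The power of a space, as a functor. -/
def powerFunctor (T : Type) : TopCat.{u} ⥤ TopCat.{u} where
  obj B := TopCat.of (T → B)
  map {B B'} f := TopCat.ofHom ⟨fun z i => f (z i), by fun_prop⟩

/-- The product with a discrete space is left adjoint to the power. -/
def sigmaAdjunction (T : Type) : sigmaFunctor.{u} T ⊣ powerFunctor.{u} T :=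
  Adjunction.mkOfHomEquiv
    { homEquiv := fun B B' =>
        { toFun := fun f => TopCat.ofHom ⟨fun b i => f (⟨i, b⟩ : Σ _ : T, B), continuous_pi fun i =>
            f.hom.continuous.comp
              (show Continuous (Sigma.mk (β := fun _ : T => B) i) from continuous_sigmaMk)⟩
          invFun := fun g => TopCat.ofHom ⟨fun z : Σ _ : T, B => (show T → B' from g z.2) z.1,
            continuous_sigma fun i => (continuous_apply (A := fun _ : T => B') i).comp
              g.hom.continuous⟩
          left_inv := fun _ => rfl
          right_inv := fun _ => rfl }
      homEquiv_naturality_left_symm := fun _ _ => rfl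
      homEquiv_naturality_right := fun _ _ => rfl }

instance (T : Type) : (sigmaFunctor.{u} T).IsLeftAdjoint := (sigmaAdjunction T).isLeftAdjoint

/-- Colimits of K-spaces can be checked after forgetting the action. There the twisted product is T
× −, whatever the cocycle, and this has a right adjoint. -/
instance (c : Cocycle H K T) {J : Type w} [Category.{v} J] [HasColimitsOfShape J TopCat.{u}] :
    PreservesColimitsOfShape J c.twist := by
  have : PreservesColimitsOfShape J (c.twist ⋙ Action.forget TopCat.{u} K) :=
    inferInstanceAs (PreservesColimitsOfShape J
      (Action.forget TopCat.{u} H ⋙ sigmaFunctor.{u} T))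
  exact Action.preservesColimitsOfShape_of_preserves _ this

namespace Cocycle

variable (c : Cocycle H K T)

/-- The map from the twisted product of a path space to the path space of the twisted product. -/
def twistPath (Y : Action TopCat.{u} H) : c.twist.obj (pathObj Y) ⟶ pathObj (c.twist.obj Y) :=
  c.twistDesc (Y := pathObj Y) (W := pathObj (c.twist.obj Y))
    (fun i (γ : C(I, Y.V)) => (⟨fun y => c.twistPt i y, c.continuous_twistPt i⟩ :
      C(Y.V, (c.twist.obj Y).V)).comp γ)
    (fun _ => ContinuousMap.continuous_postcomp _) fun _ _ _ => rfl

/-- The identification of the twisted product of a cylinder with a cylinder. -/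
def twistCyl (Y : Action TopCat.{u} H) : c.twist.obj (cyl Y) ⟶ cyl (c.twist.obj Y) :=
  c.twistDesc (Y := cyl Y) (W := cyl (c.twist.obj Y))
    (fun i (z : Y.V × I) => (⟨c.twistPt i z.1, z.2⟩ : (c.twist.obj Y).V × I))
    (fun i => Continuous.prodMk ((c.continuous_twistPt i).comp continuous_fst) continuous_snd)
    fun _ _ _ => rfl

end Cocycle

/-- The path of maps which corresponds to a map out of a cylinder. -/
def cylCurry {Y W : Action TopCat.{u} H} (f : cyl Y ⟶ W) : Y ⟶ pathObj W :=
  actionHomMk (Z := pathObj W) (fun y => f.hom.hom.curry y) (ContinuousMap.continuous _)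
    fun k y => ContinuousMap.ext fun t => hom_ρ_apply f k ((y, t) : Y.V × I)

/-- The map out of a cylinder which corresponds to a path of maps. -/
def cylUncurry {Y W : Action TopCat.{u} H} (f : Y ⟶ pathObj W) : cyl Y ⟶ W :=
  actionHomMk (Y := cyl Y) (fun z : Y.V × I => (show C(Y.V, C(I, W.V)) from f.hom.hom).uncurry z)
    (ContinuousMap.continuous _) fun k z =>
      congrArg (fun γ : C(I, W.V) => γ z.2) (hom_ρ_apply f k z.1)

lemma cylUncurry_curry {Y W : Action TopCat.{u} H} (f : cyl Y ⟶ W) :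
    cylUncurry (cylCurry f) = f := rfl

lemma cylUncurry_comp {Y Z W : Action TopCat.{u} H} (f : Y ⟶ Z) (g : Z ⟶ pathObj W) :
    cylUncurry (f ≫ g) = cylMap f ≫ cylUncurry g := rfl

lemma cylCurry_pathMap {Y W W' : Action TopCat.{u} H} (f : cyl Y ⟶ W) (g : W ⟶ W') :
    cylCurry f ≫ pathMap g = cylCurry (f ≫ g) := rfl

lemma cylCurry_eval {Y W : Action TopCat.{u} H} (f : cyl Y ⟶ W) :
    cylCurry f ≫ pathEval 1 W = cylEnd Y ≫ f := rfl

lemma cylCurry_proj {Y W : Action TopCat.{u} H} (f : Y ⟶ W) :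
    cylCurry (cylProj Y ≫ f) = f ≫ pathConst W := rfl

lemma inl_mappingCylinderIncl {Y Z : Action TopCat.{u} H} (f : Y ⟶ Z) :
    pushout.inl (cylEnd Y) f ≫ mappingCylinderIncl f = cylMap f := pushout.inl_desc _ _ _

lemma inr_mappingCylinderIncl {Y Z : Action TopCat.{u} H} (f : Y ⟶ Z) :
    pushout.inr (cylEnd Y) f ≫ mappingCylinderIncl f = cylEnd Z := pushout.inr_desc _ _ _

lemma inl_mappingCylinderProj {A : Action TopCat.{u} H} {Y Z : Retractive A} (f : Y ⟶ Z) :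
    pushout.inl (cylEnd Y.obj) f.hom ≫ mappingCylinderProj f = cylProj Y.obj ≫ Y.p :=
  pushout.inl_desc _ _ _

lemma inr_mappingCylinderProj {A : Action TopCat.{u} H} {Y Z : Retractive A} (f : Y ⟶ Z) :
    pushout.inr (cylEnd Y.obj) f.hom ≫ mappingCylinderProj f = Z.p := pushout.inr_desc _ _ _

/-- The fibrewise homotopy extension property, for maps to an arbitrary space over the base. -/
lemma fhep_iff {A : Action TopCat.{u} H} {Y Z : Retractive A} (f : Y ⟶ Z) :
    fhep A f ↔ ∀ (W : Action TopCat.{u} H) (p : W ⟶ A) (a : cyl Y.obj ⟶ W) (b : Z.obj ⟶ W),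
      cylEnd Y.obj ≫ a = f.hom ≫ b → a ≫ p = cylProj Y.obj ≫ Y.p → b ≫ p = Z.p →
      ∃ h : cyl Z.obj ⟶ W, cylMap f.hom ≫ h = a ∧ cylEnd Z.obj ≫ h = b ∧
        h ≫ p = cylProj Z.obj ≫ Z.p := by
  constructor
  · rintro ⟨r, hr, hp⟩ W p a b hab ha hb
    have h₁ : cylMap f.hom ≫ r = pushout.inl _ _ := by
      rw [← inl_mappingCylinderIncl, Category.assoc, hr, Category.comp_id]
    have h₂ : cylEnd Z.obj ≫ r = pushout.inr _ _ := by
      rw [← inr_mappingCylinderIncl f.hom, Category.assoc, hr, Category.comp_id]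
    have h₃ : pushout.desc a b hab ≫ p = mappingCylinderProj f := by
      refine pushout.hom_ext ?_ ?_
      · rw [pushout.inl_desc_assoc, ha]
        exact (pushout.inl_desc _ _ _).symm
      · rw [pushout.inr_desc_assoc, hb]
        exact (pushout.inr_desc _ _ _).symm
    refine ⟨r ≫ pushout.desc a b hab, ?_, ?_, ?_⟩
    · rw [← Category.assoc, h₁, pushout.inl_desc]
    · rw [← Category.assoc, h₂, pushout.inr_desc]
    · rw [Category.assoc, h₃, hp]
  · intro h
    obtain ⟨r, h₁, h₂, h₃⟩ := h (mappingCylinder f.hom) (mappingCylinderProj f)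
      (pushout.inl _ _) (pushout.inr _ _) pushout.condition (pushout.inl_desc _ _ _)
      (pushout.inr_desc _ _ _)
    refine ⟨r, pushout.hom_ext ?_ ?_, h₃⟩
    · rw [Category.comp_id, ← Category.assoc, inl_mappingCylinderIncl, h₁]
    · rw [Category.comp_id, ← Category.assoc, inr_mappingCylinderIncl, h₂]

/-! ### Transfers of retractive spaces -/

/-- The retractive space `P` is obtained from the twisted product `T × Y` of `Y` by a change of
base along `d`. -/
structure IsTransfer (c : Cocycle H K T) {A : Action TopCat.{u} H} {A' : Action TopCat.{u} K}
    (d : c.twist.obj A ⟶ A') (Y : Retractive A) (P : Retractive A')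
    (η : c.twist.obj Y.obj ⟶ P.obj) : Prop where
  isPushout : IsPushout (c.twist.map Y.i) d η P.i
  comp_p : η ≫ P.p = c.twist.map Y.p ≫ d

namespace IsTransfer

variable {c : Cocycle H K T} {A : Action TopCat.{u} H} {A' : Action TopCat.{u} K}
  {d : c.twist.obj A ⟶ A'} {Y Z : Retractive A} {P Q : Retractive A'}
  {η : c.twist.obj Y.obj ⟶ P.obj} {θ : c.twist.obj Z.obj ⟶ Q.obj}

/-- The map of transfers induced by a map under the base. -/
def desc (hP : IsTransfer c d Y P η) (hQ : IsTransfer c d Z Q θ) (s : Y.obj ⟶ Z.obj)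
    (hs : Y.i ≫ s = Z.i) : P.obj ⟶ Q.obj :=
  hP.isPushout.desc (c.twist.map s ≫ θ) Q.i (by
    rw [← Category.assoc, ← c.twist.map_comp, hs, hQ.isPushout.w])

lemma inl_desc (hP : IsTransfer c d Y P η) (hQ : IsTransfer c d Z Q θ) (s : Y.obj ⟶ Z.obj)
    (hs : Y.i ≫ s = Z.i) : η ≫ hP.desc hQ s hs = c.twist.map s ≫ θ :=
  hP.isPushout.inl_desc _ _ _

lemma inr_desc (hP : IsTransfer c d Y P η) (hQ : IsTransfer c d Z Q θ) (s : Y.obj ⟶ Z.obj)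
    (hs : Y.i ≫ s = Z.i) : P.i ≫ hP.desc hQ s hs = Q.i :=
  hP.isPushout.inr_desc _ _ _

lemma desc_eq (hP : IsTransfer c d Y P η) (hQ : IsTransfer c d Z Q θ) {f : Y ⟶ Z} {φ : P ⟶ Q}
    (h : η ≫ φ.hom = c.twist.map f.hom ≫ θ) : hP.desc hQ f.hom f.i_hom = φ.hom := by
  refine hP.isPushout.hom_ext ?_ ?_
  · rw [inl_desc, h]
  · rw [inr_desc, φ.i_hom]

/-- The transfer of a homotopy. -/
lemma homotopicUnder (hP : IsTransfer c d Y P η) (hQ : IsTransfer c d Z Q θ)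
    {s : Y.obj ⟶ Z.obj} {s' : Z.obj ⟶ Y.obj} (hs : Y.i ≫ s = Z.i) (hs' : Z.i ≫ s' = Y.i)
    (h : HomotopicUnder Y.i (s ≫ s') (𝟙 _)) :
    HomotopicUnder P.i (hP.desc hQ s hs ≫ hQ.desc hP s' hs') (𝟙 _) := by
  obtain ⟨h, h₀, h₁, hi⟩ := h
  -- The homotopy is stationary on the base, so its twisted product glues with the constant homotopy
  -- on A'. No compatibility with the projections to the base is involved.
  have key : c.twist.map Y.i ≫ c.twist.map h ≫ c.twistPath Y.obj ≫ pathMap η =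
      d ≫ P.i ≫ pathConst P.obj := by
    rw [← Category.assoc, ← c.twist.map_comp, hi, ← Category.assoc d, ← hP.isPushout.w,
      ← Category.assoc Y.i, hs, hs']
    rfl
  refine ⟨hP.isPushout.desc _ _ key, ?_, ?_, ?_⟩
  · refine hP.isPushout.hom_ext ?_ ?_
    · rw [hP.isPushout.inl_desc_assoc, ← Category.assoc η, inl_desc,
        Category.assoc (c.twist.map s), inl_desc, ← Category.assoc (c.twist.map s),
        ← c.twist.map_comp, ← h₀]
      rfl
    · rw [hP.isPushout.inr_desc_assoc, ← Category.assoc P.i, inr_desc, inr_desc]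
      rfl
  · refine hP.isPushout.hom_ext ?_ ?_
    · have : c.twist.map (h ≫ pathEval 1 _) ≫ η = η := by
        rw [h₁, c.twist.map_id, Category.id_comp]
      rw [hP.isPushout.inl_desc_assoc, Category.comp_id, ← this]
      rw [h₁, c.twist.map_id, Category.id_comp]
      exact this
    · rw [hP.isPushout.inr_desc_assoc]
      rfl
  · rw [hP.isPushout.inr_desc, ← Category.assoc P.i, inr_desc, inr_desc]

/-- Transfers preserve weak equivalences between relative cell complexes. -/
lemma fixedWeq (hP : IsTransfer c d Y P η) (hQ : IsTransfer c d Z Q θ) {f : Y ⟶ Z} {φ : P ⟶ Q}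
    (h : η ≫ φ.hom = c.twist.map f.hom ≫ θ) (hY : isCellComplex A Y) (hZ : isCellComplex A Z)
    (hf : fixedWeq A f) : SpanTransfer.fixedWeq A' φ := by
  -- This is where the cell structures are used. The maps s and f' are maps under the base but need
  -- not lie over it.
  obtain ⟨s, f', hs, hf', h₁, h₂⟩ := exists_homotopy_sections hY.some hZ.some f.hom f.i_hom hf
  intro J
  have e₁ := hQ.homotopicUnder hP hs f.i_hom h₁
  have e₂ := hP.homotopicUnder hQ hf' hs h₂
  rw [hP.desc_eq hQ h] at e₁
  exact isWeakHomotopyEquiv_fixedMap e₁ e₂ J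

/-- Transfers preserve fibrewise cofibrations. -/
lemma fhep (hP : IsTransfer c d Y P η) (hQ : IsTransfer c d Z Q θ) {f : Y ⟶ Z} {φ : P ⟶ Q}
    (h : η ≫ φ.hom = c.twist.map f.hom ≫ θ) (hf : fhep A f) : SpanTransfer.fhep A' φ := by
  obtain ⟨r, hr, hrp⟩ := hf
  rw [fhep_iff]
  intro W p a b hab ha hb
  have hM := (IsPushout.of_hasPushout (cylEnd Y.obj) f.hom).map c.twist
  -- The twisted product of the mapping cylinder of f is still a pushout, so the homotopy a and the
  -- map b, pulled back along η and θ, define a map out of it. Composing it with the twisted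
  -- retraction of f solves the extension problem on T × Z.
  let e : c.twist.obj (mappingCylinder f.hom) ⟶ W :=
    hM.desc (c.twistCyl Y.obj ≫ cylMap η ≫ a) (θ ≫ b) (by
      rw [← Category.assoc (c.twist.map f.hom), ← h, Category.assoc, ← hab]
      rfl)
  have he₁ : c.twist.map (pushout.inl (cylEnd Y.obj) f.hom) ≫ e =
    c.twistCyl Y.obj ≫ cylMap η ≫ a := hM.inl_desc _ _ _
  have he₂ : c.twist.map (pushout.inr (cylEnd Y.obj) f.hom) ≫ e = θ ≫ b := hM.inr_desc _ _ _
  have hep : e ≫ p = c.twist.map (mappingCylinderProj f) ≫ d := by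
    refine hM.hom_ext ?_ ?_
    · rw [← Category.assoc, he₁, Category.assoc, Category.assoc, ha,
        ← Category.assoc (c.twist.map (pushout.inl _ _)), ← c.twist.map_comp,
        inl_mappingCylinderProj, c.twist.map_comp, Category.assoc, ← hP.comp_p]
      rfl
    · rw [← Category.assoc, he₂, Category.assoc, hb,
        ← Category.assoc (c.twist.map (pushout.inr _ _)), ← c.twist.map_comp,
        inr_mappingCylinderProj, hQ.comp_p]
  have hr₁ : cylMap f.hom ≫ r = pushout.inl _ _ := by
    rw [← inl_mappingCylinderIncl, Category.assoc, hr, Category.comp_id]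
  have hr₂ : cylEnd Z.obj ≫ r = pushout.inr _ _ := by
    rw [← inr_mappingCylinderIncl f.hom, Category.assoc, hr, Category.comp_id]
  let g : c.twist.obj Z.obj ⟶ pathObj W := c.twist.map (cylCurry r) ≫ c.twistPath _ ≫ pathMap e
  have hg₁ : c.twist.map f.hom ≫ g = η ≫ cylCurry a := by
    change c.twist.map (cylCurry (cylMap f.hom ≫ r)) ≫ c.twistPath _ ≫ pathMap e = _
    rw [hr₁]
    have : c.twist.map (cylCurry (pushout.inl (cylEnd Y.obj) f.hom)) ≫ c.twistPath _ ≫ pathMap e =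
        c.twist.map (cylCurry (𝟙 _)) ≫ c.twistPath _ ≫
          pathMap (c.twist.map (pushout.inl (cylEnd Y.obj) f.hom) ≫ e) := rfl
    rw [this, he₁]
    rfl
  have hg : c.twist.map Z.i ≫ g = d ≫ P.i ≫ cylCurry a := by
    rw [← f.i_hom, c.twist.map_comp, Category.assoc, hg₁, ← Category.assoc, hP.isPushout.w,
      Category.assoc]
  have hgend : g ≫ pathEval 1 W = θ ≫ b := by
    rw [← he₂, ← hr₂]
    rfl
  have hgp : g ≫ pathMap p = c.twist.map Z.p ≫ d ≫ pathConst _ := by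
    have e₁ : g ≫ pathMap p = c.twist.map (cylCurry r) ≫ c.twistPath _ ≫ pathMap (e ≫ p) := rfl
    have e₂ : c.twist.map (cylCurry r) ≫ c.twistPath _ ≫
        pathMap (c.twist.map (mappingCylinderProj f) ≫ d) =
        c.twist.map (cylCurry (r ≫ mappingCylinderProj f)) ≫ c.twistPath _ ≫ pathMap d := rfl
    rw [e₁, hep, e₂, hrp]
    rfl
  -- Writing the homotopy as a map into the path space lets it be glued by the universal property of
  -- Q, with no need to know that cylinders preserve this pushout. On the base it is forced to be
  -- the restriction of a.
  let h' : Q.obj ⟶ pathObj W := hQ.isPushout.desc g (P.i ≫ cylCurry a) hg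
  have h'₁ : θ ≫ h' = g := hQ.isPushout.inl_desc _ _ _
  have h'₂ : Q.i ≫ h' = P.i ≫ cylCurry a := hQ.isPushout.inr_desc _ _ _
  refine ⟨cylUncurry h', ?_, ?_, ?_⟩
  · have : φ.hom ≫ h' = cylCurry a := by
      refine hP.isPushout.hom_ext ?_ ?_
      · rw [← Category.assoc, h, Category.assoc, h'₁, hg₁]
      · rw [← Category.assoc, φ.i_hom, h'₂]
    rw [← cylUncurry_comp, this, cylUncurry_curry]
  · change h' ≫ pathEval 1 W = b
    refine hQ.isPushout.hom_ext ?_ ?_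
    · rw [← Category.assoc, h'₁, hgend]
    · rw [← Category.assoc, h'₂, Category.assoc, cylCurry_eval, hab, ← Category.assoc, φ.i_hom]
  · have : h' ≫ pathMap p = Q.p ≫ pathConst _ := by
      refine hQ.isPushout.hom_ext ?_ ?_
      · rw [← Category.assoc, h'₁, hgp, ← Category.assoc θ, hQ.comp_p, Category.assoc]
      · rw [← Category.assoc, h'₂, Category.assoc, cylCurry_pathMap, ha, cylCurry_proj,
          ← Category.assoc, P.i_p, ← Category.assoc, Q.i_p]
    have := congrArg cylUncurry this
    exact this

end IsTransfer

end Twist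

/-! ### Transfers of relative cell complexes -/

section CellTransfer

namespace Cocycle

variable {H K : Type u} [Group H] [Group K] {T : Type} [MulAction K T] (c : Cocycle H K T)

/-- The set `T × H/N`, with the twisted action of `K`. -/
def TwistSet (_ : Cocycle H K T) (N : Subgroup H) : Type u := T × (H ⧸ N)

instance (N : Subgroup H) : MulAction K (c.TwistSet N) where
  smul k x := (k • x.1, c.toFun k x.1 • x.2)
  one_smul x := Prod.ext (one_smul K x.1) (by
    change c.toFun 1 x.1 • x.2 = x.2
    rw [c.map_one, one_smul])
  mul_smul k l x := Prod.ext (mul_smul k l x.1) (by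
    change c.toFun (k * l) x.1 • x.2 = c.toFun k (l • x.1) • c.toFun l x.1 • x.2
    rw [c.map_mul, mul_smul])

/-- The set of orbits of `T × H/N`. -/
abbrev TwistOrbit (N : Subgroup H) : Type u := MulAction.orbitRel.Quotient K (c.TwistSet N)

instance [Finite T] [Finite H] (N : Subgroup H) : Finite (c.TwistOrbit N) :=
  have : Finite (c.TwistSet N) := inferInstanceAs (Finite (T × (H ⧸ N)))
  inferInstanceAs (Finite (Quotient _))

variable {c} in
/-- A representative of an orbit. -/
def orbitRep {N : Subgroup H} (ω : c.TwistOrbit N) : c.TwistSet N := ω.out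

lemma exists_smul_orbitRep {N : Subgroup H} (x : c.TwistSet N) :
    ∃ k : K, k • orbitRep (Quotient.mk _ x : c.TwistOrbit N) = x := by
  have h : MulAction.orbitRel K _ (orbitRep (Quotient.mk _ x : c.TwistOrbit N)) x :=
    Quotient.exact (Quotient.out_eq (Quotient.mk (MulAction.orbitRel K (c.TwistSet N)) x))
  exact MulAction.mem_orbit_symm.1 h

/-- The stabilizer of the representative of an orbit. -/
abbrev orbitStab {N : Subgroup H} (ω : c.TwistOrbit N) : Subgroup K :=
  MulAction.stabilizer K (orbitRep ω)

/-- The points of the twisted product of `H/N × B`. -/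
abbrev twistOrbitPt {N : Subgroup H} {B : TopCat.{u}} (x : c.TwistSet N) (b : B) :
    (c.twist.obj (orbitProd N B)).V :=
  c.twistPt x.1 (Y := orbitProd N B) (⟨x.2, b⟩ : Σ _ : H ⧸ N, B)

lemma ρ_twistOrbitPt {N : Subgroup H} {B : TopCat.{u}} (k : K) (x : c.TwistSet N) (b : B) :
    ((c.twist.obj (orbitProd N B)).ρ k).hom (c.twistOrbitPt x b) = c.twistOrbitPt (k • x) b :=
  rfl

lemma continuous_twistOrbitPt {N : Subgroup H} {B : TopCat.{u}} (x : c.TwistSet N) :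
    Continuous (fun b : B => c.twistOrbitPt x b) :=
  (c.continuous_twistPt x.1 (Y := orbitProd N B)).comp
    (show Continuous (Sigma.mk (β := fun _ : H ⧸ N => B) x.2) from continuous_sigmaMk)

/-- The inclusion of an orbit in a twisted product. -/
def orbitIncl {N : Subgroup H} (B : TopCat.{u}) (ω : c.TwistOrbit N) :
    orbitProd (c.orbitStab ω) B ⟶ c.twist.obj (orbitProd N B) :=
  orbitProdDesc (Y := c.twist.obj (orbitProd N B)) (fun b => c.twistOrbitPt (orbitRep ω) b)
    (c.continuous_twistOrbitPt _) fun b k hk => by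
      rw [ρ_twistOrbitPt]
      exact congrArg (fun x => c.twistOrbitPt x b) hk

lemma orbitIncl_base {N : Subgroup H} {B : TopCat.{u}} (ω : c.TwistOrbit N) (b : B) :
    (c.orbitIncl B ω).hom.hom (orbitBase _ b) = c.twistOrbitPt (orbitRep ω) b :=
  orbitProdDesc_base _ _ _ _

lemma orbitIncl_map {N : Subgroup H} {B B' : TopCat.{u}} (f : B ⟶ B') (ω : c.TwistOrbit N) :
    c.orbitIncl B ω ≫ c.twist.map (orbitProdMap N f) = orbitProdMap _ f ≫ c.orbitIncl B' ω := by
  refine orbitProd_hom_ext fun b => ?_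
  refine (congrArg (c.twist.map (orbitProdMap N f)).hom.hom (c.orbitIncl_base ω b)).trans ?_
  exact (c.orbitIncl_base ω (f b)).symm

/-- The image of the base point of an orbit is fixed by the stabilizer of the representative, so its
translate by k depends only on where k sends that representative. -/
lemma ρ_inj_eq {N : Subgroup H} {B : TopCat.{u}} {W : Action TopCat.{u} K} {ω : c.TwistOrbit N}
    (f : orbitProd (c.orbitStab ω) B ⟶ W) {k l : K} (h : k • orbitRep ω = l • orbitRep ω) (b : B) :
    (W.ρ k).hom (f.hom.hom (orbitBase _ b)) = (W.ρ l).hom (f.hom.hom (orbitBase _ b)) := by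
  refine ρ_eq_of_mk_eq (mem_fixedSet_map f (orbitBase_mem_fixedSet _ b)) (QuotientGroup.eq.2 ?_)
  rw [MulAction.mem_stabilizer_iff, mul_smul, ← h, inv_smul_smul]

/-- The twisted product of `H/N × B` is a coproduct of orbits. -/
def orbitInclIsColimit (N : Subgroup H) (B : TopCat.{u}) :
    IsColimit (Cofan.mk (c.twist.obj (orbitProd N B)) (c.orbitIncl (N := N) B)) := by
  -- A map out of the twisted product is defined at x by translating its value at the representative
  -- of the orbit of x by a chosen s(x). By `key` the choice does not matter, which gives
  -- equivariance in `hd`. Continuity is checked separately on each copy of B, since T × H/N is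
  -- discrete.
  let s (x : c.TwistSet N) : K := (c.exists_smul_orbitRep x).choose
  have hs (x : c.TwistSet N) : s x • orbitRep (Quotient.mk _ x : c.TwistOrbit N) = x :=
    (c.exists_smul_orbitRep x).choose_spec
  have hω (ω : c.TwistOrbit N) : (Quotient.mk _ (orbitRep ω) : c.TwistOrbit N) = ω :=
    Quotient.out_eq ω
  have hk (k : K) (x : c.TwistSet N) :
      (Quotient.mk _ (k • x) : c.TwistOrbit N) = Quotient.mk _ x :=
    Quotient.sound ⟨k, rfl⟩
  have key (t : Cofan fun ω : c.TwistOrbit N => orbitProd (c.orbitStab ω) B) (x : c.TwistSet N)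
      (ω : c.TwistOrbit N) (h : Quotient.mk _ x = ω) (k : K) (hk : k • orbitRep ω = x) (b : B) :
      (t.pt.ρ (s x)).hom ((t.inj (Quotient.mk _ x)).hom.hom (orbitBase _ b)) =
        (t.pt.ρ k).hom ((t.inj ω).hom.hom (orbitBase _ b)) := by
    subst h
    exact c.ρ_inj_eq _ ((hs x).trans hk.symm) b
  have hc (t : Cofan fun ω : c.TwistOrbit N => orbitProd (c.orbitStab ω) B) (x : c.TwistSet N) :
      Continuous fun b : B =>
        (t.pt.ρ (s x)).hom ((t.inj (Quotient.mk _ x)).hom.hom (orbitBase _ b)) :=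
    (t.pt.ρ (s x)).hom.continuous.comp
      ((t.inj (Quotient.mk _ x)).hom.hom.continuous.comp (continuous_orbitBase _))
  have hd (t : Cofan fun ω : c.TwistOrbit N => orbitProd (c.orbitStab ω) B) (k : K)
      (x : c.TwistSet N) (b : B) :
      (t.pt.ρ (s (k • x))).hom ((t.inj (Quotient.mk _ (k • x))).hom.hom (orbitBase _ b)) =
        (t.pt.ρ k).hom
          ((t.pt.ρ (s x)).hom ((t.inj (Quotient.mk _ x)).hom.hom (orbitBase _ b))) := by
    rw [← ρ_mul_apply]
    refine key t (k • x) _ (hk k x) (k * s x) ?_ b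
    rw [mul_smul, hs]
  let D (t : Cofan fun ω : c.TwistOrbit N => orbitProd (c.orbitStab ω) B) :
      c.twist.obj (orbitProd N B) ⟶ t.pt :=
    c.twistDesc (Y := orbitProd N B)
      (fun i (z : Σ _ : H ⧸ N, B) => (fun (x : c.TwistSet N) (b : B) => (t.pt.ρ (s x)).hom
        ((t.inj (Quotient.mk _ x)).hom.hom (orbitBase _ b))) (i, z.1) z.2)
      (fun i => continuous_sigma fun q => hc t (i, q)) fun k i z => hd t k (i, z.1) z.2
  refine Cofan.IsColimit.mk _ D ?_ ?_
  · intro t ω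
    refine orbitProd_hom_ext fun b => ?_
    refine (congrArg (D t).hom.hom
      (c.orbitIncl_base ω b)).trans ?_
    refine (key t (orbitRep ω) ω (hω ω) 1 (one_smul _ _) b).trans ?_
    exact ρ_one_apply _ _
  · intro t m hm
    refine c.twist_hom_ext ?_
    rintro i ⟨q, b⟩
    let x : c.TwistSet N := (i, q)
    have h₁ : ((c.twist.obj (orbitProd N B)).ρ (s x)).hom
        (c.twistOrbitPt (orbitRep (Quotient.mk _ x)) b) = c.twistOrbitPt x b := by
      rw [ρ_twistOrbitPt, hs]
    change m.hom.hom (c.twistOrbitPt x b) = (t.pt.ρ (s x)).hom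
      ((t.inj (Quotient.mk _ x)).hom.hom (orbitBase _ b))
    rw [← h₁, ← hm, ← c.orbitIncl_base]
    exact hom_ρ_apply m _ _

end Cocycle

variable {H K : Type u} [Group H] [Group K] {T : Type} [MulAction K T] (c : Cocycle H K T)

/-- The attachment of cells induced on twisted products. -/
def attachCellsTwist {Y₁ Y₂ : Action TopCat.{u} H} {f : Y₁ ⟶ Y₂}
    (a : AttachCells.{u} (basicCell H) f) {P₁ P₂ : Action TopCat.{u} K} {φ : P₁ ⟶ P₂}
    {η₁ : c.twist.obj Y₁ ⟶ P₁} {η₂ : c.twist.obj Y₂ ⟶ P₂}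
    (sq : IsPushout η₁ (c.twist.map f) φ η₂) : AttachCells.{u} (basicCell K) φ where
  -- A cell of type H/N contributes one cell of the same dimension for each K-orbit of T × H/N, of
  -- type K modulo the stabilizer of the chosen representative.
  ι := Σ k : a.ι, c.TwistOrbit (a.π k).1
  π := fun x => (c.orbitStab x.2, (a.π x.1).2)
  cofan₁ := Cofan.mk (c.twist.obj a.cofan₁.pt) fun x =>
    c.orbitIncl _ x.2 ≫ c.twist.map (a.cofan₁.inj x.1)
  cofan₂ := Cofan.mk (c.twist.obj a.cofan₂.pt) fun x =>
    c.orbitIncl _ x.2 ≫ c.twist.map (a.cofan₂.inj x.1)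
  isColimit₁ := Cofan.isColimitTrans
    (Cofan.mk (c.twist.obj a.cofan₁.pt) fun k => c.twist.map (a.cofan₁.inj k))
    (isColimitCofanMkObjOfIsColimit c.twist _ _ a.isColimit₁) _
    fun k => c.orbitInclIsColimit (a.π k).1 _
  isColimit₂ := Cofan.isColimitTrans
    (Cofan.mk (c.twist.obj a.cofan₂.pt) fun k => c.twist.map (a.cofan₂.inj k))
    (isColimitCofanMkObjOfIsColimit c.twist _ _ a.isColimit₂) _
    fun k => c.orbitInclIsColimit (a.π k).1 _
  m := c.twist.map a.m
  hm := fun x => by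
    change (c.orbitIncl _ x.2 ≫ c.twist.map (a.cofan₁.inj x.1)) ≫ c.twist.map a.m = 
      basicCell K (c.orbitStab x.2, (a.π x.1).2) ≫
        c.orbitIncl _ x.2 ≫ c.twist.map (a.cofan₂.inj x.1)
    rw [Category.assoc, ← c.twist.map_comp, a.hm, c.twist.map_comp, ← Category.assoc,
      ← Category.assoc]
    exact congrArg (· ≫ _) (c.orbitIncl_map _ x.2)
  g₁ := c.twist.map a.g₁ ≫ η₁
  g₂ := c.twist.map a.g₂ ≫ η₂
  isPushout := by
    have := (a.isPushout.map c.twist).flip.paste_vert sq.flip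
    exact this.flip

/-! ### The filtration of a transferred relative cell complex -/

section Filtration

variable {c} {A Y : Action TopCat.{u} H} {A' P : Action TopCat.{u} K} {i : A ⟶ Y}
  {d : c.twist.obj A ⟶ A'} {η : c.twist.obj Y ⟶ P} {j : A' ⟶ P}

/-- The map of the base to a stage of a relative cell complex. -/
def stageMap (b : RelCellStructure i) (m : ℕ) : A ⟶ b.F.obj m :=
  b.isoBot.inv ≫ b.F.map (homOfLE bot_le)

lemma stageMap_comp (b : RelCellStructure i) {m n : ℕ} (f : m ⟶ n) :
    stageMap b m ≫ b.F.map f = stageMap b n := by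
  rw [stageMap, Category.assoc, ← b.F.map_comp]
  rfl

lemma stageMap_incl (b : RelCellStructure i) (m : ℕ) : stageMap b m ≫ b.incl.app m = i := by
  have h := b.incl.naturality (homOfLE (bot_le : ⊥ ≤ m))
  refine Eq.trans ?_ b.fac
  rw [stageMap, Category.assoc, h]
  exact congrArg (b.isoBot.inv ≫ ·) (Category.comp_id _)

variable (c d) in
/-- The filtration of the transfer of a relative cell complex. -/
def transferStages (b : RelCellStructure i) : ℕ ⥤ Action TopCat.{u} K where
  obj m := pushout (c.twist.map (stageMap b m)) d
  map {m n} f := pushout.desc (c.twist.map (b.F.map f) ≫ pushout.inl _ _) (pushout.inr _ _) (by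
    rw [← Category.assoc, ← c.twist.map_comp, stageMap_comp, pushout.condition])
  map_id m := by
    refine pushout.hom_ext ?_ ?_
    · rw [pushout.inl_desc, b.F.map_id, c.twist.map_id, Category.id_comp, Category.comp_id]
    · rw [pushout.inr_desc, Category.comp_id]
  map_comp f g := by
    refine pushout.hom_ext ?_ ?_
    · rw [pushout.inl_desc, pushout.inl_desc_assoc, b.F.map_comp, c.twist.map_comp, Category.assoc,
        Category.assoc, pushout.inl_desc]
    · rw [pushout.inr_desc, pushout.inr_desc_assoc, pushout.inr_desc]

variable (c d) in
/-- The map of a stage to its transfer. -/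
def stageInl (b : RelCellStructure i) (m : ℕ) :
    c.twist.obj (b.F.obj m) ⟶ (transferStages c d b).obj m :=
  pushout.inl (c.twist.map (stageMap b m)) d

variable (c d) in
/-- The map of the base to a transferred stage. -/
def stageInr (b : RelCellStructure i) (m : ℕ) : A' ⟶ (transferStages c d b).obj m :=
  pushout.inr (c.twist.map (stageMap b m)) d

lemma isPushout_stage (b : RelCellStructure i) (m : ℕ) :
    IsPushout (c.twist.map (stageMap b m)) d (stageInl c d b m) (stageInr c d b m) :=
  IsPushout.of_hasPushout _ _

lemma stageInl_map (b : RelCellStructure i) {m n : ℕ} (f : m ⟶ n) :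
    stageInl c d b m ≫ (transferStages c d b).map f =
      c.twist.map (b.F.map f) ≫ stageInl c d b n :=
  pushout.inl_desc _ _ _

lemma stageInr_map (b : RelCellStructure i) {m n : ℕ} (f : m ⟶ n) :
    stageInr c d b m ≫ (transferStages c d b).map f = stageInr c d b n :=
  pushout.inr_desc _ _ _

/-- Every transferred stage is a pushout along the same base change d, so cancelling the square of
stage m from that of stage n leaves a pushout. This is the square that `attachCellsTwist` needs. -/
lemma isPushout_transferStages (b : RelCellStructure i) {m n : ℕ} (f : m ⟶ n) :
    IsPushout (stageInl c d b m) (c.twist.map (b.F.map f)) ((transferStages c d b).map f)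
      (stageInl c d b n) := by
  have h := isPushout_stage (c := c) (d := d) b n
  rw [← stageMap_comp b f, c.twist.map_comp, ← stageInr_map b f] at h
  exact (IsPushout.of_left h (stageInl_map b f).symm (isPushout_stage b m)).flip

/-- The transfer of a relative cell complex is a relative cell complex. -/
def transferCells (b : RelCellStructure i) (sq : IsPushout (c.twist.map i) d η j) :
    RelCellStructure j where
  F := transferStages c d b
  isoBot := by
    have : IsIso (stageMap b ⊥) := by
      have : b.F.map (homOfLE (bot_le : (⊥ : ℕ) ≤ ⊥)) = 𝟙 _ := b.F.map_id _
      rw [stageMap, this]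
      infer_instance
    exact (asIso (pushout.inr (c.twist.map (stageMap b ⊥)) d)).symm
  incl :=
    { app := fun m => pushout.desc (c.twist.map (b.incl.app m) ≫ η) j (by
        rw [← Category.assoc, ← c.twist.map_comp, stageMap_incl, sq.w])
      naturality := fun m n f => by
        refine pushout.hom_ext ?_ ?_
        · have h : b.F.map f ≫ b.incl.app n = b.incl.app m := by
            rw [b.incl.naturality]; exact Category.comp_id _
          change _ ≫ pushout.desc _ _ _ ≫ pushout.desc _ _ _ = _ ≫ _ ≫ 𝟙 _
          rw [pushout.inl_desc_assoc, Category.assoc, pushout.inl_desc, ← Category.assoc,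
            ← c.twist.map_comp, h, Category.comp_id, pushout.inl_desc]
        · change _ ≫ pushout.desc _ _ _ ≫ pushout.desc _ _ _ = _ ≫ _ ≫ 𝟙 _
          rw [pushout.inr_desc_assoc, pushout.inr_desc, Category.comp_id, pushout.inr_desc] }
  isColimit := by
    -- The twisted product preserves the sequential colimit of the stages. A cocone on the
    -- transferred stages therefore gives a map out of the twisted product of Y and, independently
    -- of the stage, a map out of A'; together these form a map out of the pushout.
    let hc := isColimitOfPreserves c.twist b.isColimit
    have hs (s : Cocone (transferStages c d b)) {m n : ℕ} (f : m ⟶ n) :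
        (transferStages c d b).map f ≫ s.ι.app n = s.ι.app m := s.w f
    let l (s : Cocone (transferStages c d b)) : Cocone (b.F ⋙ c.twist) :=
      { pt := s.pt
        ι :=
          { app := fun m => stageInl c d b m ≫ s.ι.app m
            naturality := fun m n f => by
              change c.twist.map (b.F.map f) ≫ stageInl c d b n ≫ s.ι.app n = (stageInl c d b m ≫ s.ι.app m) ≫ 𝟙 _
              rw [← Category.assoc, ← stageInl_map, Category.assoc, hs, Category.comp_id] } }
    have hl (s : Cocone (transferStages c d b)) (m : ℕ) :
        c.twist.map (b.incl.app m) ≫ hc.desc (l s) = stageInl c d b m ≫ s.ι.app m := hc.fac (l s) m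
    have hw (s : Cocone (transferStages c d b)) :
        c.twist.map i ≫ hc.desc (l s) = d ≫ stageInr c d b 0 ≫ s.ι.app 0 := by
      have h := congrArg (fun f => c.twist.map f ≫ hc.desc (l s)) (stageMap_incl b 0)
      refine h.symm.trans ?_
      change c.twist.map (stageMap b 0 ≫ b.incl.app 0) ≫ _ = _
      rw [c.twist.map_comp, Category.assoc, hl, ← Category.assoc,
        (isPushout_stage b 0).w, Category.assoc]
    have hinr' (s : Cocone (transferStages c d b)) (m : ℕ) :
        stageInr c d b m ≫ s.ι.app m = stageInr c d b 0 ≫ s.ι.app 0 := by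
      rw [← stageInr_map b (homOfLE (Nat.zero_le m)), Category.assoc, hs]
    refine ⟨fun s => sq.desc (hc.desc (l s)) (stageInr c d b 0 ≫ s.ι.app 0) (hw s), fun s m => ?_,
      fun s φ hφ => ?_⟩
    · refine pushout.hom_ext ?_ ?_
      · change _ ≫ pushout.desc _ _ _ ≫ _ = _
        rw [pushout.inl_desc_assoc, Category.assoc, sq.inl_desc, hl]
        rfl
      · change _ ≫ pushout.desc _ _ _ ≫ _ = _
        rw [pushout.inr_desc_assoc, sq.inr_desc, ← hinr' s m]
        rfl
    · have h₁ (m : ℕ) : pushout.desc (c.twist.map (b.incl.app m) ≫ η) j (by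
        rw [← Category.assoc, ← c.twist.map_comp, stageMap_incl, sq.w]) ≫ φ = s.ι.app m := hφ m
      refine sq.hom_ext ?_ ?_
      · rw [sq.inl_desc]
        refine hc.hom_ext fun m => ?_
        refine Eq.trans ?_ (hl s m).symm
        rw [← h₁ m]
        change c.twist.map (b.incl.app m) ≫ _ = pushout.inl _ _ ≫ _
        rw [pushout.inl_desc_assoc, Category.assoc]
      · rw [sq.inr_desc, ← h₁ 0]
        change _ = pushout.inr _ _ ≫ _
        rw [pushout.inr_desc_assoc]
  fac := by
    change pushout.inr _ _ ≫ pushout.desc _ _ _ = j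
    rw [pushout.inr_desc]
  attachCells m hm := attachCellsTwist c (b.attachCells m hm) (isPushout_transferStages b (homOfLE _))

/-- The cell of a relative cell complex from which a cell of its transfer arises. -/
def transferCellsIndex (b : RelCellStructure i) (sq : IsPushout (c.twist.map i) d η j)
    (γ : (transferCells b sq).Cells) :
    Σ γ : b.Cells, c.TwistOrbit (b.attachCells γ.j γ.hj |>.π γ.k).1 :=
  ⟨⟨γ.j, γ.hj, (show Σ k : (b.attachCells γ.j γ.hj).ι,
    c.TwistOrbit ((b.attachCells γ.j γ.hj).π k).1 from γ.k).1⟩,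
    (show Σ k : (b.attachCells γ.j γ.hj).ι,
      c.TwistOrbit ((b.attachCells γ.j γ.hj).π k).1 from γ.k).2⟩

lemma transferCellsIndex_injective (b : RelCellStructure i)
    (sq : IsPushout (c.twist.map i) d η j) : Function.Injective (transferCellsIndex b sq) := by
  rintro ⟨m, hm, k, ω⟩ ⟨m', hm', k', ω'⟩ h
  have h' : (⟨⟨m, hm, k⟩, ω⟩ : Σ γ : b.Cells,
    c.TwistOrbit ((b.attachCells γ.j γ.hj).π γ.k).1) = ⟨⟨m', hm', k'⟩, ω'⟩ := h
  cases h'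
  rfl

/-- Each cell gives rise to only finitely many orbits, as T × H/N is finite. -/
lemma finite_transferCells [Finite T] [Finite H] (b : RelCellStructure i) [Finite b.Cells]
    (sq : IsPushout (c.twist.map i) d η j) : Finite (transferCells b sq).Cells :=
  Finite.of_injective _ (transferCellsIndex_injective b sq)

end Filtration

namespace IsTransfer

variable {c} {A : Action TopCat.{u} H} {A' : Action TopCat.{u} K} {d : c.twist.obj A ⟶ A'}
  {Y : Retractive A} {P : Retractive A'} {η : c.twist.obj Y.obj ⟶ P.obj}

lemma isCellComplex (hP : IsTransfer c d Y P η) (hY : isCellComplex A Y) :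
    SpanTransfer.isCellComplex A' P :=
  ⟨transferCells hY.some hP.isPushout⟩

lemma isFiniteCellComplex [Finite T] [Finite H] (hP : IsTransfer c d Y P η)
    (hY : isFiniteCellComplex A Y) : SpanTransfer.isFiniteCellComplex A' P := by
  obtain ⟨b, hb⟩ := hY
  exact ⟨transferCells b hP.isPushout, finite_transferCells b hP.isPushout⟩

end IsTransfer

end CellTransfer

/-! ### The maps of spaces underlying an equivariant functor -/

section ShiftHom

open StrictAction ProdEG

variable {G : Type u} [Group G] {D : Type*} [Category D] {X : Action D G}
  {S : Type v} [MulAction G S]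

namespace EqFunctor

/-- The morphism `k F(s, g) = F(k s, k g) ⟶ F(k s, g')`. -/
def shiftMap (F : EqFunctor G S (Retractive X.V)) (k : G) {x y : ProdEG S G}
    (h : k • x.pt = y.pt) : (act k).obj (F.functor.obj x) ⟶ F.functor.obj y :=
  eqToHom (F.equivariant_obj k x).symm ≫ F.functor.map (homMk (x := (shift S k).obj x) h)

/-- The map of spaces underlying the morphism `k F(s, g) = F(k s, k g) ⟶ F(k s, g')`. -/
def shiftHom (F : EqFunctor G S (Retractive X.V)) (k : G) {x y : ProdEG S G}
    (h : k • x.pt = y.pt) : (F.functor.obj x).obj ⟶ (F.functor.obj y).obj :=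
  (F.shiftMap k h).hom

variable (F F' : EqFunctor G S (Retractive X.V)) {x y z : ProdEG S G}

/-- The form used in computations: the source of the morphism may be any expression for the shifted
point, so that the transport between equal objects is isolated in a single `eqToHom`. -/
lemma shiftHom_eq (k : G) (h : k • x.pt = y.pt) {x' : ProdEG S G}
    (hx : F.functor.obj x' = (act k).obj (F.functor.obj x)) (hx' : x' = (shift S k).obj x)
    (f : x' ⟶ y) : F.shiftHom k h =
      eqToHom (congrArg Retractive.obj hx.symm) ≫ (F.functor.map f).hom := by
  subst hx'
  rw [shiftHom, shiftMap, Retractive.comp_hom, Retractive.eqToHom_hom]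
  rfl

lemma shiftHom_shift (k : G) : F.shiftHom k (x := x) (y := (shift S k).obj x) rfl =
    eqToHom (congrArg Retractive.obj (F.equivariant_obj k x).symm) := by
  rw [F.shiftHom_eq k rfl (F.equivariant_obj k x) rfl (𝟙 _), F.functor.map_id]
  exact Category.comp_id _

lemma shiftHom_comp_map (k : G) (h : k • x.pt = y.pt) (f : y ⟶ z) :
    F.shiftHom k h ≫ (F.functor.map f).hom = F.shiftHom k (h.trans (hom_eq f)) := by
  rw [shiftHom, shiftHom, ← Retractive.comp_hom, shiftMap, shiftMap, Category.assoc,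
    ← F.functor.map_comp]
  rfl

lemma map_comp_shiftHom (k : G) (f : x ⟶ y) (h : k • y.pt = z.pt) :
    (F.functor.map f).hom ≫ F.shiftHom k h =
      F.shiftHom k ((congrArg (k • ·) (hom_eq f)).trans h) := by
  have e := F.equivariant_map k f
  have e' : (act k).map (F.functor.map f) ≫ F.shiftMap k h =
      F.shiftMap k ((congrArg (k • ·) (hom_eq f)).trans h) := by
    have : F.functor.map (homMk (x := (shift S k).obj x) (y := z)
        ((congrArg (k • ·) (hom_eq f)).trans h)) =
        F.functor.map ((shift S k).map f) ≫
          F.functor.map (homMk (x := (shift S k).obj y) h) := by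
      rw [← F.functor.map_comp]
      rfl
    rw [shiftMap, shiftMap, this, e]
    simp only [Category.assoc, eqToHom_trans_assoc, eqToHom_refl, Category.id_comp]
  exact congrArg Retractive.Hom.hom e'

lemma shiftHom_shift_shift (k l : G) :
    F.shiftHom k (x := x) (y := (shift S k).obj x) rfl ≫
      F.shiftHom l (y := (shift S (l * k)).obj x) (mul_smul l k x.pt).symm =
      F.shiftHom (l * k) rfl := by
  have e : (shift S (l * k)).obj x = (shift S l).obj ((shift S k).obj x) :=
    ProdEG.ext (mul_smul l k x.pt) (mul_assoc l k x.elt)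
  have e' : F.functor.obj ((shift S (l * k)).obj x) =
      (act l).obj (F.functor.obj ((shift S k).obj x)) := by
    rw [e, F.equivariant_obj]
  rw [F.shiftHom_eq l _ e' e (𝟙 _), shiftHom_shift, shiftHom_shift, F.functor.map_id]
  refine (congrArg _ (Category.comp_id _)).trans (eqToHom_trans _ _)

/-- Acting by k does not change the total object, so strict equivariance and functoriality together
give honest translation maps between the values of F, and these compose like group elements. They
carry all the structure of F with no `eqToHom` left. -/
lemma shiftHom_comp (k l : G) (h : k • x.pt = y.pt) (h' : l • y.pt = z.pt) :
    F.shiftHom k h ≫ F.shiftHom l h' =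
      F.shiftHom (l * k) ((mul_smul l k x.pt).trans ((congrArg (l • ·) h).trans h')) := by
  have h₁ := F.shiftHom_comp_map k (x := x) (y := (shift S k).obj x) rfl (homMk h)
  have h₂ := F.shiftHom_comp_map l (x := (shift S k).obj x) (y := (shift S (l * k)).obj x)
    (mul_smul l k x.pt).symm (homMk (y := z)
      ((mul_smul l k x.pt).trans ((congrArg (l • ·) h).trans h')))
  rw [← h₁, Category.assoc, map_comp_shiftHom, ← h₂, ← Category.assoc, shiftHom_shift_shift,
    shiftHom_comp_map]

lemma shiftHom_one (f : x ⟶ y) :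
    F.shiftHom 1 ((one_smul G x.pt).trans (hom_eq f)) = (F.functor.map f).hom := by
  have e : x = (shift S (1 : G)).obj x := ProdEG.ext (one_smul G _).symm (one_mul _).symm
  rw [F.shiftHom_eq 1 _ (by rw [act_one]; rfl) e f]
  exact Category.id_comp _

lemma shiftHom_of_eq_one {k : G} (hk : k = 1) (h : k • x.pt = x.pt) : F.shiftHom k h = 𝟙 _ := by
  subst hk
  rw [← Retractive.id_hom, ← F.functor.map_id]
  exact F.shiftHom_one (𝟙 x)

lemma shiftHom_congr {k l : G} (hk : k = l) (h : k • x.pt = y.pt) :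
    F.shiftHom k h = F.shiftHom l (hk ▸ h) := by
  subst hk
  rfl

lemma i_shiftHom (k : G) (h : k • x.pt = y.pt) :
    (F.functor.obj x).i ≫ F.shiftHom k h = X.ρ k ≫ (F.functor.obj y).i := by
  have e : (X.ρ k⁻¹ ≫ (F.functor.obj x).i) ≫ F.shiftHom k h = (F.functor.obj y).i :=
    (F.shiftMap k h).i_hom
  rw [← e, ← Category.assoc, ← Category.assoc, ← Retractive.ρ_mul_hom, inv_mul_cancel,
    Action.ρ_one, Category.id_comp]

lemma shiftHom_p (k : G) (h : k • x.pt = y.pt) :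
    F.shiftHom k h ≫ (F.functor.obj y).p = (F.functor.obj x).p ≫ X.ρ k :=
  (F.shiftMap k h).hom_p

variable {F F'}

lemma shiftHom_natTrans (α : F ⟶ F') (k : G) (h : k • x.pt = y.pt) :
    F.shiftHom k h ≫ (α.natTrans.app y).hom = (α.natTrans.app x).hom ≫ F'.shiftHom k h := by
  have e : F.shiftMap k h ≫ α.natTrans.app y =
      (act k).map (α.natTrans.app x) ≫ F'.shiftMap k h := by
    rw [shiftMap, shiftMap, Category.assoc, α.natTrans.naturality, α.equivariant]
    simp only [Category.assoc, eqToHom_trans_assoc, eqToHom_refl, Category.id_comp]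
  exact congrArg Retractive.Hom.hom e

/-- A morphism of equivariant functors, given by compatible maps of retractive spaces. -/
def ofShiftHom (a : ∀ x, F.functor.obj x ⟶ F'.functor.obj x)
    (ha : ∀ (k : G) (x y : ProdEG S G) (h : k • x.pt = y.pt),
      F.shiftHom k h ≫ (a y).hom = (a x).hom ≫ F'.shiftHom k h) : F ⟶ F' :=
  { natTrans :=
      { app := a
        naturality := fun x y f => by
          refine Retractive.hom_ext _ _ ?_
          rw [Retractive.comp_hom, Retractive.comp_hom, ← shiftHom_one, ← shiftHom_one, ha] }
    equivariant := fun k x => by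
      refine Retractive.hom_ext _ _ ?_
      have := ha k x ((shift S k).obj x) rfl
      rw [shiftHom_shift, shiftHom_shift] at this
      simp only [Retractive.comp_hom, Retractive.eqToHom_hom, Retractive.act_map_hom]
      rw [← this, eqToHom_trans_assoc, eqToHom_refl, Category.id_comp] }

variable {T : Type w} [MulAction G T]

lemma pullback_shiftHom (f : S →[G] T) (F : EqFunctor G T (Retractive X.V)) (k : G)
    (h : k • x.pt = y.pt) : ((pullback _ f).obj F).shiftHom k h =
      F.shiftHom k (x := (mapPt f).obj x) (y := (mapPt f).obj y)
        ((map_smul f k x.pt).symm.trans (congrArg f h)) := by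
  refine (((pullback _ f).obj F).shiftHom_eq k h (((pullback _ f).obj F).equivariant_obj k x)
    rfl (homMk h)).trans ?_
  exact (F.shiftHom_eq k (x := (mapPt f).obj x) (y := (mapPt f).obj y) _
    (x' := (mapPt f).obj ((shift S k).obj x)) (((pullback _ f).obj F).equivariant_obj k x)
    (ProdEG.ext (map_smul f k x.pt) rfl) (homMk (congrArg f h))).symm

variable [Finite S] [HasFiniteCoproducts (Retractive X.V)]

/-- The inclusion of a summand in the pushforward. -/
def pushIncl (f : S →[G] T) (F : EqFunctor G S (Retractive X.V)) (x : ProdEG T G) (j : S)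
    (hj : f j = x.pt) :
    F.functor.obj ⟨j, x.elt⟩ ⟶ ((pushforward _ f).obj F).functor.obj x :=
  pushInj F x.pt x.elt j hj

lemma pushIncl_map (f : S →[G] T) (F : EqFunctor G S (Retractive X.V)) {x y : ProdEG T G}
    (e : x ⟶ y) (j : S) (hj : f j = x.pt) :
    pushIncl f F x j hj ≫ ((pushforward _ f).obj F).functor.map e =
      F.functor.map (homElt j x.elt y.elt) ≫ pushIncl f F y j (hj.trans (hom_eq e)) :=
  pushInj_desc F _ _ _ _ _

lemma pushIncl_natTrans (f : S →[G] T) {F F' : EqFunctor G S (Retractive X.V)} (α : F ⟶ F')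
    (x : ProdEG T G) (j : S) (hj : f j = x.pt) :
    pushIncl f F x j hj ≫ ((pushforward _ f).map α).natTrans.app x =
      α.natTrans.app ⟨j, x.elt⟩ ≫ pushIncl f F' x j hj :=
  pushInj_pushMap α _ _ _ _

lemma exists_pushIncl_desc (f : S →[G] T) (F : EqFunctor G S (Retractive X.V)) (x : ProdEG T G)
    {Z : Retractive X.V} (φ : ∀ j : S, f j = x.pt → (F.functor.obj ⟨j, x.elt⟩ ⟶ Z)) :
    ∃ g : ((pushforward _ f).obj F).functor.obj x ⟶ Z,
      ∀ j hj, pushIncl f F x j hj ≫ g = φ j hj :=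
  ⟨pushDesc f F x.pt x.elt φ, fun _ _ => pushInj_desc F _ _ _ _ _⟩

lemma pushIncl_hom_ext (f : S →[G] T) (F : EqFunctor G S (Retractive X.V)) (x : ProdEG T G)
    {Z : Retractive X.V} {a b : ((pushforward _ f).obj F).functor.obj x ⟶ Z}
    (h : ∀ j hj, pushIncl f F x j hj ≫ a = pushIncl f F x j hj ≫ b) : a = b :=
  push_hom_ext F _ _ h

/-- Translation by k on a pushforward permutes the summands as k permutes the fibres. It suffices to
treat the translation to the shifted point itself, where `pushInj_shift` compares the
identifications; the general case follows by composing with the morphisms in the EG direction. -/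
lemma pushIncl_shiftHom (f : S →[G] T) (F : EqFunctor G S (Retractive X.V)) (k : G)
    {x y : ProdEG T G} (h : k • x.pt = y.pt) (j j' : S) (hj : f j = x.pt) (hj' : k • j = j')
    (hy : f j' = y.pt) :
    (pushIncl f F x j hj).hom ≫ ((pushforward _ f).obj F).shiftHom k h =
      F.shiftHom k (x := ⟨j, x.elt⟩) (y := ⟨j', y.elt⟩) hj' ≫ (pushIncl f F y j' hy).hom := by
  subst hj'
  have hs : f (k • j) = k • x.pt := by rw [map_smul, hj]
  have h₁ := ((pushforward _ f).obj F).shiftHom_comp_map k (x := x) (y := (shift T k).obj x) rfl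
    (homMk h)
  have h₂ := F.shiftHom_comp_map k (x := ⟨j, x.elt⟩) (y := ⟨k • j, k * x.elt⟩) (z := ⟨k • j, y.elt⟩)
    rfl (homMk rfl)
  have h₃ := congrArg Retractive.Hom.hom
    (pushIncl_map f F (homMk h : (shift T k).obj x ⟶ y) (k • j) hs)
  have h₄ : (pushIncl f F x j hj).hom ≫ ((pushforward _ f).obj F).shiftHom k (x := x)
      (y := (shift T k).obj x) rfl = F.shiftHom k (x := ⟨j, x.elt⟩) (y := ⟨k • j, k * x.elt⟩) rfl ≫
        (pushIncl f F ((shift T k).obj x) (k • j) hs).hom := by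
    have e₁ := F.shiftHom_shift (x := ⟨j, x.elt⟩) k
    have e₂ := ((pushforward _ f).obj F).shiftHom_shift (x := x) k
    have e₃ : pushIncl f F ((shift T k).obj x) (k • j) hs = eqToHom (smul_obj F k x.elt j) ≫
      (act k).map (pushIncl f F x j hj) ≫
        eqToHom (((pushforward _ f).obj F).equivariant_obj k x).symm :=
      pushInj_shift F k x.pt x.elt j hj hs
    have e₄ := congrArg Retractive.Hom.hom e₃
    simp only [Retractive.comp_hom, Retractive.eqToHom_hom, Retractive.act_map_hom] at e₄
    rw [e₁, e₂, e₄, eqToHom_trans_assoc, eqToHom_refl, Category.id_comp]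
  rw [← h₁, ← h₂, ← Category.assoc, h₄, Category.assoc, Category.assoc]
  exact congrArg (_ ≫ ·) h₃

end EqFunctor

end ShiftHom

/-! ### Homotopy fixed points are equivariant retractive objects -/

section EvalEquivalence

open StrictAction ProdEG EqFunctor

namespace Retractive

variable {D : Type*} [Category D] {A : D}

lemma isIso_of_hom {Y Z : Retractive A} (f : Y ⟶ Z) [IsIso f.hom] : IsIso f :=
  ⟨⟨inv f.hom, by rw [← f.i_hom, Category.assoc, IsIso.hom_inv_id, Category.comp_id],
    by rw [← f.hom_p, IsIso.inv_hom_id_assoc]⟩, hom_ext _ _ (IsIso.hom_inv_id _),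
    hom_ext _ _ (IsIso.inv_hom_id _)⟩

end Retractive

variable {G : Type u} [Group G] {D : Type*} [Category D] {X : Action D G} {H : Subgroup G}

lemma smul_base (h : H) : (h : G) • ((1 : G) : G ⧸ H) = ((1 : G) : G ⧸ H) :=
  congrArg ProdEG.pt (shift_basePt h 1)

lemma mem_of_smul_base {g : G} (h : g • ((1 : G) : G ⧸ H) = ((1 : G) : G ⧸ H)) : g ∈ H := by
  have h' : ((g * 1 : G) : G ⧸ H) = ((1 : G) : G ⧸ H) := h
  rw [mul_one, eq_comm, QuotientGroup.eq] at h'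
  simpa using h'

lemma out_smul_base (s : G ⧸ H) : s.out • ((1 : G) : G ⧸ H) = s := by
  have : ((s.out * 1 : G) : G ⧸ H) = s := by rw [mul_one]; exact Quotient.out_eq s
  exact this

lemma inv_out_smul (s : G ⧸ H) : s.out⁻¹ • s = ((1 : G) : G ⧸ H) := by
  rw [inv_smul_eq_iff, out_smul_base]

lemma evalAct_hom (F : EqFunctor G (G ⧸ H) (Retractive X.V)) (h : H) :
    (evalAct F h).hom = F.shiftHom (h : G) (x := basePt H 1) (y := basePt H 1) (smul_base h) := by
  rw [F.shiftHom_eq (h : G) (smul_base h) (x' := basePt H (h * 1)) (basePt_obj F h 1).symm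
    (shift_basePt h 1).symm (baseHom H (h * 1) 1), evalAct, Retractive.comp_hom,
    Retractive.eqToHom_hom]

lemma eval_ρ (F : EqFunctor G (G ⧸ H) (Retractive X.V)) (h : H) :
    ((eval X H).obj F).obj.ρ h =
      F.shiftHom (h : G) (x := basePt H 1) (y := basePt H 1) (smul_base h) :=
  evalAct_hom F h

/-! ### Morphisms are determined by, and extend from, their value at the base point -/

section Extend

variable {F F' : EqFunctor G (G ⧸ H) (Retractive X.V)}
  (ψ : F.functor.obj (basePt H 1) ⟶ F'.functor.obj (basePt H 1))

/-- The components of the morphism of equivariant functors with a given value at the base point. -/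
def extendApp (x : ProdEG (G ⧸ H) G) : F.functor.obj x ⟶ F'.functor.obj x where
  hom := F.shiftHom x.pt.out⁻¹ (y := basePt H 1) (inv_out_smul x.pt) ≫ ψ.hom ≫
    F'.shiftHom x.pt.out (x := basePt H 1) (out_smul_base x.pt)
  i_hom := by
    rw [← Category.assoc, i_shiftHom, Category.assoc, ← Category.assoc _ ψ.hom, ψ.i_hom,
      i_shiftHom, ← Category.assoc, ← Retractive.ρ_mul_hom, mul_inv_cancel, Action.ρ_one,
      Category.id_comp]
  hom_p := by
    rw [Category.assoc, Category.assoc, shiftHom_p, ← Category.assoc ψ.hom, ψ.hom_p,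
      ← Category.assoc, shiftHom_p, Category.assoc, ← Retractive.ρ_mul_hom, mul_inv_cancel,
      Action.ρ_one, Category.comp_id]

variable {ψ}

/-- Relative to the chosen coset representatives, translation from x to y by k is an element η of H
at the base point. Compatibility with translations thus reduces to the H-equivariance of ψ. -/
lemma extendApp_shiftHom (hψ : ∀ h : H,
      F.shiftHom (h : G) (x := basePt H 1) (y := basePt H 1) (smul_base h) ≫ ψ.hom =
        ψ.hom ≫ F'.shiftHom (h : G) (x := basePt H 1) (y := basePt H 1) (smul_base h))
    (k : G) (x y : ProdEG (G ⧸ H) G) (h : k • x.pt = y.pt) :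
    F.shiftHom k h ≫ (extendApp ψ y).hom = (extendApp ψ x).hom ≫ F'.shiftHom k h := by
  let η : H := ⟨y.pt.out⁻¹ * k * x.pt.out, mem_of_smul_base (by
    rw [mul_smul, mul_smul, out_smul_base, h, inv_out_smul])⟩
  have h₁ : F.shiftHom k h ≫ F.shiftHom y.pt.out⁻¹ (y := basePt H 1) (inv_out_smul y.pt) =
      F.shiftHom x.pt.out⁻¹ (y := basePt H 1) (inv_out_smul x.pt) ≫
        F.shiftHom (η : G) (x := basePt H 1) (y := basePt H 1) (smul_base η) := by
    rw [shiftHom_comp, shiftHom_comp]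
    exact F.shiftHom_congr (by simp [η, mul_assoc]) _
  have h₂ : F'.shiftHom x.pt.out (x := basePt H 1) (out_smul_base x.pt) ≫ F'.shiftHom k h =
      F'.shiftHom (η : G) (x := basePt H 1) (y := basePt H 1) (smul_base η) ≫
        F'.shiftHom y.pt.out (x := basePt H 1) (out_smul_base y.pt) := by
    rw [shiftHom_comp, shiftHom_comp]
    exact F'.shiftHom_congr (by simp [η, mul_assoc]) _
  rw [extendApp, extendApp, ← Category.assoc, h₁]
  simp only [Category.assoc]
  rw [h₂, ← Category.assoc _ ψ.hom, hψ, Category.assoc]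

/-- The representative chosen for the base coset need not be 1, but it lies in H; conjugating the
H-equivariant ψ by it changes nothing. -/
lemma extendApp_basePt (hψ : ∀ h : H,
      F.shiftHom (h : G) (x := basePt H 1) (y := basePt H 1) (smul_base h) ≫ ψ.hom =
        ψ.hom ≫ F'.shiftHom (h : G) (x := basePt H 1) (y := basePt H 1) (smul_base h)) :
    extendApp ψ (basePt H 1) = ψ := by
  refine Retractive.hom_ext _ _ ?_
  have h₀ : (((1 : G) : G ⧸ H).out : G) ∈ H := mem_of_smul_base (out_smul_base _)
  have hη := hψ ⟨_, H.inv_mem h₀⟩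
  change F.shiftHom _ (x := basePt H 1) (y := basePt H 1) (smul_base ⟨_, H.inv_mem h₀⟩) ≫
    ψ.hom ≫ F'.shiftHom _ (x := basePt H 1) (y := basePt H 1) (out_smul_base _) = ψ.hom
  rw [← Category.assoc, hη, Category.assoc, shiftHom_comp,
    F'.shiftHom_of_eq_one (by simp), Category.comp_id]

end Extend

instance : (eval X H).Full where
  map_surjective {F F'} φ := by
    let ψ : F.functor.obj (basePt H 1) ⟶ F'.functor.obj (basePt H 1) :=
      ⟨φ.hom.hom, congrArg Action.Hom.hom φ.i_hom, congrArg Action.Hom.hom φ.hom_p⟩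
    have hψ (h : H) : F.shiftHom (h : G) (x := basePt H 1) (y := basePt H 1) (smul_base h) ≫
        ψ.hom = ψ.hom ≫
          F'.shiftHom (h : G) (x := basePt H 1) (y := basePt H 1) (smul_base h) := by
      rw [← evalAct_hom, ← evalAct_hom]
      exact φ.hom.comm h
    refine ⟨EqFunctor.ofShiftHom (extendApp ψ) (extendApp_shiftHom hψ), ?_⟩
    exact Retractive.hom_ext _ _ (Action.hom_ext _ _
      (congrArg Retractive.Hom.hom (extendApp_basePt hψ)))

/-- Every point of G/H × EG is a translate of the base point, so naturality with respect to
translations recovers each component from the one there. -/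
instance : (eval X H).Faithful where
  map_injective {F F'} α β h := by
    have h₀ : (α.natTrans.app (basePt H 1)).hom = (β.natTrans.app (basePt H 1)).hom :=
      congrArg (fun φ => φ.hom.hom) h
    refine EqFunctor.hom_ext _ _ (NatTrans.ext (funext fun x => Retractive.hom_ext _ _ ?_))
    have e (γ : F ⟶ F') := shiftHom_natTrans γ x.pt.out⁻¹ (y := basePt H 1) (inv_out_smul x.pt)
    have e' (γ : F ⟶ F') : (γ.natTrans.app x).hom =
        F.shiftHom x.pt.out⁻¹ (y := basePt H 1) (inv_out_smul x.pt) ≫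
          (γ.natTrans.app (basePt H 1)).hom ≫
            F'.shiftHom x.pt.out (x := basePt H 1) (out_smul_base x.pt) := by
      rw [← Category.assoc, e γ, Category.assoc, shiftHom_comp,
        F'.shiftHom_of_eq_one (by simp), Category.comp_id]
    rw [e' α, e' β, h₀]

/-! ### Every equivariant retractive object is the value of an equivariant functor -/

section EssSurj

variable (H) in
/-- An equivariant choice of elements which carry the base point to the points of `G/H`. -/
def baseShift (x : ProdEG (G ⧸ H) G) : G := x.elt * (x.elt⁻¹ • x.pt).out

lemma baseShift_smul (x : ProdEG (G ⧸ H) G) : baseShift H x • ((1 : G) : G ⧸ H) = x.pt := by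
  rw [baseShift, mul_smul, out_smul_base, smul_inv_smul]

/-- Coset representatives cannot in general be chosen equivariantly on G/H, but on G/H × EG the
group coordinate makes this possible. Strict equivariance of `coind` rests on this. -/
lemma baseShift_shift (k : G) (x : ProdEG (G ⧸ H) G) :
    baseShift H ((shift (G ⧸ H) k).obj x) = k * baseShift H x := by
  change (k * x.elt) * ((k * x.elt)⁻¹ • k • x.pt).out = _
  rw [mul_inv_rev, mul_smul, inv_smul_smul, mul_assoc]
  rfl

/-- The element of `H` by which the morphism `x ⟶ y` acts. -/
def baseShiftDiff {x y : ProdEG (G ⧸ H) G} (f : x ⟶ y) : H :=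
  ⟨(baseShift H y)⁻¹ * baseShift H x, mem_of_smul_base (by
    rw [mul_smul, baseShift_smul, hom_eq f, inv_smul_eq_iff, baseShift_smul])⟩

lemma baseShiftDiff_id (x : ProdEG (G ⧸ H) G) : baseShiftDiff (𝟙 x) = 1 :=
  Subtype.ext (inv_mul_cancel _)

lemma baseShiftDiff_comp {x y z : ProdEG (G ⧸ H) G} (f : x ⟶ y) (g : y ⟶ z) :
    baseShiftDiff (f ≫ g) = baseShiftDiff g * baseShiftDiff f :=
  Subtype.ext (by simp [baseShiftDiff, mul_assoc])

variable (Y : Retractive (resObj X H))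

/-- The retractive object underlying an equivariant retractive object. -/
abbrev underlying : Retractive X.V := ⟨Y.obj.V, Y.i.hom, Y.p.hom, congrArg Action.Hom.hom Y.i_p⟩

/-- The action on the underlying retractive object. -/
def underlyingρ (h : H) : (underlying Y).obj ⟶ (underlying Y).obj := Y.obj.ρ h

lemma underlyingρ_mul (h k : H) : underlyingρ Y (h * k) = underlyingρ Y k ≫ underlyingρ Y h :=
  Retractive.ρ_mul_hom _ h k

lemma underlyingρ_one : underlyingρ Y 1 = 𝟙 _ := Action.ρ_one _

lemma ρ_underlying_i (h : H) :
    X.ρ (h : G) ≫ (underlying Y).i = (underlying Y).i ≫ underlyingρ Y h := Y.i.comm h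

lemma underlyingρ_p (h : H) :
    underlyingρ Y h ≫ (underlying Y).p = (underlying Y).p ≫ X.ρ (h : G) := Y.p.comm h

/-- The equivariant functor with a given value at the base point. -/
def coindFunctor : ProdEG (G ⧸ H) G ⥤ Retractive X.V where
  obj x := (act (baseShift H x)).obj (underlying Y)
  map {x y} f := ⟨underlyingρ Y (baseShiftDiff f), by
      change (X.ρ (baseShift H x)⁻¹ ≫ (underlying Y).i) ≫ underlyingρ Y _ =
        X.ρ (baseShift H y)⁻¹ ≫ (underlying Y).i
      rw [Category.assoc, ← ρ_underlying_i, ← Category.assoc, ← Retractive.ρ_mul_hom]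
      exact congrArg (fun g => X.ρ g ≫ (underlying Y).i) (mul_inv_cancel_right _ _), by
      change underlyingρ Y _ ≫ (underlying Y).p ≫ X.ρ (baseShift H y) =
        (underlying Y).p ≫ X.ρ (baseShift H x)
      rw [← Category.assoc, underlyingρ_p, Category.assoc, ← Retractive.ρ_mul_hom]
      exact congrArg (fun g => (underlying Y).p ≫ X.ρ g) (mul_inv_cancel_left _ _)⟩
  map_id x := Retractive.hom_ext _ _ (by
    change underlyingρ Y (baseShiftDiff (𝟙 x)) = 𝟙 _
    rw [baseShiftDiff_id, underlyingρ_one])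
  map_comp f g := Retractive.hom_ext _ _ (by
    change underlyingρ Y (baseShiftDiff (f ≫ g)) = underlyingρ Y _ ≫ underlyingρ Y _
    rw [baseShiftDiff_comp, underlyingρ_mul])

/-- The equivariant functor with a given value at the base point. -/
def coind : EqFunctor G (G ⧸ H) (Retractive X.V) where
  functor := coindFunctor Y
  equivariant k := CategoryTheory.Functor.ext
    (fun x => by
      change (act (baseShift H ((shift (G ⧸ H) k).obj x))).obj (underlying Y) = _
      rw [baseShift_shift, act_mul]
      rfl)
    (fun x y f => Retractive.hom_ext _ _ (by
      simp only [Retractive.comp_hom, Retractive.eqToHom_hom]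
      have : baseShiftDiff ((shift (G ⧸ H) k).map f) = baseShiftDiff f :=
        Subtype.ext (by
          change (baseShift H _)⁻¹ * baseShift H _ = (baseShift H y)⁻¹ * baseShift H x
          rw [baseShift_shift, baseShift_shift, mul_inv_rev, mul_assoc, inv_mul_cancel_left])
      change underlyingρ Y (baseShiftDiff ((shift (G ⧸ H) k).map f)) =
        𝟙 _ ≫ underlyingρ Y (baseShiftDiff f) ≫ 𝟙 _
      rw [this, Category.id_comp, Category.comp_id]))

variable (H) in
/-- The chosen element of `H` at the base point. -/
def baseElt : H := ⟨baseShift H (basePt H 1), mem_of_smul_base (baseShift_smul _)⟩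

/-- The element chosen at the base point lies in H but need not be 1, so the original action returns
conjugated. The comparison map `evalCoind` undoes the conjugation. -/
lemma eval_coind_ρ (h : H) :
    ((eval X H).obj (coind Y)).obj.ρ h = Y.obj.ρ ((baseElt H)⁻¹ * h * baseElt H) := by
  have e : ((eval X H).obj (coind Y)).obj.ρ h =
      𝟙 _ ≫ Y.obj.ρ (baseShiftDiff (baseHom H (h * 1) 1)) := by
    change (evalAct (coind Y) h).hom = _
    rw [evalAct, Retractive.comp_hom, Retractive.eqToHom_hom]
    rfl
  rw [e, Category.id_comp]
  congr 1
  refine Subtype.ext ?_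
  change (baseShift H _)⁻¹ * baseShift H (basePt H (h * 1)) = _
  rw [← shift_basePt, baseShift_shift, ← mul_assoc]
  rfl

/-- The comparison map of an equivariant retractive object with the value of its equivariant
functor. -/
def evalCoind : (eval X H).obj (coind Y) ⟶ Y where
  hom :=
    { hom := underlyingρ Y (baseElt H)
      comm := fun h => by
        rw [eval_coind_ρ]
        change underlyingρ Y _ ≫ underlyingρ Y _ = underlyingρ Y _ ≫ underlyingρ Y _
        rw [← underlyingρ_mul, ← underlyingρ_mul, mul_assoc, mul_inv_cancel_left] }
  i_hom := Action.hom_ext _ _ (by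
    change (X.ρ (baseElt H : G)⁻¹ ≫ (underlying Y).i) ≫ underlyingρ Y (baseElt H) =
      (underlying Y).i
    rw [Category.assoc, ← ρ_underlying_i, ← Category.assoc, ← Retractive.ρ_mul_hom,
      mul_inv_cancel, Action.ρ_one, Category.id_comp])
  hom_p := Action.hom_ext _ _ (Y.p.comm (baseElt H))

instance : (eval X H).EssSurj where
  mem_essImage Y := by
    have : IsIso (evalCoind Y).hom.hom := by
      change IsIso (underlyingρ Y (baseElt H))
      refine ⟨underlyingρ Y (baseElt H)⁻¹, ?_, ?_⟩
      · rw [← underlyingρ_mul, inv_mul_cancel, underlyingρ_one]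
      · rw [← underlyingρ_mul, mul_inv_cancel, underlyingρ_one]
    have := Action.isIso_of_hom_isIso (evalCoind Y).hom
    have := Retractive.isIso_of_hom (evalCoind Y)
    exact ⟨coind Y, ⟨asIso (evalCoind Y)⟩⟩

end EssSurj

instance : (eval X H).IsEquivalence where

end EvalEquivalence

/-! ### The value of a span on a homotopy fixed point -/

section SpanValue

open StrictAction ProdEG EqFunctor

variable {G : Type u} [Group G] {H K : Subgroup G} {S : Type v} [Finite S] [MulAction G S]
  (p : S →[G] G ⧸ H) (q : S →[G] G ⧸ K)

/-! ### The summands of the value of a span, and their universal property -/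

section FibMap

variable {D : Type*} [Category D] {X : Action D G} [HasFiniteCoproducts (Retractive X.V)]

/-- The value of a span on an equivariant functor. -/
abbrev spanObj (F : EqFunctor G (G ⧸ H) (Retractive X.V)) :
    EqFunctor G (G ⧸ K) (Retractive X.V) :=
  (pushforward _ q).obj ((EqFunctor.pullback _ p).obj F)

variable {q} (F : EqFunctor G (G ⧸ H) (Retractive X.V)) (j : Fib q ((1 : G) : G ⧸ K))

/-- The inclusion of a summand of the value of a span at the base point. -/
def summandIncl : F.functor.obj ⟨p j.1, 1⟩ ⟶ (spanObj p q F).functor.obj (basePt K 1) :=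
  pushIncl q ((EqFunctor.pullback _ p).obj F) (basePt K 1) j.1 j.2

/-- The map of the value at the base point to the value of a span at the base point, for an element
of the fibre. -/
def fibMap : (F.functor.obj (basePt H 1)).obj ⟶
    ((spanObj p q F).functor.obj (basePt K 1)).obj :=
  F.shiftHom (p j.1).out (x := basePt H 1) (y := ⟨p j.1, 1⟩) (out_smul_base _) ≫
    (summandIncl p F j).hom

lemma shiftHom_fibMap :
    F.shiftHom (p j.1).out⁻¹ (x := ⟨p j.1, 1⟩) (y := basePt H 1) (inv_out_smul _) ≫
      fibMap p F j = (summandIncl p F j).hom := by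
  rw [fibMap, ← Category.assoc, shiftHom_comp, F.shiftHom_of_eq_one (by simp), Category.id_comp]

lemma i_fibMap : (F.functor.obj (basePt H 1)).i ≫ fibMap p F j =
    X.ρ (p j.1).out ≫ ((spanObj p q F).functor.obj (basePt K 1)).i := by
  rw [fibMap, ← Category.assoc, i_shiftHom, Category.assoc, (summandIncl p F j).i_hom]

lemma fibMap_p : fibMap p F j ≫ ((spanObj p q F).functor.obj (basePt K 1)).p =
    (F.functor.obj (basePt H 1)).p ≫ X.ρ (p j.1).out := by
  rw [fibMap, Category.assoc, (summandIncl p F j).hom_p, shiftHom_p]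

/-- The origin of the cocycle: k takes the summand j to the summand kj, and once both are identified
with F(eH, e) through coset representatives, the map between them is the action of η ∈ H. -/
lemma fibMap_shiftHom (k : K) (j' : Fib q ((1 : G) : G ⧸ K)) (h : (k : G) • j.1 = j'.1)
    (η : G) (hη : η = (p j'.1).out⁻¹ * k * (p j.1).out)
    (hη' : η • ((1 : G) : G ⧸ H) = ((1 : G) : G ⧸ H)) :
    fibMap p F j ≫ (spanObj p q F).shiftHom (k : G) (x := basePt K 1) (y := basePt K 1)
      (smul_base k) =
      F.shiftHom η (x := basePt H 1) (y := basePt H 1) hη' ≫ fibMap p F j' := by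
  have hp : (k : G) • p j.1 = p j'.1 := by rw [← map_smul, h]
  have e : (summandIncl p F j).hom ≫ (spanObj p q F).shiftHom (k : G) (x := basePt K 1)
      (y := basePt K 1) (smul_base k) =
      F.shiftHom (k : G) (x := ⟨p j.1, 1⟩) (y := ⟨p j'.1, 1⟩) hp ≫ (summandIncl p F j').hom := by
    refine (pushIncl_shiftHom q ((EqFunctor.pullback _ p).obj F) (k : G) (x := basePt K 1)
      (y := basePt K 1) (smul_base k) j.1 j'.1 j.2 h j'.2).trans ?_
    exact congrArg (· ≫ _) (pullback_shiftHom p F (k : G) (x := ⟨j.1, 1⟩) (y := ⟨j'.1, 1⟩) h)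
  rw [fibMap, Category.assoc, e, fibMap, ← Category.assoc, ← Category.assoc, shiftHom_comp,
    shiftHom_comp]
  exact congrArg (· ≫ _) (F.shiftHom_congr (by rw [hη]; simp [mul_assoc]) _)

lemma fibMap_natTrans {F F' : EqFunctor G (G ⧸ H) (Retractive X.V)} (α : F ⟶ F') :
    fibMap p F j ≫ (((pushforward _ q).map ((EqFunctor.pullback _ p).map α)).natTrans.app
      (basePt K 1)).hom = (α.natTrans.app (basePt H 1)).hom ≫ fibMap p F' j := by
  have e := congrArg Retractive.Hom.hom
    (pushIncl_natTrans q ((EqFunctor.pullback _ p).map α) (basePt K 1) j.1 j.2)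
  rw [fibMap, Category.assoc, fibMap, ← Category.assoc _ _ (summandIncl p F' j).hom,
    ← shiftHom_natTrans, Category.assoc]
  exact congrArg (_ ≫ ·) e

variable [HasBinaryProducts D]

variable {F} in
-- The sum is a coproduct of retractive objects, whereas Z is a mere object with no map to X.
-- Replacing Z by Z × X, with section determined by the common restriction of g and g' to the base,
-- turns g and g' into morphisms of retractive objects.
lemma fibMap_hom_ext {Z : D} {g g' : ((spanObj p q F).functor.obj (basePt K 1)).obj ⟶ Z}
    (h : ∀ j, fibMap p F j ≫ g = fibMap p F j ≫ g')
    (hi : ((spanObj p q F).functor.obj (basePt K 1)).i ≫ g =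
      ((spanObj p q F).functor.obj (basePt K 1)).i ≫ g') : g = g' := by
  let P := (spanObj p q F).functor.obj (basePt K 1)
  let W : Retractive X.V := ⟨Z ⨯ X.V, prod.lift (P.i ≫ g) (𝟙 _), prod.snd, prod.lift_snd _ _⟩
  let γ : P ⟶ W := ⟨prod.lift g P.p, by rw [prod.comp_lift, P.i_p], prod.lift_snd _ _⟩
  let γ' : P ⟶ W := ⟨prod.lift g' P.p, by rw [prod.comp_lift, P.i_p, ← hi], prod.lift_snd _ _⟩
  have e : γ = γ' := by
    refine pushIncl_hom_ext q _ _ fun j hj => Retractive.hom_ext _ _ ?_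
    change (summandIncl p F ⟨j, hj⟩).hom ≫ prod.lift g P.p =
      (summandIncl p F ⟨j, hj⟩).hom ≫ prod.lift g' P.p
    rw [prod.comp_lift, prod.comp_lift, ← shiftHom_fibMap, Category.assoc, h, Category.assoc,
      Category.assoc]
  have := congrArg (fun f => f.hom ≫ prod.fst) e
  simpa only [γ, γ', prod.lift_fst] using this

/-- Again Z × X is made a retractive object, now with section (b, 1). The hypothesis says precisely
that the maps `a j`, translated back to the summands, respect the sections. -/
lemma exists_fibMap_desc {Z : D} (a : Fib q ((1 : G) : G ⧸ K) →
    ((F.functor.obj (basePt H 1)).obj ⟶ Z)) (b : X.V ⟶ Z)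
    (h : ∀ j, (F.functor.obj (basePt H 1)).i ≫ a j = X.ρ (p j.1).out ≫ b) :
    ∃ g : ((spanObj p q F).functor.obj (basePt K 1)).obj ⟶ Z,
      (∀ j, fibMap p F j ≫ g = a j) ∧
        ((spanObj p q F).functor.obj (basePt K 1)).i ≫ g = b := by
  let W : Retractive X.V := ⟨Z ⨯ X.V, prod.lift b (𝟙 _), prod.snd, prod.lift_snd _ _⟩
  let φ (j : S) (hj : q j = ((1 : G) : G ⧸ K)) : F.functor.obj ⟨p j, 1⟩ ⟶ W :=
    ⟨prod.lift (F.shiftHom (p j).out⁻¹ (x := ⟨p j, 1⟩) (y := basePt H 1) (inv_out_smul _) ≫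
      a ⟨j, hj⟩) (F.functor.obj ⟨p j, 1⟩).p, by
        rw [prod.comp_lift, Retractive.i_p, ← Category.assoc, i_shiftHom, Category.assoc, h,
          ← Category.assoc, ← Retractive.ρ_mul_hom, mul_inv_cancel, Action.ρ_one,
          Category.id_comp], prod.lift_snd _ _⟩
  obtain ⟨g, hg⟩ := exists_pushIncl_desc q ((EqFunctor.pullback _ p).obj F) (basePt K 1) φ
  have hg' (j : Fib q ((1 : G) : G ⧸ K)) : summandIncl p F j ≫ g = φ j.1 j.2 := hg j.1 j.2
  refine ⟨g.hom ≫ prod.fst, fun j => ?_, ?_⟩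
  · rw [fibMap, Category.assoc, ← Category.assoc _ g.hom, ← Retractive.comp_hom, hg']
    change _ ≫ prod.lift _ _ ≫ prod.fst = _
    rw [prod.lift_fst, ← Category.assoc, shiftHom_comp, F.shiftHom_of_eq_one (by simp),
      Category.id_comp]
  · rw [← Category.assoc, g.i_hom]
    exact prod.lift_fst _ _

end FibMap

/-! ### The transfer along a span -/

/-- The fibre of `q` over the base point, as a finite set of indices. -/
def FibIndex : Type := Fin (Nat.card (Fib q ((1 : G) : G ⧸ K)))

instance : Finite (FibIndex q) := inferInstanceAs (Finite (Fin _))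

/-- The element of the fibre with a given index. -/
def fibEquiv : FibIndex q ≃ Fib q ((1 : G) : G ⧸ K) := (Finite.equivFin _).symm

instance : MulAction K (Fib q ((1 : G) : G ⧸ K)) where
  smul k j := ⟨(k : G) • j.1, by rw [map_smul, j.2, smul_base]⟩
  one_smul j := Subtype.ext (one_smul G j.1)
  mul_smul k l j := Subtype.ext (mul_smul (k : G) (l : G) j.1)

instance : MulAction K (FibIndex q) := (fibEquiv q).mulAction K

lemma fibEquiv_smul (k : K) (i : FibIndex q) :
    (fibEquiv q (k • i)).1 = (k : G) • (fibEquiv q i).1 := by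
  have : fibEquiv q (k • i) = k • fibEquiv q i := (fibEquiv q).apply_symm_apply _
  rw [this]
  rfl

variable {q} in
/-- The chosen element of `G` which carries the base point to the image of an element of the
fibre. -/
abbrev fibShift (i : FibIndex q) : G := (p (fibEquiv q i).1).out

/-- The cocycle of a span. -/
def spanCocycle : Cocycle H K (FibIndex q) where
  toFun k i := ⟨(fibShift p (k • i))⁻¹ * k * fibShift p i, mem_of_smul_base (by
    rw [mul_smul, mul_smul, out_smul_base, ← map_smul, ← fibEquiv_smul, inv_out_smul])⟩
  map_mul k l i := Subtype.ext (by
    simp only [Subgroup.coe_mul, mul_smul, mul_assoc, mul_inv_cancel_left])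

/-- The defining relation g_{kj} c(k, j) = k g_j, which makes the base change (j, x) ↦ g_j x
equivariant. -/
lemma fibShift_mul (k : K) (i : FibIndex q) :
    fibShift p (k • i) * (spanCocycle p q).toFun k i = k * fibShift p i := by
  simp only [spanCocycle, mul_assoc, mul_inv_cancel_left]

variable (X : Action TopCat.{u} G)

/-- The change of base of a span. -/
def spanBase : (spanCocycle p q).twist.obj (resObj X H) ⟶ resObj X K :=
  (spanCocycle p q).twistDesc (Y := resObj X H) (W := resObj X K)
    (fun i x => (X.ρ (fibShift p i)).hom x) (fun i => (X.ρ (fibShift p i)).hom.continuous)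
    fun k i (x : X.V) => by
      have h := congrArg (fun g => (X.ρ g).hom x) (fibShift_mul p q k i)
      simp only [ρ_mul_apply] at h
      exact h

variable {X} (F : EqFunctor G (G ⧸ H) (Retractive X.V))

/-- The map of the twisted product to the value of a span. -/
def spanMap : (spanCocycle p q).twist.obj ((eval X H).obj F).obj ⟶
    ((eval X K).obj ((spanAction X p q).obj F)).obj :=
  (spanCocycle p q).twistDesc (Y := ((eval X H).obj F).obj)
    (W := ((eval X K).obj ((spanAction X p q).obj F)).obj)
    (fun i y => (fibMap p F (fibEquiv q i)).hom y)
    (fun i => (fibMap p F (fibEquiv q i)).hom.continuous)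
    fun k i y => by
      rw [eval_ρ, eval_ρ]
      exact (ConcreteCategory.congr_hom (fibMap_shiftHom p F (fibEquiv q i) k
        (fibEquiv q (k • i)) (fibEquiv_smul q k i).symm _ rfl
          (smul_base ((spanCocycle p q).toFun k i))) y).symm

lemma spanMap_natural {F F' : EqFunctor G (G ⧸ H) (Retractive X.V)} (α : F ⟶ F') :
    spanMap p q F ≫ ((eval X K).map ((spanAction X p q).map α)).hom =
      (spanCocycle p q).twist.map ((eval X H).map α).hom ≫ spanMap p q F' :=
  (spanCocycle p q).twist_hom_ext fun i y =>
    ConcreteCategory.congr_hom (fibMap_natTrans p (fibEquiv q i) α) y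

/-- The value of a span is a transfer. -/
lemma isTransfer_spanMap : IsTransfer (spanCocycle p q) (spanBase p q X) ((eval X H).obj F)
    ((eval X K).obj ((spanAction X p q).obj F)) (spanMap p q F) where
  comp_p := (spanCocycle p q).twist_hom_ext fun i y =>
    ConcreteCategory.congr_hom (fibMap_p p F (fibEquiv q i)) y
  isPushout := by
    have w : (spanCocycle p q).twist.map ((eval X H).obj F).i ≫ spanMap p q F =
        spanBase p q X ≫ ((eval X K).obj ((spanAction X p q).obj F)).i :=
      (spanCocycle p q).twist_hom_ext fun i y =>
        ConcreteCategory.congr_hom (i_fibMap p F (fibEquiv q i)) y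
    -- The pushout property may be checked on underlying spaces. There a cocone is a family of maps
    -- out of F(eH, e), one for each point of the fibre, together with a map out of X that agrees
    -- with them on the base; this is the input of `exists_fibMap_desc`.
    refine IsPushout.of_map (Action.forget TopCat.{u} K) w
      (IsPushout.of_isColimit
        (c := PushoutCocone.mk _ _ (congrArg Action.Hom.hom w))
        (PushoutCocone.isColimitAux' _ fun s => ?_))
    let a (j : Fib q ((1 : G) : G ⧸ K)) : (F.functor.obj (basePt H 1)).obj ⟶ s.pt :=
      TopCat.ofHom ⟨fun y => s.inl ((spanCocycle p q).twistPt ((fibEquiv q).symm j)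
        (Y := ((eval X H).obj F).obj) y), s.inl.hom.continuous.comp
          ((spanCocycle p q).continuous_twistPt _ (Y := ((eval X H).obj F).obj))⟩
    have ha (i : FibIndex q) (y : ((eval X H).obj F).obj.V) : a (fibEquiv q i) y =
        s.inl ((spanCocycle p q).twistPt i (Y := ((eval X H).obj F).obj) y) := by
      change s.inl ((spanCocycle p q).twistPt ((fibEquiv q).symm (fibEquiv q i))
        (Y := ((eval X H).obj F).obj) y) = _
      rw [Equiv.symm_apply_apply]
    have h (j : Fib q ((1 : G) : G ⧸ K)) :
        (F.functor.obj (basePt H 1)).i ≫ a j = X.ρ (p j.1).out ≫ s.inr := by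
      obtain ⟨i, rfl⟩ := (fibEquiv q).surjective j
      refine TopCat.hom_ext (ContinuousMap.ext fun x => ?_)
      refine (ha i _).trans ?_
      exact ConcreteCategory.congr_hom s.condition
        ((spanCocycle p q).twistPt i (Y := resObj X H) x)
    let e := exists_fibMap_desc p F a s.inr h
    refine ⟨e.choose, ?_, e.choose_spec.2, fun {m} h₁ h₂ => ?_⟩
    · refine TopCat.hom_ext (ContinuousMap.ext fun z => ?_)
      refine (ConcreteCategory.congr_hom (e.choose_spec.1 (fibEquiv q z.1)) z.2).trans ?_
      exact ha z.1 z.2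
    · refine fibMap_hom_ext p (fun j => ?_) (h₂.trans e.choose_spec.2.symm)
      rw [e.choose_spec.1]
      obtain ⟨i, rfl⟩ := (fibEquiv q).surjective j
      refine TopCat.hom_ext (ContinuousMap.ext fun y => ?_)
      refine Eq.trans ?_ (ha i y).symm
      exact ConcreteCategory.congr_hom h₁
        ((spanCocycle p q).twistPt i (Y := ((eval X H).obj F).obj) y)

end SpanValue

/-! ### Pushouts and zero objects of retractive objects -/

lemma isPushout_of_exists {C : Type*} [Category C] {Y Z W V : C} {f : Y ⟶ Z} {g : Y ⟶ W}
    {g' : Z ⟶ V} {f' : W ⟶ V} (w : f ≫ g' = g ≫ f')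
    (hex : ∀ {S : C} (a : Z ⟶ S) (b : W ⟶ S), f ≫ a = g ≫ b →
      ∃ m : V ⟶ S, g' ≫ m = a ∧ f' ≫ m = b)
    (hext : ∀ {S : C} (m m' : V ⟶ S), g' ≫ m = g' ≫ m' → f' ≫ m = f' ≫ m' → m = m') :
    IsPushout f g g' f' :=
  IsPushout.of_isColimit (c := PushoutCocone.mk g' f' w) (PushoutCocone.isColimitAux' _ fun s =>
    have h := (hex s.inl s.inr s.condition).choose_spec
    ⟨_, h.1, h.2, fun {_} h₁ h₂ => hext _ _ (h₁.trans h.1.symm) (h₂.trans h.2.symm)⟩)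

namespace Retractive

variable {D : Type*} [Category D] {A : D}

variable (A) in
/-- The functor which sends a retractive object to its total object. -/
def forget : Retractive A ⥤ D where
  obj Y := Y.obj
  map f := f.hom

lemma isPushout_of_hom {Y Z W V : Retractive A} {f : Y ⟶ Z} {g : Y ⟶ W} {f' : W ⟶ V} {g' : Z ⟶ V}
    (h : IsPushout f.hom g.hom g'.hom f'.hom) : IsPushout f g g' f' := by
  refine isPushout_of_exists (hom_ext _ _ h.w) (fun {S} a b hab => ?_) fun {S} m m' h₁ h₂ => ?_
  · refine ⟨⟨h.desc a.hom b.hom (congrArg Hom.hom hab), ?_, ?_⟩, ?_, ?_⟩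
    · rw [← g'.i_hom, Category.assoc, h.inl_desc, a.i_hom]
    · exact h.hom_ext (by rw [h.inl_desc_assoc, a.hom_p, g'.hom_p])
        (by rw [h.inr_desc_assoc, b.hom_p, f'.hom_p])
    · exact hom_ext _ _ (h.inl_desc _ _ _)
    · exact hom_ext _ _ (h.inr_desc _ _ _)
  · exact hom_ext _ _ (h.hom_ext (congrArg Hom.hom h₁) (congrArg Hom.hom h₂))

/-- The pushout of the total objects inherits a section and a projection, and is then a pushout of
retractive objects; by uniqueness it is the given one. -/
lemma isPushout_hom [HasPushouts D] {Y Z W V : Retractive A} {f : Y ⟶ Z} {g : Y ⟶ W} {f' : W ⟶ V}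
    {g' : Z ⟶ V} (h : IsPushout f g g' f') : IsPushout f.hom g.hom g'.hom f'.hom := by
  let V' : Retractive A := ⟨pushout f.hom g.hom, Z.i ≫ pushout.inl _ _,
    pushout.desc Z.p W.p (by rw [f.hom_p, g.hom_p]), by
      rw [Category.assoc, pushout.inl_desc, Z.i_p]⟩
  let a : Z ⟶ V' := ⟨pushout.inl _ _, rfl, pushout.inl_desc _ _ _⟩
  let b : W ⟶ V' := ⟨pushout.inr _ _, by
    rw [← g.i_hom, Category.assoc, ← pushout.condition, ← Category.assoc, f.i_hom],
    pushout.inr_desc _ _ _⟩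
  have h₀ : IsPushout f.hom g.hom a.hom b.hom := IsPushout.of_hasPushout _ _
  have h' : IsPushout f g a b := isPushout_of_hom h₀
  refine IsPushout.of_iso h₀ (Iso.refl _) (Iso.refl _) (Iso.refl _)
    ((forget A).mapIso (h'.isoIsPushout _ _ h)) ?_ ?_ ?_ ?_
  · exact (Category.comp_id _).trans (Category.id_comp _).symm
  · exact (Category.comp_id _).trans (Category.id_comp _).symm
  · exact (congrArg Hom.hom (h'.inl_isoIsPushout_hom _ _ h)).trans (Category.id_comp _).symm
  · exact (congrArg Hom.hom (h'.inr_isoIsPushout_hom _ _ h)).trans (Category.id_comp _).symm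

lemma isZero_of_isIso_i (Y : Retractive A) [IsIso Y.i] : IsZero Y where
  unique_to Z := ⟨⟨⟨⟨Y.p ≫ Z.i, by rw [← Category.assoc, Y.i_p, Category.id_comp],
    by rw [Category.assoc, Z.i_p, Category.comp_id]⟩⟩, fun f => hom_ext _ _ (by
      rw [← cancel_epi Y.i, f.i_hom]
      exact (by rw [← Category.assoc, Y.i_p, Category.id_comp] : Z.i = Y.i ≫ Y.p ≫ Z.i))⟩⟩
  unique_from Z := ⟨⟨⟨⟨Z.p ≫ Y.i, by rw [← Category.assoc, Z.i_p, Category.id_comp],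
    by rw [Category.assoc, Y.i_p, Category.comp_id]⟩⟩, fun f => hom_ext _ _ (by
      have : IsIso Y.p := by
        have := Y.i_p
        rw [← IsIso.eq_inv_comp, Category.comp_id] at this
        rw [this]
        infer_instance
      rw [← cancel_mono Y.p, f.hom_p]
      exact (by rw [Category.assoc, Y.i_p, Category.comp_id] : Z.p = (Z.p ≫ Y.i) ≫ Y.p))⟩⟩

/-- The composite Y.p ≫ Y.i is an endomorphism of Y, so for a zero object it is the identity. -/
lemma isIso_i_of_isZero {Y : Retractive A} (h : IsZero Y) : IsIso Y.i := by
  let f : Y ⟶ Y := ⟨Y.p ≫ Y.i, by rw [← Category.assoc, Y.i_p, Category.id_comp],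
    by rw [Category.assoc, Y.i_p, Category.comp_id]⟩
  exact ⟨Y.p, Y.i_p, congrArg Hom.hom (h.eq_of_src f (𝟙 Y))⟩

variable (A) in
lemma exists_isZero : ∃ Y : Retractive A, IsZero Y := by
  let Y : Retractive A := ⟨A, 𝟙 A, 𝟙 A, Category.comp_id _⟩
  have : IsIso Y.i := inferInstanceAs (IsIso (𝟙 A))
  exact ⟨Y, Y.isZero_of_isIso_i⟩

end Retractive

lemma isZero_obj_of_isEquivalence {C D : Type*} [Category C] [Category D] (F : C ⥤ D)
    [F.IsEquivalence] {Z : D} (hZ : IsZero Z) {Y : C} (hY : IsZero Y) : IsZero (F.obj Y) := by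
  have h : IsZero (F.obj (F.objPreimage Z)) := (F.objObjPreimageIso Z).isZero_iff.2 hZ
  have h' : IsZero (F.objPreimage Z) := IsZero.of_full_of_faithful_of_isZero F _ h
  exact (F.mapIso (hY.iso h')).isZero_iff.2 h

namespace IsTransfer

variable {H K : Type u} [Group H] [Group K] {T : Type} [MulAction K T] {c : Cocycle H K T}
  {A : Action TopCat.{u} H} {A' : Action TopCat.{u} K} {d : c.twist.obj A ⟶ A'}

lemma isZero {Y : Retractive A} {P : Retractive A'} {η : c.twist.obj Y.obj ⟶ P.obj}
    (hP : IsTransfer c d Y P η) (hY : IsZero Y) : IsZero P := by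
  have := Retractive.isIso_i_of_isZero hY
  have : IsIso P.i := hP.isPushout.isIso_inr_of_isIso
  exact P.isZero_of_isIso_i

/-- Transfers preserve pushouts. -/
lemma isPushout_map {Y Z W V : Retractive A} {P Q R U : Retractive A'}
    {ηY : c.twist.obj Y.obj ⟶ P.obj} {ηZ : c.twist.obj Z.obj ⟶ Q.obj}
    {ηW : c.twist.obj W.obj ⟶ R.obj} {ηV : c.twist.obj V.obj ⟶ U.obj}
    (hP : IsTransfer c d Y P ηY) (hQ : IsTransfer c d Z Q ηZ) (hR : IsTransfer c d W R ηW)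
    (hU : IsTransfer c d V U ηV) {f : Y ⟶ Z} {g : Y ⟶ W} {f' : W ⟶ V} {g' : Z ⟶ V}
    {φ : P ⟶ Q} {γ : P ⟶ R} {φ' : R ⟶ U} {γ' : Q ⟶ U}
    (hφ : ηY ≫ φ.hom = c.twist.map f.hom ≫ ηZ) (hγ : ηY ≫ γ.hom = c.twist.map g.hom ≫ ηW)
    (hφ' : ηW ≫ φ'.hom = c.twist.map f'.hom ≫ ηV) (hγ' : ηZ ≫ γ'.hom = c.twist.map g'.hom ≫ ηV)
    (h : IsPushout f g g' f') : IsPushout φ γ γ' φ' := by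
  have h₀ := (Retractive.isPushout_hom h).map c.twist
  have w : φ.hom ≫ γ'.hom = γ.hom ≫ φ'.hom := by
    refine hP.isPushout.hom_ext ?_ ?_
    · rw [← Category.assoc, hφ, Category.assoc, hγ', ← Category.assoc ηY, hγ, Category.assoc, hφ',
        ← Category.assoc, h₀.w, Category.assoc]
    · rw [← Category.assoc, φ.i_hom, γ'.i_hom, ← Category.assoc, γ.i_hom, φ'.i_hom]
  refine Retractive.isPushout_of_hom (isPushout_of_exists w (fun a b hab => ?_)
    fun m m' h₁ h₂ => ?_)
  · have e₁ : c.twist.map f.hom ≫ ηZ ≫ a = c.twist.map g.hom ≫ ηW ≫ b := by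
      rw [← Category.assoc, ← hφ, Category.assoc, hab, ← Category.assoc, hγ, Category.assoc]
    -- A map out of U is a map out of the twisted product of V and one out of A' that agree on the
    -- twisted base. The first comes from the twisted pushout square `h₀`; the second is a
    -- restricted along Q.i, which by `e₃` is also b restricted along R.i.
    have e₂ : c.twist.map V.i ≫ h₀.desc (ηZ ≫ a) (ηW ≫ b) e₁ = d ≫ Q.i ≫ a := by
      rw [← g'.i_hom, c.twist.map_comp, Category.assoc, h₀.inl_desc, ← Category.assoc,
        hQ.isPushout.w, Category.assoc]
    have e₃ : Q.i ≫ a = R.i ≫ b := by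
      rw [← φ.i_hom, Category.assoc, hab, ← Category.assoc, γ.i_hom]
    refine ⟨hU.isPushout.desc _ _ e₂, hQ.isPushout.hom_ext ?_ ?_, hR.isPushout.hom_ext ?_ ?_⟩
    · rw [← Category.assoc, hγ', Category.assoc, hU.isPushout.inl_desc, h₀.inl_desc]
    · rw [← Category.assoc, γ'.i_hom, hU.isPushout.inr_desc]
    · rw [← Category.assoc, hφ', Category.assoc, hU.isPushout.inl_desc, h₀.inr_desc]
    · rw [← Category.assoc, φ'.i_hom, hU.isPushout.inr_desc, e₃]
  · refine hU.isPushout.hom_ext (h₀.hom_ext ?_ ?_) ?_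
    · rw [← Category.assoc, ← hγ', Category.assoc, h₁, ← Category.assoc, hγ', Category.assoc]
    · rw [← Category.assoc, ← hφ', Category.assoc, h₂, ← Category.assoc, hφ', Category.assoc]
    · rw [← γ'.i_hom, Category.assoc, h₁, Category.assoc]

end IsTransfer

/-! ### Transfers of homotopy finite retractive spaces -/

section HomotopyFinite

variable {H K : Type u} [Group H] [Group K] {T : Type} [MulAction K T] (c : Cocycle H K T)
  {A : Action TopCat.{u} H} {A' : Action TopCat.{u} K} (d : c.twist.obj A ⟶ A')

/-- The transfer of a retractive space. -/
def transferObj (Y : Retractive A) : Retractive A' where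
  obj := pushout (c.twist.map Y.i) d
  i := pushout.inr _ _
  p := pushout.desc (c.twist.map Y.p ≫ d) (𝟙 A') (by
    rw [← Category.assoc, ← c.twist.map_comp, Y.i_p, c.twist.map_id, Category.id_comp,
      Category.comp_id])
  i_p := pushout.inr_desc _ _ _

/-- The map of the twisted product to the transfer. -/
def transferMap (Y : Retractive A) : c.twist.obj Y.obj ⟶ (transferObj c d Y).obj :=
  pushout.inl _ _

lemma isTransfer_transferMap (Y : Retractive A) :
    IsTransfer c d Y (transferObj c d Y) (transferMap c d Y) where
  isPushout := IsPushout.of_hasPushout _ _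
  comp_p := pushout.inl_desc _ _ _

namespace IsTransfer

variable {c d} {Y Z W : Retractive A} {P Q R : Retractive A'} {η : c.twist.obj Y.obj ⟶ P.obj}
  {θ : c.twist.obj Z.obj ⟶ Q.obj} {ζ : c.twist.obj W.obj ⟶ R.obj}

/-- The map of transfers induced by a map of retractive spaces. -/
def map (hP : IsTransfer c d Y P η) (hQ : IsTransfer c d Z Q θ) (f : Y ⟶ Z) : P ⟶ Q where
  hom := hP.desc hQ f.hom f.i_hom
  i_hom := hP.inr_desc hQ f.hom f.i_hom
  hom_p := by
    refine hP.isPushout.hom_ext ?_ ?_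
    · rw [← Category.assoc, inl_desc, Category.assoc, hQ.comp_p, hP.comp_p, ← Category.assoc,
        ← c.twist.map_comp, f.hom_p]
    · rw [← Category.assoc, inr_desc, Q.i_p, P.i_p]

lemma map_hom (hP : IsTransfer c d Y P η) (hQ : IsTransfer c d Z Q θ) (f : Y ⟶ Z) :
    η ≫ (hP.map hQ f).hom = c.twist.map f.hom ≫ θ :=
  hP.inl_desc hQ f.hom f.i_hom

lemma map_id (hP : IsTransfer c d Y P η) : hP.map hP (𝟙 Y) = 𝟙 P := by
  refine Retractive.hom_ext _ _ (hP.isPushout.hom_ext ?_ ?_)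
  · rw [map_hom]
    change c.twist.map (𝟙 _) ≫ η = η ≫ 𝟙 _
    rw [c.twist.map_id, Category.id_comp, Category.comp_id]
  · rw [Retractive.Hom.i_hom, Retractive.Hom.i_hom]

lemma map_comp (hP : IsTransfer c d Y P η) (hQ : IsTransfer c d Z Q θ) (hR : IsTransfer c d W R ζ)
    (f : Y ⟶ Z) (g : Z ⟶ W) : hP.map hR (f ≫ g) = hP.map hQ f ≫ hQ.map hR g := by
  refine Retractive.hom_ext _ _ (hP.isPushout.hom_ext ?_ ?_)
  · rw [map_hom, Retractive.comp_hom, Retractive.comp_hom, ← Category.assoc η, map_hom,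
      Category.assoc, map_hom, c.twist.map_comp, Category.assoc]
  · rw [Retractive.Hom.i_hom, Retractive.Hom.i_hom]

/-- Transfers of the same retractive space are isomorphic. -/
def iso {P' : Retractive A'} {η' : c.twist.obj Y.obj ⟶ P'.obj} (hP : IsTransfer c d Y P η)
    (hP' : IsTransfer c d Y P' η') : P ≅ P' where
  hom := hP.map hP' (𝟙 Y)
  inv := hP'.map hP (𝟙 Y)
  hom_inv_id := by rw [← map_comp, Category.comp_id, map_id]
  inv_hom_id := by rw [← map_comp, Category.comp_id, map_id]

end IsTransfer

/-- The transfer, as a functor between categories of relative cell complexes. -/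
def cellTransfer : (isCellComplex A).FullSubcategory ⥤ (isCellComplex A').FullSubcategory :=
  ObjectProperty.lift _
    { obj := fun Y => transferObj c d Y.obj
      map := fun {Y Z} f => (isTransfer_transferMap c d Y.obj).map
        (isTransfer_transferMap c d Z.obj) f.hom
      map_id := fun Y => (isTransfer_transferMap c d Y.obj).map_id
      map_comp := fun {Y Z W} f g => (isTransfer_transferMap c d Y.obj).map_comp
        (isTransfer_transferMap c d Z.obj) (isTransfer_transferMap c d W.obj) f.hom g.hom }
    fun Y => (isTransfer_transferMap c d Y.obj).isCellComplex Y.property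

/-- The transfer is known to preserve weak equivalences only between relative cell complexes, which
is why it is viewed as a functor between these subcategories before localizing. -/
lemma cellTransfer_isInvertedBy :
    (cellWeq A).IsInvertedBy (cellTransfer c d ⋙ (cellWeq A').Q) := fun Y Z f hf =>
  Localization.inverts (cellWeq A').Q (cellWeq A') ((cellTransfer c d).map f)
    ((isTransfer_transferMap c d Y.obj).fixedWeq (isTransfer_transferMap c d Z.obj)
      (IsTransfer.map_hom _ _ _) Y.property Z.property hf)

-- The transfer induces a functor on localizations, and functors preserve retracts. The retract
-- obtained is the model `transferObj`, which is isomorphic to P because transfers are unique.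
variable {c d} in
lemma IsTransfer.isHomotopyFinite [Finite T] [Finite H] {Y : Retractive A} {P : Retractive A'}
    {η : c.twist.obj Y.obj ⟶ P.obj} (hP : IsTransfer c d Y P η) (hY : isHomotopyFinite A Y) :
    SpanTransfer.isHomotopyFinite A' P := by
  obtain ⟨hY, Z, hZ, ⟨r⟩⟩ := hY
  have hP' : SpanTransfer.isCellComplex A' P := hP.isCellComplex hY
  let L := Localization.Construction.lift _ (cellTransfer_isInvertedBy c d)
  let r' : Retract ((cellWeq A').Q.obj ((cellTransfer c d).obj ⟨Y, hY⟩))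
      ((cellWeq A').Q.obj ((cellTransfer c d).obj Z)) := r.map L
  let e : (⟨P, hP'⟩ : (SpanTransfer.isCellComplex A').FullSubcategory) ≅
      (cellTransfer c d).obj ⟨Y, hY⟩ :=
    (SpanTransfer.isCellComplex A').isoMk (hP.iso (isTransfer_transferMap c d Y))
  exact ⟨hP', (cellTransfer c d).obj Z,
    (isTransfer_transferMap c d Z.obj).isFiniteCellComplex hZ,
    ⟨(Retract.ofIso ((cellWeq A').Q.mapIso e)).trans r'⟩⟩

end HomotopyFinite

end

end SpanTransfer

theorem mainTheorem8 {G : Type u} [Group G] [Finite G] (X : Action TopCat.{u} G)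
    (H K : Subgroup G) {S : Type v} [Finite S] [MulAction G S]
    (p : S →[G] G ⧸ H) (q : S →[G] G ⧸ K) :
    SpanTransfer.RestrictsToExact (SpanTransfer.spanAction X p q)
      (SpanTransfer.hfObj X H) (SpanTransfer.hfCof X H) (SpanTransfer.hfWeq X H)
      (SpanTransfer.hfObj X K) (SpanTransfer.hfCof X K) (SpanTransfer.hfWeq X K) := by
  have tr := SpanTransfer.isTransfer_spanMap p q (X := X)
  exact
    { map_mem := fun Y hY => (tr Y).isHomotopyFinite hY
      -- Zero objects and pushouts refer to the categories of equivariant functors, so they are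
      -- moved to equivariant retractive spaces and back along the equivalences `eval`. Cofibrations
      -- and weak equivalences are defined through `eval` already.
      map_zero := fun Y _ hY => IsZero.of_full_of_faithful_of_isZero (SpanTransfer.eval X K) _
        ((tr Y).isZero
          (SpanTransfer.isZero_obj_of_isEquivalence (SpanTransfer.eval X H)
            (SpanTransfer.Retractive.exists_isZero _).choose_spec hY))
      map_cof := fun {Y Z} f _ _ hf =>
        (tr Y).fhep (tr Z) (SpanTransfer.spanMap_natural p q f) hf
      map_weq := fun {Y Z} f hY hZ hf =>
        -- Of homotopy finiteness, only the underlying relative cell complex structure is used here.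
        (tr Y).fixedWeq (tr Z) (SpanTransfer.spanMap_natural p q f) hY.choose hZ.choose hf
      map_pushout := fun {Y Z W V f g f' g'} _ _ _ _ h =>
        ((tr Y).isPushout_map (tr Z) (tr W) (tr V) (SpanTransfer.spanMap_natural p q f)
          (SpanTransfer.spanMap_natural p q g) (SpanTransfer.spanMap_natural p q f')
          (SpanTransfer.spanMap_natural p q g')
          (h.map (SpanTransfer.eval X H))).of_map_of_faithful (SpanTransfer.eval X K) }
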